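/- Let $n\ge 1$ and let $N=2n$ or $N=2n-1$. Fix $q\in(0,1)$ and positive real numbers $a_1,\dots,a_n$, and put $\bar a_{2l-1}=a_l$, $\bar a_{2l}=a_l^{-1}$. Let $\mathcal W_0^n=\{z\in\mathbb Z^n: z_1\ge\dots\ge z_n\ge 0\}$, and let $\mathbb K_0^N$ be the set of symplectic Gelfand–Tsetlin patterns $\mathbf z=(z^1,\dots,z^N)$, where $z^k\in\mathbb Z_{\ge 0}^{\lfloor (k+1)/2\rfloor}$ and consecutive levels interlace, $z^{k}_1\ge z^{k-1}_1\ge z^{k}_2\ge z^{k-1}_2\ge\cdots$ for $2\le k\le N$. Throughout, $z^k_0=\infty$ (so that $q^{z^k_0-x}=0$) and $z^k_j=0$ for $j>\lfloor (k+1)/2\rfloor$, also for $k=0$ (the empty level). A fraction $\frac{1-q^{\infty}}{1-q^{\infty}}$ is read as $1$. **The process.** Let $\mathbf Z=(\mathbf Z(t);t\ge 0)$ be the continuous-time Markov chain (with right-continuous, piecewise constant paths having left limits) on $\mathbb K_0^N$ with the following transitions. For $1\le k\le N$, $1\le j\le\lfloor (k+1)/2\rfloor$, the particle $Z^k_j$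 independently * jumps one step to the right at rate $\bar a_k R_j(Z^k;Z^{k-1})$, where $R_j(y;x)=(1-q^{x_{j-1}-y_j})\dfrac{1-q^{y_j-y_{j+1}+1}}{1-q^{y_j-x_j+1}}$; * jumps one step to the left at rate $\bar a_k^{-1}L_j(Z^k;Z^{k-1})$, where $L_j(y;x)=(1-q^{y_j-x_j})\dfrac{1-q^{y_{j-1}-y_j+1}}{1-q^{x_{j-1}-y_j+1}}$. Whenever $Z^k_j$ moves to the right (of its own accord or because it is pushed) from a position with $Z^k_j=Z^{k+1}_j$, $k<N$, the particle $Z^{k+1}_j$ is simultaneously pushed one step to the right; whenever $Z^k_j$ moves to the left from a position where the particle $Z^{k+1}_{j+1}$ exists, $k<N$, and $Z^k_j=Z^{k+1}_{j+1}$, the particle $Z^{k+1}_{j+1}$ is simultaneously pushed one step to the left. **Weights.** With $m!_q=\prod_{k=1}^m\frac{1-q^k}{1-q}$, $\binom{m}{k}_q=\frac{m!_q}{k!_q(m-k)!_q}$ and $|z^k|=\sum_i z^k_i$ ($|z^0|=0$), let, for $k=2l$ or $k=2l-1$, $$\Lambda_k(z^{k-1},z^k)=\bar a_k^{|z^k|-|z^{k-1}|}\prod_{i=1}^{l-1}\binom{z^k_i-z^k_{i+1}}{z^k_i-z^{k-1}_i}_q\Big(\mathbf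 1_{\{k=2l-1\}}+\binom{z^k_l}{z^k_l-z^{k-1}_l}_q\mathbf 1_{\{k=2l\}}\Big),$$ $$w^{(N)}_{a,q}(\mathbf z)=\prod_{k=1}^N\Lambda_k(z^{k-1},z^k),\qquad \hat{\mathcal P}^{(N)}_z(a;q)=\sum_{\mathbf z\in\mathbb K_0^N:\,z^N=z}w^{(N)}_{a,q}(\mathbf z),$$ and let $M^{(N)}_{a,q}(\cdot;z)=w^{(N)}_{a,q}(\cdot)/\hat{\mathcal P}^{(N)}_z(a;q)$, a probability measure on the patterns with bottom level $z^N=z$. **Theorem.** Suppose that $\mathbf Z$ has initial distribution $M^{(N)}_{a,q}(\cdot;z)$ for some $z\in\mathcal W_0^n$. Then the bottom level $Z^N=(Z^N(t);t\ge 0)$ is a continuous-time Markov chain on $\mathcal W_0^n$, started at $z$, with transition rates given for $z\ne z'$ by $$Q^q_N(z,z')=\frac{\hat{\mathcal P}^{(N)}_{z'}(a;q)}{\hat{\mathcal P}^{(N)}_{z}(a;q)}\,f_N(z,z'),\qquad f_N(z,z')=\begin{cases}1-q^{z_{i-1}-z_i}&\text{if }z'-z=e_i,\ 1\le i\le n,\\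 1-q^{z_i-z_{i+1}}&\text{if }z'-z=-e_i,\ 1\le i\le n,\\ 0&\text{otherwise,}\end{cases}$$ with the conventions $z_0=+\infty$, $z_{n+1}=0$, and on the diagonal by $$Q^q_N(z,z)=\begin{cases}-\sum_{i=1}^n(a_i+a_i^{-1}),&N=2n,\\ -\sum_{i=1}^{n-1}(a_i+a_i^{-1})-a_n-a_n^{-1}(1-q^{z_n}),&N=2n-1.\end{cases}$$ Moreover, for every $t>0$ the conditional law of $\mathbf Z(t)$ given $\{Z^N(s),s\le t\}$ is $M^{(N)}_{a,q}(\cdot;Z^N(t))$. -/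

import Mathlib

open MeasureTheory Filter Topology
open scoped NNReal

/-! ### Continuous-time Markov chains on a discrete state space -/

section MarkovChains

variable {S : Type*}

open Classical in
/-- An honest transition function on the countable discrete space `S`: `P t x y` is the probability to be
at `y` at time `t` when started at `x`. -/
structure IsTransitionFunction (P : ℝ≥0 → S → S → ℝ) : Prop where
  nonneg : ∀ t x y, 0 ≤ P t x y
  hasSum_one : ∀ t x, HasSum (P t x) 1
  zero : ∀ x y, P 0 x y = if x = y then 1 else 0
  chapman_kolmogorov : ∀ s t x y, HasSum (fun u => P s x u * P t u y) (P (s + t) x y)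

open Classical in
/-- The transition function `P` has transition rates `Q`, i.e. `Q` is its derivative at time `0`
(entry by entry, diagonal entries included). -/
def HasTransitionRates (P : ℝ≥0 → S → S → ℝ) (Q : S → S → ℝ) : Prop :=
  ∀ x y, Tendsto (fun t : ℝ≥0 => (P t x y - if x = y then 1 else 0) / (t : ℝ))
    (𝓝[>] 0) (𝓝 (Q x y))

/-- The σ-algebra generated by `X s`, `s ≤ t`. -/
abbrev pastSigma {Ω : Type*} [MeasurableSpace S] (X : ℝ≥0 → Ω → S) (t : ℝ≥0) : MeasurableSpace Ω :=
  ⨆ s ∈ Set.Iic t, MeasurableSpace.comap (X s) inferInstance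

/-- `X` is, under `μ`, a continuous-time Markov chain (with respect to its own past) on the
countable discrete space `S` with transition rates `Q`. Its paths are almost surely right-continuous
step functions with left limits for the discrete topology. -/
structure IsMarkovChainWithRates {Ω : Type*} [MeasurableSpace Ω] [MeasurableSpace S]
    (μ : Measure Ω) (X : ℝ≥0 → Ω → S) (Q : S → S → ℝ) : Prop where
  measurable : ∀ t, Measurable (X t)
  right_continuous : ∀ᵐ ω ∂μ, ∀ t, ∀ᶠ u in 𝓝[>] t, X u ω = X t ω
  left_limits : ∀ᵐ ω ∂μ, ∀ t, ∃ x, ∀ᶠ u in 𝓝[<] t, X u ω = x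
  markov : ∃ P : ℝ≥0 → S → S → ℝ, IsTransitionFunction P ∧ HasTransitionRates P Q ∧
    ∀ s t y, μ[(X (s + t) ⁻¹' {y}).indicator (fun _ => (1 : ℝ)) | pastSigma X s]
      =ᵐ[μ] fun ω => P t (X s ω) y

end MarkovChains

/-! ### Shapes and symplectic Gelfand-Tsetlin patterns -/

/-- The set `𝒲₀ⁿ` of integer vectors `z₁ ≥ z₂ ≥ … ≥ zₙ ≥ 0`. The parts are indexed from `1` and
extended by the value `0` to all other indices, in accordance with the convention `zₙ₊₁ = 0`. -/
@[ext] structure Shape (n : ℕ) where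
  part : ℕ → ℤ
  nonneg : ∀ j, 0 ≤ part j
  support : ∀ j, ¬ (1 ≤ j ∧ j ≤ n) → part j = 0
  antitone : ∀ j, 1 ≤ j → part (j + 1) ≤ part j

/-- The set `𝕂₀ᴺ` of integer-valued symplectic Gelfand-Tsetlin patterns with `N` levels.
`entry k j` is the `j`-th particle of level `k`; both indices start at `1`, the level `k` has
`⌊(k+1)/2⌋` particles, and the entries are extended by `0` to all other pairs of indices.
The conditions `lower` and `upper` together say that consecutive levels interlace:
`zᵏ⁺¹₁ ≥ zᵏ₁ ≥ zᵏ⁺¹₂ ≥ zᵏ₂ ≥ …`. -/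
@[ext] structure SympPattern (N : ℕ) where
  entry : ℕ → ℕ → ℤ
  nonneg : ∀ k j, 0 ≤ entry k j
  support : ∀ k j, ¬ (1 ≤ k ∧ k ≤ N ∧ 1 ≤ j ∧ j ≤ (k + 1) / 2) → entry k j = 0
  lower : ∀ k j, 1 ≤ k → k < N → 1 ≤ j → entry k j ≤ entry (k + 1) j
  upper : ∀ k j, 1 ≤ k → k < N → 1 ≤ j → entry (k + 1) (j + 1) ≤ entry k j

instance (n : ℕ) : MeasurableSpace (Shape n) := ⊤

instance (N : ℕ) : MeasurableSpace (SympPattern N) := ⊤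

theorem half_levels {n N : ℕ} (hn : 1 ≤ n) (hN : N = 2 * n ∨ N = 2 * n - 1) :
    (N + 1) / 2 = n := by
  omega

/-- The bottom level `z^N` of a pattern. -/
def SympPattern.bottom {n N : ℕ} (h : (N + 1) / 2 = n) (p : SympPattern N) : Shape n where
  part := p.entry N
  nonneg := p.nonneg N
  support j hj := p.support N j (by omega)
  antitone j hj := by
    by_cases hN : 2 ≤ N
    · obtain ⟨M, rfl⟩ : ∃ M, N = M + 1 := ⟨N - 1, by omega⟩
      exact (p.upper M j (by omega) (by omega) hj).trans (p.lower M j (by omega) (by omega) hj)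
    · rw [p.support N (j + 1) (by omega)]
      exact p.nonneg N j

/-- The process `Z^N` of the bottom level of a process `Z` of patterns. -/
def bottomProcess {Ω : Type*} {n N : ℕ} (h : (N + 1) / 2 = n) (Z : ℝ≥0 → Ω → SympPattern N) :
    ℝ≥0 → Ω → Shape n := fun t ω => (Z t ω).bottom h

theorem SympPattern.entry_le_bottom {N : ℕ} (p : SympPattern N) (k j : ℕ) :
    p.entry k j ≤ p.entry N j := by
  by_cases h : 1 ≤ k ∧ k ≤ N ∧ 1 ≤ j
  · obtain ⟨hk, hkN, hj⟩ := h
    obtain ⟨d, rfl⟩ := Nat.exists_eq_add_of_le hkN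
    have key : ∀ e, e ≤ d → p.entry k j ≤ p.entry (k + e) j := by
      intro e
      induction e with
      | zero => intro _; exact le_rfl
      | succ e ih =>
        intro he
        exact (ih (by omega)).trans (p.lower (k + e) j (by omega) (by omega) hj)
    exact key d le_rfl
  · rw [p.support k j (by tauto)]
    exact p.nonneg N j

/-- There are only finitely many patterns with a given bottom level. -/
theorem SympPattern.finite_fibre {n N : ℕ} (z : Shape n) :
    Finite {p : SympPattern N // p.entry N = z.part} := by
  let F : {p : SympPattern N // p.entry N = z.part} →
      ((x : Fin (N + 1) × Fin (N + 1)) → Set.Icc (0 : ℤ) (z.part x.2)) :=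
    fun p x => ⟨p.1.entry x.1 x.2, p.1.nonneg _ _, by
      have := p.1.entry_le_bottom x.1 x.2
      rwa [p.2] at this⟩
  refine Finite.of_injective F ?_
  intro p p' h
  apply Subtype.ext
  apply SympPattern.ext
  funext k j
  by_cases hkj : k ≤ N ∧ j ≤ N
  · have := congrFun h (⟨k, by omega⟩, ⟨j, by omega⟩)
    exact congrArg Subtype.val this
  · rw [p.1.support k j (by omega), p'.1.support k j (by omega)]

/-! ### The dynamics on patterns -/

noncomputable section

/-- The extended parameters: `ā_{2l-1} = a_l` and `ā_{2l} = a_l⁻¹`. -/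
def extParam (a : ℕ → ℝ) (k : ℕ) : ℝ :=
  if Even k then (a (k / 2))⁻¹ else a ((k + 1) / 2)

/-- `R_j(y; x)` for a level `y` and the level `x` above it. With the convention `x₀ = ∞` the
factor `1 - q^(x₀ - y₁)` is `1`. -/
def rightFactor (q : ℝ) (y x : ℕ → ℤ) (j : ℕ) : ℝ :=
  (if j = 1 then 1 else 1 - q ^ (x (j - 1) - y j))
    * ((1 - q ^ (y j - y (j + 1) + 1)) / (1 - q ^ (y j - x j + 1)))

/-- `L_j(y; x)` for a level `y` and the level `x` above it. With the conventions
`y₀ = x₀ = ∞` the fraction is `1` for `j = 1`. -/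
def leftFactor (q : ℝ) (y x : ℕ → ℤ) (j : ℕ) : ℝ :=
  (1 - q ^ (y j - x j))
    * (if j = 1 then 1
       else (1 - q ^ (y (j - 1) - y j + 1)) / (1 - q ^ (x (j - 1) - y j + 1)))

open Classical in
/-- The entries after the particle `(k, j)` has jumped to the right: the particle `(m+1, j)` is
pushed to the right together with `(m, j)` if the two were at the same place. -/
def jumpRight (N : ℕ) (z : ℕ → ℕ → ℤ) (k j : ℕ) : ℕ → ℕ → ℤ := fun l i =>
  if k ≤ l ∧ l ≤ N ∧ i = j ∧ ∀ m, k ≤ m → m < l → z (m + 1) j = z m j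
  then z l i + 1 else z l i

open Classical in
/-- The entries after the particle `(k, j)` has jumped to the left: the particle
`(k+m+1, j+m+1)` (if there is one) is pushed to the left together with `(k+m, j+m)` if the two
were at the same place. -/
def jumpLeft (N : ℕ) (z : ℕ → ℕ → ℤ) (k j : ℕ) : ℕ → ℕ → ℤ := fun l i =>
  if k ≤ l ∧ l ≤ N ∧ i = j + (l - k) ∧ i ≤ (l + 1) / 2 ∧
    ∀ m, m < l - k → z (k + m + 1) (j + m + 1) = z (k + m) (j + m)
  then z l i - 1 else z l i

open Classical in
/-- The transition rates of the `q`-deformed process on patterns: the particle `(k, j)` jumps to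
the right at rate `ā_k R_j(zᵏ; zᵏ⁻¹)` and to the left at rate `ā_k⁻¹ L_j(zᵏ; zᵏ⁻¹)`. -/
def patternRate (N : ℕ) (a : ℕ → ℝ) (q : ℝ) (z w : SympPattern N) : ℝ :=
  if w = z then
    -∑ k ∈ Finset.Icc 1 N, ∑ j ∈ Finset.Icc 1 ((k + 1) / 2),
      (extParam a k * rightFactor q (z.entry k) (z.entry (k - 1)) j
        + (extParam a k)⁻¹ * leftFactor q (z.entry k) (z.entry (k - 1)) j)
  else
    ∑ k ∈ Finset.Icc 1 N, ∑ j ∈ Finset.Icc 1 ((k + 1) / 2),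
      ((if w.entry = jumpRight N z.entry k j then
          extParam a k * rightFactor q (z.entry k) (z.entry (k - 1)) j else 0)
        + (if w.entry = jumpLeft N z.entry k j then
          (extParam a k)⁻¹ * leftFactor q (z.entry k) (z.entry (k - 1)) j else 0))

/-! ### Weights -/

/-- The `q`-factorial `∏_{k=1}^m (1 - q^k)/(1 - q)`. -/
def qFact (q : ℝ) (m : ℕ) : ℝ := ∏ k ∈ Finset.Icc 1 m, (1 - q ^ k) / (1 - q)

/-- The `q`-binomial coefficient, used for integers `0 ≤ k ≤ m` only. -/
def qBinom (q : ℝ) (m k : ℤ) : ℝ :=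
  qFact q m.toNat / (qFact q k.toNat * qFact q (m - k).toNat)

/-- The weight `Λ_{k-1,k}(x, y)` of a slice, `x` being the level `k - 1` and `y` the level `k`. -/
def sliceWeight (a : ℕ → ℝ) (q : ℝ) (k : ℕ) (x y : ℕ → ℤ) : ℝ :=
  extParam a k ^ ((∑ i ∈ Finset.Icc 1 ((k + 1) / 2), y i) - ∑ i ∈ Finset.Icc 1 (k / 2), x i)
    * (∏ i ∈ Finset.Icc 1 ((k + 1) / 2 - 1), qBinom q (y i - y (i + 1)) (y i - x i))
    * (if Even k then qBinom q (y (k / 2)) (y (k / 2) - x (k / 2)) else 1)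

/-- The weight `w^{(N)}_{a,q}` of a pattern. -/
def patternWeight (N : ℕ) (a : ℕ → ℝ) (q : ℝ) (p : SympPattern N) : ℝ :=
  ∏ k ∈ Finset.Icc 1 N, sliceWeight a q k (p.entry (k - 1)) (p.entry k)

/-- The function `P̂^{(N)}_z(a;q)`: the sum of the weights of all patterns with bottom level `z`.
It is a finite sum by `SympPattern.finite_fibre`. -/
def Phat {n : ℕ} (N : ℕ) (a : ℕ → ℝ) (q : ℝ) (z : Shape n) : ℝ :=
  ∑' p : {p : SympPattern N // p.entry N = z.part}, patternWeight N a q p.1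

open Classical in
/-- The probability mass function `M^{(N)}_{a,q}(·; z)` on patterns, carried by the patterns with
bottom level `z`. -/
def gibbsMass {n : ℕ} (N : ℕ) (a : ℕ → ℝ) (q : ℝ) (z : Shape n) (p : SympPattern N) : ℝ :=
  if p.entry N = z.part then patternWeight N a q p / Phat N a q z else 0

/-! ### The rates of the bottom level -/

open Classical in
/-- `f_N(z, z')`: it is `1 - q^(z_{i-1} - z_i)` if `z' - z = e_i` (with `z₀ = ∞`),
`1 - q^(z_i - z_{i+1})` if `z' - z = -e_i`, and `0` otherwise. At most one of the summands is
not `0`. -/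
def jumpFactor {n : ℕ} (q : ℝ) (z z' : Shape n) : ℝ :=
  ∑ i ∈ Finset.Icc 1 n,
    ((if z'.part - z.part = Pi.single i 1 then
        (if i = 1 then 1 else 1 - q ^ (z.part (i - 1) - z.part i)) else 0)
      + (if z'.part - z.part = -Pi.single i 1 then
        1 - q ^ (z.part i - z.part (i + 1)) else 0))

open Classical in
/-- The rate matrix `Q_N^q` on shapes, for `N = 2n` and (the other case) `N = 2n - 1`. -/
def shapeRate {n : ℕ} (N : ℕ) (a : ℕ → ℝ) (q : ℝ) (z z' : Shape n) : ℝ :=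
  if z' = z then
    (if N = 2 * n then -∑ i ∈ Finset.Icc 1 n, (a i + (a i)⁻¹)
     else -(∑ i ∈ Finset.Icc 1 (n - 1), (a i + (a i)⁻¹)) - a n
        - (a n)⁻¹ * (1 - q ^ z.part n))
  else Phat N a q z' / Phat N a q z * jumpFactor q z z'

end

/-! ### Transition functions and the backward equation -/

section TransitionFunctions

variable {S : Type*} {P : ℝ≥0 → S → S → ℝ}

/-! Let M be the kernel `gibbsMass`, Q the rates on patterns and R the rates on shapes. The theorem
rests on the intertwining M Q = R M (`gibbs_intertwines`); a Markov function argument then gives the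
statement on processes.

The intertwining is algebra. Removing the factors `Phat` turns it into
`sum_patternWeight_mul_patternRate`: the unnormalised weights intertwine Q with `levelRate`, whose
off-diagonal entries are f_N. This goes by induction on the number of levels. The weight of a
pattern is the weight of its truncation times one slice weight (`patternWeight_succ`). A transition
either moves the truncation, and pushing then determines the bottom level, or it moves the bottom
level alone (`patternRate_succ`). Summing over the higher levels with the induction hypothesis
leaves an identity for two consecutive levels, `twoLevel_balance`. When the lower level moves,
either a push or a jump of its own accord contributes, never both, and the jump rates are such that
the ratios of slice weights match. When it stays, the incoming flow at the upper level and the exit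
rates of the lower level differ by telescoping sums of powers of q, whose boundary terms give the
diagonal entries (`diagRate_balance`).

For the process, every pattern has its rates carried by a finite set, so the transition function P
satisfies the backward equation. Averaging the defect of the intertwining at time t against M gives
a bounded solution of u' = R u with u(0) = 0. It vanishes because the exit rates of R are bounded
(`eq_zero_of_linear_system`). Hence the semigroups are intertwined as well (`kernel_transition`). So
`fibreTransition` is a transition function with rates R, and M remains the conditional law of the
pattern given the past of the bottom level (`kernel_law_of_past`), which yields the Markov property.
-/

theorem IsTransitionFunction.le_one (hP : IsTransitionFunction P) (t : ℝ≥0) (x y : S) :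
    P t x y ≤ 1 :=
  le_hasSum (hP.hasSum_one t x) y fun u _ => hP.nonneg t x u

theorem IsTransitionFunction.sum_le_one (hP : IsTransitionFunction P) (t : ℝ≥0) (x : S)
    (F : Finset S) : ∑ y ∈ F, P t x y ≤ 1 :=
  sum_le_hasSum F (fun u _ => hP.nonneg t x u) (hP.hasSum_one t x)

theorem IsTransitionFunction.sum_mul_le (hP : IsTransitionFunction P) (s t : ℝ≥0) (x y : S)
    (F : Finset S) : ∑ u ∈ F, P s x u * P t u y ≤ P (s + t) x y :=
  sum_le_hasSum F (fun u _ => mul_nonneg (hP.nonneg s x u) (hP.nonneg t u y))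
    (hP.chapman_kolmogorov s t x y)

/-- Chapman-Kolmogorov for the complementary probabilities `1 - P t u y`, truncated to `F`. With
`sum_mul_le` it encloses `P (s + t) x y` up to the mass that leaves `F` in time `s`. -/
theorem IsTransitionFunction.le_sum_mul (hP : IsTransitionFunction P) (s t : ℝ≥0) (x y : S)
    (F : Finset S) :
    P (s + t) x y ≤ ∑ u ∈ F, P s x u * P t u y + (1 - ∑ u ∈ F, P s x u) := by
  have h : HasSum (fun u => P s x u * (1 - P t u y)) (1 - P (s + t) x y) := by
    simpa only [mul_sub, mul_one] using
      (hP.hasSum_one s x).sub (hP.chapman_kolmogorov s t x y)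
  have := sum_le_hasSum F (fun u _ => mul_nonneg (hP.nonneg s x u)
    (sub_nonneg.2 (hP.le_one t u y))) h
  simp only [mul_sub, mul_one, Finset.sum_sub_distrib] at this
  linarith

/-- The enclosure with `F = {x}`. The bound does not depend on `t`, so continuity at time 0 gives
continuity at all times. -/
theorem IsTransitionFunction.abs_sub_le (hP : IsTransitionFunction P) (s t : ℝ≥0) (x y : S) :
    |P (s + t) x y - P t x y| ≤ 1 - P s x x := by
  have h1 := hP.sum_mul_le s t x y {x}
  have h2 := hP.le_sum_mul s t x y {x}
  simp only [Finset.sum_singleton] at h1 h2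
  have h3 := hP.le_one s x x
  have h4 := hP.le_one t x y
  have h5 := hP.nonneg t x y
  have h6 := hP.nonneg s x x
  rw [abs_le]
  constructor <;> nlinarith

variable {Q : S → S → ℝ}

theorem HasTransitionRates.nonneg (hQ : HasTransitionRates P Q) (hP : IsTransitionFunction P)
    {x y : S} (hxy : x ≠ y) : 0 ≤ Q x y := by
  refine ge_of_tendsto' (hQ x y) fun t => ?_
  simp only [hxy, if_false, sub_zero]
  exact div_nonneg (hP.nonneg t x y) t.2

theorem HasTransitionRates.tendsto_one (hQ : HasTransitionRates P Q)
    (hP : IsTransitionFunction P) (x : S) : Tendsto (fun t => P t x x) (𝓝 0) (𝓝 1) := by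
  have h0 : P 0 x x = 1 := by simp [hP.zero]
  have h1 : Tendsto (fun t => P t x x) (𝓝[>] 0) (𝓝 1) := by
    have h2 : Tendsto (fun t : ℝ≥0 => (t : ℝ)) (𝓝[>] 0) (𝓝 0) := by
      have : Tendsto (fun t : ℝ≥0 => (t : ℝ)) (𝓝 0) (𝓝 ((0 : ℝ≥0) : ℝ)) :=
        NNReal.continuous_coe.tendsto 0
      exact this.mono_left nhdsWithin_le_nhds
    have h3 := (h2.mul (hQ x x)).add_const 1
    simp only [zero_mul, zero_add, if_true] at h3
    refine h3.congr' ?_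
    filter_upwards [self_mem_nhdsWithin] with t ht
    have : (t : ℝ) ≠ 0 := by
      have : (0 : ℝ≥0) < t := ht
      positivity
    field_simp
    ring
  -- The rates control positive times only; time 0 itself is added separately.
  have h4 : 𝓝 (0 : ℝ≥0) = 𝓝[>] 0 ⊔ pure 0 := by
    rw [← nhdsWithin_univ, ← Set.Ici_bot, ← Set.Ioi_union_left, nhdsWithin_union, bot_eq_zero',
      nhdsWithin_singleton]
  rw [h4]
  refine h1.sup ?_
  rw [tendsto_pure_left]
  intro s hs
  rw [h0]
  exact mem_of_mem_nhds hs

theorem HasTransitionRates.continuous (hQ : HasTransitionRates P Q)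
    (hP : IsTransitionFunction P) (x y : S) : Continuous fun t : ℝ => P t.toNNReal x y := by
  suffices h : Continuous fun t : ℝ≥0 => P t x y from h.comp continuous_real_toNNReal
  rw [continuous_iff_continuousAt]
  intro t
  have key : ∀ s t : ℝ≥0, |P s x y - P t x y| ≤ 1 - P (nndist s t) x x := by
    intro s t
    rcases le_total s t with h | h
    · obtain ⟨d, rfl⟩ := exists_add_of_le h
      have : nndist s (s + d) = d := by
        ext; simp [NNReal.dist_eq]
      rw [this, abs_sub_comm, add_comm]
      exact hP.abs_sub_le d s x y
    · obtain ⟨d, rfl⟩ := exists_add_of_le h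
      have : nndist (t + d) t = d := by
        ext; simp [NNReal.dist_eq]
      rw [this, add_comm]
      exact hP.abs_sub_le d t x y
  rw [ContinuousAt, tendsto_iff_dist_tendsto_zero]
  refine squeeze_zero (fun _ => dist_nonneg) (fun s => key s t) ?_
  have h1 : Tendsto (fun s => nndist s t) (𝓝 t) (𝓝 0) := by
    have : Tendsto (fun s => nndist s t) (𝓝 t) (𝓝 (nndist t t)) :=
      (continuous_id.nndist continuous_const).tendsto t
    simpa using this
  simpa using ((hQ.tendsto_one hP x).comp h1).const_sub 1

/-- The backward equation, for a state `x` whose rates are carried by a finite set. -/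
theorem HasTransitionRates.hasDerivWithinAt (hQ : HasTransitionRates P Q)
    (hP : IsTransitionFunction P) {x : S} {F : Finset S} (hx : x ∈ F)
    (hF : ∑ u ∈ F, Q x u = 0) (y : S) {t : ℝ} (ht : 0 ≤ t) :
    HasDerivWithinAt (fun t : ℝ => P t.toNNReal x y) (∑ u ∈ F, Q x u * P t.toNNReal u y)
      (Set.Ici t) t := by
  classical
  rw [← hasDerivWithinAt_Ioi_iff_Ici, hasDerivWithinAt_iff_tendsto_slope' (by simp)]
  have hdelta : ∀ u, Tendsto (fun h : ℝ≥0 => (P h x u - if x = u then 1 else 0) / (h : ℝ))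
      (𝓝[>] 0) (𝓝 (Q x u)) := fun u => by convert hQ x u
  have h1 := tendsto_finsetSum F fun u _ => (hdelta u).mul_const (P t.toNNReal u y)
  -- The rates of `x` over `F` sum to 0, so the probability of having left `F` at time `h` is o(h).
  -- This is the gap between the lower and the upper bound of the difference quotient.
  have h2 : Tendsto (fun h : ℝ≥0 => (1 - ∑ u ∈ F, P h x u) / (h : ℝ)) (𝓝[>] 0) (𝓝 0) := by
    have := (tendsto_finsetSum F fun u _ => hdelta u).neg
    rw [hF, neg_zero] at this
    refine this.congr fun h => ?_
    rw [← Finset.sum_div, Finset.sum_sub_distrib, Finset.sum_ite_eq, if_pos hx, ← neg_div, neg_sub]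
  have h3 : Tendsto (fun h : ℝ≥0 => (P (h + t.toNNReal) x y - P t.toNNReal x y) / (h : ℝ))
      (𝓝[>] 0) (𝓝 (∑ u ∈ F, Q x u * P t.toNNReal u y)) := by
    have hsum : ∀ h : ℝ≥0, ∑ u ∈ F, (P h x u - if x = u then 1 else 0) / (h : ℝ)
          * P t.toNNReal u y
        = (∑ u ∈ F, P h x u * P t.toNNReal u y - P t.toNNReal x y) / (h : ℝ) := by
      intro h
      simp only [div_mul_eq_mul_div, ← Finset.sum_div, sub_mul, ite_mul, one_mul, zero_mul,
        Finset.sum_sub_distrib, Finset.sum_ite_eq, if_pos hx]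
    refine tendsto_of_tendsto_of_tendsto_of_le_of_le h1 (by simpa using h1.add h2) ?_ ?_
    · intro h
      simp only [hsum]
      have := hP.sum_mul_le h t.toNNReal x y F
      gcongr
    · intro h
      simp only [hsum, ← add_div]
      have := hP.le_sum_mul h t.toNNReal x y F
      refine div_le_div_of_nonneg_right ?_ h.2
      linarith
  have h4 : Tendsto (fun s : ℝ => (s - t).toNNReal) (𝓝[>] t) (𝓝[>] 0) := by
    refine tendsto_nhdsWithin_iff.2 ⟨?_, ?_⟩
    · have : Tendsto (fun s : ℝ => (s - t).toNNReal) (𝓝 t) (𝓝 (t - t).toNNReal) :=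
        (continuous_real_toNNReal.comp (continuous_id.sub continuous_const)).tendsto t
      simp only [sub_self, Real.toNNReal_zero] at this
      exact this.mono_left nhdsWithin_le_nhds
    · filter_upwards [self_mem_nhdsWithin] with s hs
      have : t < s := hs
      simpa using this
  refine (h3.comp h4).congr' ?_
  filter_upwards [self_mem_nhdsWithin] with s hs
  have hs' : t < s := hs
  have hst : (s - t).toNNReal + t.toNNReal = s.toNNReal := by
    rw [← Real.toNNReal_add (by linarith) ht]; simp
  simp only [Function.comp, hst, slope_def_field]
  rw [Real.coe_toNNReal _ (by linarith)]

end TransitionFunctions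

/-- Bounded solutions of a linear system with bounded coefficients are determined by their
initial value. -/
theorem eq_zero_of_linear_system {T : Type*} {H : T → Finset T} {A : T → T → ℝ} {C K : ℝ}
    {u : ℝ → T → ℝ} (hA : ∀ z, ∑ z' ∈ H z, |A z z'| ≤ C) (hK : ∀ t z, |u t z| ≤ K)
    (hu : ∀ z, Continuous fun t => u t z)
    (hd : ∀ t z, 0 ≤ t → HasDerivWithinAt (fun t => u t z) (∑ z' ∈ H z, A z z' * u t z')
      (Set.Ici t) t)
    (h0 : ∀ z, u 0 z = 0) {t : ℝ} (ht : 0 ≤ t) (z : T) : u t z = 0 := by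
  have hK0 : 0 ≤ K := (abs_nonneg _).trans (hK 0 z)
  have hC : 0 ≤ C := (Finset.sum_nonneg fun _ _ => abs_nonneg _).trans (hA z)
  -- Picard iteration: each use of the equation improves the bound by one term of the exponential
  -- series.
  have key : ∀ (n : ℕ) (t : ℝ) (z : T), 0 ≤ t → |u t z| ≤ K * ((C * t) ^ n / n.factorial) := by
    intro n
    induction n with
    | zero => intro t z _; simpa using hK t z
    | succ n ih =>
      intro t z ht
      -- The bound for `n + 1` is a primitive of `C` times the bound for `n`, and so dominates a
      -- function whose derivative is controlled by the bound for `n`.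
      have hB : ∀ x : ℝ, HasDerivAt (fun t : ℝ => K * ((C * t) ^ (n + 1) / (n + 1).factorial))
          (C * (K * ((C * x) ^ n / n.factorial))) x := by
        intro x
        have h1 : HasDerivAt (fun t : ℝ => C * t) C x := by
          simpa using (hasDerivAt_id x).const_mul C
        refine (((h1.pow (n + 1)).div_const ((n + 1).factorial : ℝ)).const_mul K).congr_deriv ?_
        rw [Nat.factorial_succ]
        push_cast
        have : (n.factorial : ℝ) ≠ 0 := by positivity
        have : (n : ℝ) + 1 ≠ 0 := by positivity
        field_simp
      refine image_norm_le_of_norm_deriv_right_le_deriv_boundary' (a := 0) (b := t)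
        (hu z).continuousOn (fun x hx => hd x z hx.1) (by simp [h0 z])
        (fun x _ => (hB x).continuousAt.continuousWithinAt)
        (fun x _ => (hB x).hasDerivWithinAt) ?_ ⟨ht, le_rfl⟩
      intro x hx
      calc ‖∑ z' ∈ H z, A z z' * u x z'‖ ≤ ∑ z' ∈ H z, ‖A z z' * u x z'‖ := norm_sum_le _ _
        _ ≤ ∑ z' ∈ H z, |A z z'| * (K * ((C * x) ^ n / n.factorial)) := by
            refine Finset.sum_le_sum fun z' _ => ?_
            rw [Real.norm_eq_abs, abs_mul]
            exact mul_le_mul_of_nonneg_left (ih x z' hx.1) (abs_nonneg _)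
        _ ≤ C * (K * ((C * x) ^ n / n.factorial)) := by
            rw [← Finset.sum_mul]
            refine mul_le_mul_of_nonneg_right (hA z) ?_
            have := hx.1
            positivity
  have hlim : Tendsto (fun n : ℕ => K * ((C * t) ^ n / n.factorial)) atTop (𝓝 0) := by
    simpa using (FloorSemiring.tendsto_pow_div_factorial_atTop (C * t)).const_mul K
  have := ge_of_tendsto' hlim fun n => key n t z ht
  exact abs_nonpos_iff.1 this

/-! ### Intertwined rate matrices -/

/-- The kernel `M` from `T` to the fibres of `b : S → T` intertwines the rates `R` on `T` and the rates
`Q` on `S`. The rates of the points over `z` are carried by the points over `H z`. -/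
structure KernelIntertwines {S T : Type*} (b : S → T) (fib : T → Finset S) (M : T → S → ℝ)
    (Q : S → S → ℝ) (R : T → T → ℝ) (H : T → Finset T) (C : ℝ) : Prop where
  mem_fib : ∀ z p, p ∈ fib z ↔ b p = z
  kernel_nonneg : ∀ z p, 0 ≤ M z p
  kernel_support : ∀ z p, b p ≠ z → M z p = 0
  sum_kernel : ∀ z, ∑ p ∈ fib z, M z p = 1
  mem_nhd : ∀ z, z ∈ H z
  sum_rates : ∀ p, ∑ z' ∈ H (b p), ∑ x ∈ fib z', Q p x = 0
  intertwines : ∀ z x, ∑ p ∈ fib z, M z p * Q p x = R z (b x) * M (b x) x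
  diag_le : ∀ z, -R z z ≤ C

/-- The probability that the chain started from the law `M z` is in the fibre over `z'` at time `t`. -/
def fibreTransition {S T : Type*} (fib : T → Finset S) (M : T → S → ℝ) (P : ℝ≥0 → S → S → ℝ)
    (t : ℝ≥0) (z z' : T) : ℝ :=
  ∑ p ∈ fib z, M z p * ∑ w ∈ fib z', P t p w

theorem hasSum_congr_fun {ι : Type*} {f g : ι → ℝ} {r : ℝ} (h : ∀ i, f i = g i) :
    HasSum f r ↔ HasSum g r := by
  rw [funext h]

theorem HasSum.sum_fibres {S T : Type*} {b : S → T} {fib : T → Finset S}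
    (hfib : ∀ z p, p ∈ fib z ↔ b p = z) {f : S → ℝ} {r : ℝ} (hf : HasSum f r) :
    HasSum (fun z => ∑ p ∈ fib z, f p) r := by
  refine (hasSum_congr_fun fun z => ?_).1 (hf.tsum_fiberwise b)
  have : b ⁻¹' {z} = (fib z : Set S) := by
    ext p; simp [hfib]
  rw [this]
  exact (fib z).tsum_subtype f

namespace KernelIntertwines

variable {S T : Type*} {b : S → T} {fib : T → Finset S} {M : T → S → ℝ}
  {Q : S → S → ℝ} {R : T → T → ℝ} {H : T → Finset T} {C : ℝ} {P : ℝ≥0 → S → S → ℝ}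

/-- Summing the intertwining over a fibre removes the kernel on the right, whose total mass is 1.
Sign and row sums of `R` are then inherited from `Q`. -/
theorem rate_eq (hM : KernelIntertwines b fib M Q R H C) (z z' : T) :
    ∑ p ∈ fib z, M z p * ∑ x ∈ fib z', Q p x = R z z' := by
  simp only [Finset.mul_sum]
  rw [Finset.sum_comm]
  calc ∑ x ∈ fib z', ∑ p ∈ fib z, M z p * Q p x = ∑ x ∈ fib z', R z z' * M z' x := by
        refine Finset.sum_congr rfl fun x hx => ?_
        rw [hM.intertwines, (hM.mem_fib _ _).1 hx]
    _ = R z z' := by rw [← Finset.mul_sum, hM.sum_kernel, mul_one]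

theorem rate_nonneg (hM : KernelIntertwines b fib M Q R H C) (hP : IsTransitionFunction P)
    (hQ : HasTransitionRates P Q) {z z' : T} (h : z ≠ z') : 0 ≤ R z z' := by
  rw [← hM.rate_eq]
  refine Finset.sum_nonneg fun p hp => mul_nonneg (hM.kernel_nonneg z p) ?_
  refine Finset.sum_nonneg fun x hx => hQ.nonneg hP ?_
  rintro rfl
  exact h (((hM.mem_fib _ _).1 hp).symm.trans ((hM.mem_fib _ _).1 hx))

theorem sum_rate (hM : KernelIntertwines b fib M Q R H C) (z : T) :
    ∑ z' ∈ H z, R z z' = 0 := by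
  simp only [← hM.rate_eq]
  rw [Finset.sum_comm]
  refine Finset.sum_eq_zero fun p hp => ?_
  rw [← Finset.mul_sum]
  have := hM.sum_rates p
  rw [(hM.mem_fib _ _).1 hp] at this
  rw [this, mul_zero]

/-- The rows of `R` sum to 0 and only the diagonal entry can be negative, so the absolute row sum is
`-2 * R z z`. -/
theorem sum_abs_rate_le (hM : KernelIntertwines b fib M Q R H C) (hP : IsTransitionFunction P)
    (hQ : HasTransitionRates P Q) (z : T) : ∑ z' ∈ H z, |R z z'| ≤ 2 * C := by
  classical
  have h1 := Finset.add_sum_erase (H z) (fun z' => R z z') (hM.mem_nhd z)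
  have h2 := Finset.add_sum_erase (H z) (fun z' => |R z z'|) (hM.mem_nhd z)
  have h3 : ∑ z' ∈ (H z).erase z, |R z z'| = ∑ z' ∈ (H z).erase z, R z z' :=
    Finset.sum_congr rfl fun z' hz' =>
      abs_of_nonneg (hM.rate_nonneg hP hQ (Finset.ne_of_mem_erase hz').symm)
  have h4 : 0 ≤ ∑ z' ∈ (H z).erase z, R z z' := Finset.sum_nonneg fun z' hz' =>
      hM.rate_nonneg hP hQ (Finset.ne_of_mem_erase hz').symm
  rw [hM.sum_rate] at h1
  have h5 := hM.diag_le z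
  rw [h3, abs_of_nonpos (by linarith)] at h2
  linarith

theorem sum_sum_fib_nhd (hM : KernelIntertwines b fib M Q R H C) [DecidableEq S] (z : T)
    (f : S → ℝ) : ∑ x ∈ (H z).biUnion fib, f x = ∑ z' ∈ H z, ∑ x ∈ fib z', f x := by
  refine Finset.sum_biUnion fun z₁ _ z₂ _ h => Finset.disjoint_left.2 fun p h1 h2 => h ?_
  exact ((hM.mem_fib _ _).1 h1).symm.trans ((hM.mem_fib _ _).1 h2)

/-- The intertwining of the semigroups. Only the rates `R` of the image are required to be bounded:
the uniqueness argument takes place on `T`, after averaging over the fibres. -/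
theorem kernel_transition (hM : KernelIntertwines b fib M Q R H C) (hP : IsTransitionFunction P)
    (hQ : HasTransitionRates P Q) (t : ℝ≥0) (z : T) (w : S) :
    ∑ p ∈ fib z, M z p * P t p w = fibreTransition fib M P t z (b w) * M (b w) w := by
  classical
  -- `v t p` measures how far the chain started from `p` is from being distributed as the kernel on
  -- the fibre of `w`. The average `u` of `v` should vanish; it solves u' = R u because M Q = R M.
  let v : ℝ → S → ℝ := fun t p =>
    P t.toNNReal p w - (∑ w' ∈ fib (b w), P t.toNNReal p w') * M (b w) w
  let u : ℝ → T → ℝ := fun t z => ∑ p ∈ fib z, M z p * v t p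
  have hMle : ∀ z p, M z p ≤ 1 := by
    intro z p
    by_cases h : b p = z
    · rw [← hM.sum_kernel z]
      exact Finset.single_le_sum (fun x _ => hM.kernel_nonneg z x) ((hM.mem_fib _ _).2 h)
    · rw [hM.kernel_support z p h]; exact zero_le_one
  have hv : ∀ t p, |v t p| ≤ 1 := by
    intro t p
    have h1 := hP.nonneg t.toNNReal p w
    have h2 := hP.le_one t.toNNReal p w
    have h3 : 0 ≤ ∑ w' ∈ fib (b w), P t.toNNReal p w' :=
      Finset.sum_nonneg fun w' _ => hP.nonneg _ p w'
    have h4 := hP.sum_le_one t.toNNReal p (fib (b w))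
    have h5 := hM.kernel_nonneg (b w) w
    have h6 := hMle (b w) w
    have h7 := mul_nonneg h3 h5
    have h8 := mul_le_one₀ h4 h5 h6
    simp only [v]
    rw [abs_le]
    constructor <;> linarith
  have hvc : ∀ p, Continuous fun t => v t p := fun p =>
    (hQ.continuous hP p w).sub
      ((continuous_finsetSum _ fun w' _ => hQ.continuous hP p w').mul_const _)
  have hvd : ∀ t p, 0 ≤ t → HasDerivWithinAt (fun t => v t p)
      (∑ z' ∈ H (b p), ∑ x ∈ fib z', Q p x * v t x) (Set.Ici t) t := by
    intro t p ht
    -- The finite set carrying the rates of `p` is the union of the fibres over `H (b p)`. The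
    -- backward equation applies to each transition probability in `v` with this same set.
    have hmem : p ∈ (H (b p)).biUnion fib :=
      Finset.mem_biUnion.2 ⟨b p, hM.mem_nhd _, (hM.mem_fib _ _).2 rfl⟩
    have hF : ∑ x ∈ (H (b p)).biUnion fib, Q p x = 0 := by
      rw [hM.sum_sum_fib_nhd, hM.sum_rates]
    refine ((hQ.hasDerivWithinAt hP hmem hF w ht).sub
      ((HasDerivWithinAt.fun_sum fun w' _ =>
        hQ.hasDerivWithinAt hP hmem hF w' ht).mul_const _)).congr_deriv ?_
    rw [← hM.sum_sum_fib_nhd, Finset.sum_comm, Finset.sum_mul, ← Finset.sum_sub_distrib]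
    refine Finset.sum_congr rfl fun x _ => ?_
    simp only [v]
    rw [← Finset.mul_sum]
    ring
  have hu : u t z = 0 := by
    refine eq_zero_of_linear_system (H := H) (A := R) (C := 2 * C) (K := 1) (u := u)
      (hM.sum_abs_rate_le hP hQ) ?_ ?_ ?_ ?_ t.2 z
    · intro t z
      calc |∑ p ∈ fib z, M z p * v t p| ≤ ∑ p ∈ fib z, |M z p * v t p| :=
            Finset.abs_sum_le_sum_abs _ _
        _ ≤ ∑ p ∈ fib z, M z p := by
            refine Finset.sum_le_sum fun p _ => ?_
            rw [abs_mul, abs_of_nonneg (hM.kernel_nonneg z p)]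
            exact mul_le_of_le_one_right (hM.kernel_nonneg z p) (hv t p)
        _ = 1 := hM.sum_kernel z
    · exact fun z => continuous_finsetSum _ fun p _ => (hvc p).const_mul _
    · intro t z ht
      refine (HasDerivWithinAt.fun_sum fun p _ => (hvd t p ht).const_mul (M z p)).congr_deriv ?_
      calc ∑ p ∈ fib z, M z p * ∑ z' ∈ H (b p), ∑ x ∈ fib z', Q p x * v t x
          = ∑ p ∈ fib z, ∑ z' ∈ H z, ∑ x ∈ fib z', M z p * Q p x * v t x := by
            refine Finset.sum_congr rfl fun p hp => ?_
            rw [(hM.mem_fib _ _).1 hp]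
            simp only [Finset.mul_sum, mul_assoc]
        _ = ∑ z' ∈ H z, ∑ x ∈ fib z', (∑ p ∈ fib z, M z p * Q p x) * v t x := by
            rw [Finset.sum_comm]
            refine Finset.sum_congr rfl fun z' _ => ?_
            rw [Finset.sum_comm]
            simp only [Finset.sum_mul]
        _ = ∑ z' ∈ H z, R z z' * u t z' := by
            refine Finset.sum_congr rfl fun z' _ => ?_
            simp only [u, Finset.mul_sum]
            refine Finset.sum_congr rfl fun x hx => ?_
            rw [hM.intertwines, (hM.mem_fib _ _).1 hx, mul_assoc]
    -- At time 0 only the fibre of `w` matters. There the average is `M (b w) w` minus the total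
    -- mass 1 times `M (b w) w`.
    · intro z
      simp only [u, v, Real.toNNReal_zero, hP.zero, Finset.sum_ite_eq, hM.mem_fib]
      by_cases hz : b w = z
      · subst hz
        have : ∀ p ∈ fib (b w), M (b w) p * ((if p = w then 1 else 0)
            - (if b p = b w then 1 else 0) * M (b w) w)
            = (if p = w then M (b w) p else 0) - M (b w) p * M (b w) w := by
          intro p hp
          rw [if_pos ((hM.mem_fib _ _).1 hp)]
          split_ifs <;> ring
        rw [Finset.sum_congr rfl this, Finset.sum_sub_distrib, Finset.sum_ite_eq',
          if_pos ((hM.mem_fib _ _).2 rfl), ← Finset.sum_mul, hM.sum_kernel]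
        ring
      · refine Finset.sum_eq_zero fun p hp => ?_
        have hp' := (hM.mem_fib _ _).1 hp
        rw [if_neg (by rintro rfl; exact hz hp'), if_neg (by rw [hp']; exact fun h => hz h.symm)]
        ring
  simp only [u, v, Real.toNNReal_coe, mul_sub, Finset.sum_sub_distrib, ← mul_assoc,
    ← Finset.sum_mul] at hu
  rw [fibreTransition]
  linarith

/-- Only Chapman-Kolmogorov needs the intertwining: at the intermediate time the mass on a fibre is
spread according to the kernel, so the second factor starts afresh from the kernel. -/
theorem isTransitionFunction (hM : KernelIntertwines b fib M Q R H C)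
    (hP : IsTransitionFunction P) (hQ : HasTransitionRates P Q) :
    IsTransitionFunction (fibreTransition fib M P) where
  nonneg t z z' := Finset.sum_nonneg fun p _ => mul_nonneg (hM.kernel_nonneg z p)
    (Finset.sum_nonneg fun w _ => hP.nonneg t p w)
  hasSum_one t z := by
    rw [← hM.sum_kernel z]
    refine hasSum_sum fun p _ => ?_
    simpa using ((hP.hasSum_one t p).sum_fibres hM.mem_fib).mul_left (M z p)
  zero z z' := by
    classical
    simp only [fibreTransition, hP.zero, Finset.sum_ite_eq, hM.mem_fib]
    by_cases h : z = z'
    · rw [if_pos h]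
      refine Eq.trans ?_ (hM.sum_kernel z)
      refine Finset.sum_congr rfl fun p hp => ?_
      rw [if_pos (((hM.mem_fib _ _).1 hp).trans h), mul_one]
    · rw [if_neg h]
      refine Finset.sum_eq_zero fun p hp => ?_
      rw [if_neg (fun h' => h (((hM.mem_fib _ _).1 hp).symm.trans h')), mul_zero]
  chapman_kolmogorov s t z z' := by
    have h1 : HasSum (fun u => ∑ p ∈ fib z, M z p * ∑ w ∈ fib z', P s p u * P t u w)
        (fibreTransition fib M P (s + t) z z') :=
      hasSum_sum fun p _ => (hasSum_sum fun w _ => hP.chapman_kolmogorov s t p w).mul_left _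
    refine (hasSum_congr_fun fun u => ?_).2 (h1.sum_fibres hM.mem_fib)
    calc fibreTransition fib M P s z u * fibreTransition fib M P t u z'
        = ∑ x ∈ fib u, (∑ p ∈ fib z, M z p * P s p x) * ∑ w ∈ fib z', P t x w := by
          conv_lhs => rw [fibreTransition.eq_1 fib M P t, Finset.mul_sum]
          refine Finset.sum_congr rfl fun x hx => ?_
          rw [hM.kernel_transition hP hQ, (hM.mem_fib _ _).1 hx, mul_assoc]
      _ = _ := by
          refine Finset.sum_congr rfl fun x _ => ?_
          rw [Finset.sum_mul]
          refine Finset.sum_congr rfl fun p _ => ?_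
          rw [← Finset.mul_sum, mul_assoc]

theorem hasTransitionRates (hM : KernelIntertwines b fib M Q R H C)
    (hP : IsTransitionFunction P) (hQ : HasTransitionRates P Q) :
    HasTransitionRates (fibreTransition fib M P) R := by
  classical
  intro z z'
  have h1 := tendsto_finsetSum (fib z) fun p _ =>
    (tendsto_finsetSum (fib z') fun w _ => hQ p w).const_mul (M z p)
  rw [hM.rate_eq] at h1
  refine h1.congr fun t => ?_
  have h2 := (hM.isTransitionFunction hP hQ).zero z z'
  rw [← h2]
  simp only [fibreTransition, ← Finset.sum_sub_distrib, Finset.sum_div, ← mul_sub, mul_div_assoc,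
    hP.zero]

end KernelIntertwines

/-! ### Markov functions -/

section PastSigma

variable {Ω S T : Type*} [MeasurableSpace S] [MeasurableSpace T]

theorem pastSigma_le [MeasurableSpace Ω] {X : ℝ≥0 → Ω → S} (hX : ∀ t, Measurable (X t)) (t : ℝ≥0) :
    pastSigma X t ≤ ‹MeasurableSpace Ω› :=
  iSup₂_le fun s _ => (hX s).comap_le

theorem measurable_pastSigma (X : ℝ≥0 → Ω → S) {s t : ℝ≥0} (h : s ≤ t) :
    Measurable[pastSigma X t] (X s) :=
  measurable_iff_comap_le.2
    (le_iSup₂ (f := fun s (_ : s ∈ Set.Iic t) => MeasurableSpace.comap (X s) inferInstance) s h)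

theorem pastSigma_comp_le {X : ℝ≥0 → Ω → S} {b : S → T} (hb : Measurable b) (t : ℝ≥0) :
    pastSigma (fun t ω => b (X t ω)) t ≤ pastSigma X t :=
  iSup₂_le fun _ hs => (hb.comp (measurable_pastSigma X hs)).comap_le

theorem hasSum_setIntegral_comp [MeasurableSpace Ω] [Countable S] [DiscreteMeasurableSpace S] {μ : Measure Ω}
    [IsFiniteMeasure μ] {X : Ω → S} (hX : Measurable X) (A : Set Ω) {g : S → ℝ} {K : ℝ}
    (hg : ∀ p, |g p| ≤ K) :
    HasSum (fun p => μ.real (A ∩ X ⁻¹' {p}) * g p) (∫ ω in A, g (X ω) ∂μ) := by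
  have hint : Integrable (fun ω => g (X ω)) (μ.restrict A) :=
    Integrable.of_bound ((measurable_of_countable g).comp hX).aestronglyMeasurable K
      (Eventually.of_forall fun ω => hg (X ω))
  have hm : ∀ p, MeasurableSet (X ⁻¹' {p}) := fun p => hX (measurableSet_singleton p)
  have hU : ⋃ p, X ⁻¹' {p} = Set.univ := by
    ext ω; simp
  have h := hasSum_integral_iUnion hm
    (fun p p' hpp => Set.disjoint_left.2 fun ω h1 h2 => hpp (h1.symm.trans h2))
    (hint.integrableOn (s := ⋃ p, X ⁻¹' {p}))
  rw [hU, setIntegral_univ] at h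
  refine (hasSum_congr_fun fun p => ?_).1 h
  rw [setIntegral_congr_fun (hm p) (g := fun _ => g p) (fun ω hω => by
    rw [show X ω = p from hω]), setIntegral_const, smul_eq_mul, measureReal_restrict_apply (hm p),
    Set.inter_comm]

end PastSigma

namespace KernelIntertwines

variable {S T : Type*} {b : S → T} {fib : T → Finset S} {M : T → S → ℝ}
  {Q : S → S → ℝ} {R : T → T → ℝ} {H : T → Finset T} {C : ℝ} {P : ℝ≥0 → S → S → ℝ}

/-- `hν` says that the kernel is the conditional law of `ν` given the fibre, and `ν'` is the law a
time `t` later. The measures may have any total mass, as needed for laws restricted to an event. -/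
theorem hasSum_mul_fibreTransition (hM : KernelIntertwines b fib M Q R H C) {t : ℝ≥0}
    {ν ν' : S → ℝ} (hν : ∀ p, ν p = (∑ x ∈ fib (b p), ν x) * M (b p) p)
    (hν' : ∀ w, HasSum (fun p => ν p * P t p w) (ν' w)) (z' : T) :
    HasSum (fun z => (∑ x ∈ fib z, ν x) * fibreTransition fib M P t z z')
      (∑ w ∈ fib z', ν' w) := by
  refine (hasSum_congr_fun fun z => ?_).1
    ((hasSum_sum fun w _ => hν' w).sum_fibres (fib := fib) hM.mem_fib)
  rw [fibreTransition, Finset.mul_sum]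
  refine Finset.sum_congr rfl fun p hp => ?_
  rw [← Finset.mul_sum, hν p, (hM.mem_fib _ _).1 hp, mul_assoc]

/-- The transition function preserves the laws that have the kernel as their conditional law given the
fibre. -/
theorem kernel_law_transition (hM : KernelIntertwines b fib M Q R H C)
    (hP : IsTransitionFunction P) (hQ : HasTransitionRates P Q) {t : ℝ≥0}
    {ν ν' : S → ℝ} (hν : ∀ p, ν p = (∑ x ∈ fib (b p), ν x) * M (b p) p)
    (hν' : ∀ w, HasSum (fun p => ν p * P t p w) (ν' w)) (w : S) :
    ν' w = (∑ x ∈ fib (b w), ν' x) * M (b w) w := by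
  refine ((hν' w).sum_fibres hM.mem_fib).unique ?_
  refine (hasSum_congr_fun fun z => ?_).1
    ((hM.hasSum_mul_fibreTransition hν hν' (b w)).mul_right (M (b w) w))
  rw [mul_assoc, ← hM.kernel_transition hP hQ, Finset.mul_sum]
  refine Finset.sum_congr rfl fun p hp => ?_
  rw [hν p, (hM.mem_fib _ _).1 hp, mul_assoc]

variable {Ω : Type*} [MeasurableSpace Ω] [MeasurableSpace S] [Countable S] [DiscreteMeasurableSpace S]
  {μ : Measure Ω} [IsProbabilityMeasure μ] {Z : ℝ≥0 → Ω → S}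

theorem sum_fib_measureReal (hM : KernelIntertwines b fib M Q R H C) {X : Ω → S}
    (hX : Measurable X) {A : Set Ω} (hA : MeasurableSet A) (z : T) :
    ∑ p ∈ fib z, μ.real (A ∩ X ⁻¹' {p}) = μ.real (A ∩ (fun ω => b (X ω)) ⁻¹' {z}) := by
  rw [← measureReal_biUnion_finset]
  · congr 1
    ext ω
    simp [hM.mem_fib]
  · exact fun p _ p' _ hpp => Set.disjoint_left.2 fun ω h1 h2 => hpp (h1.2.symm.trans h2.2)
  · exact fun p _ => hA.inter (hX (measurableSet_singleton p))

/-- The Markov property integrated over `A`, written as a sum over the values of the chain at time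
`s`. It is the form in which the laws restricted to `A` evolve by `P`. -/
theorem hasSum_measureReal_transition (hP : IsTransitionFunction P) (hZ : ∀ t, Measurable (Z t))
    (hmar : ∀ s t y, μ[(Z (s + t) ⁻¹' {y}).indicator (fun _ => (1 : ℝ)) | pastSigma Z s]
      =ᵐ[μ] fun ω => P t (Z s ω) y) {s t : ℝ≥0} {A : Set Ω} (hA : MeasurableSet[pastSigma Z s] A)
    (w : S) : HasSum (fun p => μ.real (A ∩ Z s ⁻¹' {p}) * P t p w)
      (μ.real (A ∩ Z (s + t) ⁻¹' {w})) := by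
  have hA' : MeasurableSet A := pastSigma_le hZ s _ hA
  have hm : MeasurableSet (Z (s + t) ⁻¹' {w}) := hZ _ (measurableSet_singleton w)
  have h1 : ∫ ω in A, P t (Z s ω) w ∂μ = μ.real (A ∩ Z (s + t) ⁻¹' {w}) := by
    rw [← setIntegral_congr_ae hA' ((hmar s t w).mono fun ω h _ => h),
      setIntegral_condExp (pastSigma_le hZ s) ((integrable_const 1).indicator hm) hA,
      setIntegral_indicator hm, setIntegral_const, smul_eq_mul, mul_one]
  rw [← h1]
  exact hasSum_setIntegral_comp (hZ s) A (K := 1) fun p => by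
    rw [abs_of_nonneg (hP.nonneg t p w)]; exact hP.le_one t p w

/-- Given an event of the past of the image process, the law of the chain has the kernel as its conditional
law given the fibre. -/
theorem kernel_law_of_past [MeasurableSpace T] [DiscreteMeasurableSpace T]
    (hM : KernelIntertwines b fib M Q R H C)
    (hP : IsTransitionFunction P) (hQ : HasTransitionRates P Q) (hZ : ∀ t, Measurable (Z t))
    (hmar : ∀ s t y, μ[(Z (s + t) ⁻¹' {y}).indicator (fun _ => (1 : ℝ)) | pastSigma Z s]
      =ᵐ[μ] fun ω => P t (Z s ω) y) {z : T} (hinit : ∀ p, μ.real (Z 0 ⁻¹' {p}) = M z p)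
    {t : ℝ≥0} {A : Set Ω} (hA : MeasurableSet[pastSigma (fun t ω => b (Z t ω)) t] A) (p : S) :
    μ.real (A ∩ Z t ⁻¹' {p})
      = (∑ x ∈ fib (b p), μ.real (A ∩ Z t ⁻¹' {x})) * M (b p) p := by
  classical
  have hb : Measurable b := measurable_of_countable b
  have hY : ∀ t, Measurable fun ω => b (Z t ω) := fun t => hb.comp (hZ t)
  -- For a fixed event of the past, the property passes to later times by `kernel_law_transition`.
  have hstep : ∀ s t : ℝ≥0, ∀ A, MeasurableSet[pastSigma (fun t ω => b (Z t ω)) s] A →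
      (∀ p, μ.real (A ∩ Z s ⁻¹' {p})
        = (∑ x ∈ fib (b p), μ.real (A ∩ Z s ⁻¹' {x})) * M (b p) p) → s ≤ t →
      ∀ p, μ.real (A ∩ Z t ⁻¹' {p})
        = (∑ x ∈ fib (b p), μ.real (A ∩ Z t ⁻¹' {x})) * M (b p) p := by
    intro s t A hA h hst
    obtain ⟨d, rfl⟩ := exists_add_of_le hst
    exact hM.kernel_law_transition hP hQ h
      (hasSum_measureReal_transition hP hZ hmar (pastSigma_comp_le hb s A hA))
  have hzero : ∀ p, μ.real (Set.univ ∩ Z 0 ⁻¹' {p})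
      = (∑ x ∈ fib (b p), μ.real (Set.univ ∩ Z 0 ⁻¹' {x})) * M (b p) p := by
    intro p
    simp only [Set.univ_inter, hinit]
    by_cases h : b p = z
    · rw [h, hM.sum_kernel, one_mul]
    · rw [hM.kernel_support z p h, Finset.sum_eq_zero, zero_mul]
      intro x hx
      exact hM.kernel_support z x (by rwa [(hM.mem_fib _ _).1 hx])
  have hfin : ∀ (I : Finset ℝ≥0) (f : ℝ≥0 → Set Ω),
      (∀ s ∈ I, MeasurableSet[MeasurableSpace.comap (fun ω => b (Z s ω)) inferInstance] (f s)) →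
      ∀ t, (∀ s ∈ I, s ≤ t) → ∀ p, μ.real ((⋂ s ∈ I, f s) ∩ Z t ⁻¹' {p})
        = (∑ x ∈ fib (b p), μ.real ((⋂ s ∈ I, f s) ∩ Z t ⁻¹' {x})) * M (b p) p := by
    intro I
    -- Cylinder events, by induction on the largest time `a`: carry the property forward to `a`,
    -- then intersect with the event at time `a`.
    induction I using Finset.induction_on_max with
    | empty =>
      intro f _ t _
      simp only [Finset.notMem_empty, Set.iInter_of_empty, Set.iInter_univ]
      exact hstep 0 t _ MeasurableSet.univ hzero zero_le
    | insert a I hI ih =>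
      intro f hf t ht
      have hfa := hf a (Finset.mem_insert_self a I)
      have hfI : ∀ s ∈ I, MeasurableSet[pastSigma (fun t ω => b (Z t ω)) a] (f s) := fun s hs =>
        (measurable_pastSigma (fun t ω => b (Z t ω)) (hI s hs).le).comap_le _
          (hf s (Finset.mem_insert_of_mem hs))
      refine hstep a t _ ?_ ?_ (ht a (Finset.mem_insert_self a I))
      · refine Finset.measurableSet_biInter _ fun s hs => ?_
        rcases Finset.mem_insert.1 hs with rfl | hs
        · exact (measurable_pastSigma (fun t ω => b (Z t ω)) le_rfl).comap_le _ hfa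
        · exact hfI s hs
      · obtain ⟨B, -, hB⟩ := hfa
        have h := ih f (fun s hs => hf s (Finset.mem_insert_of_mem hs)) a fun s hs => (hI s hs).le
        -- The event at time `a` depends only on the image, so it keeps or discards whole fibres and
        -- leaves the conditional law on each fibre unchanged.
        have hsplit : ∀ x, (⋂ s ∈ insert a I, f s) ∩ Z a ⁻¹' {x}
            = if b x ∈ B then (⋂ s ∈ I, f s) ∩ Z a ⁻¹' {x} else ∅ := by
          intro x
          rw [Finset.set_biInter_insert, ← hB]
          ext ω
          by_cases hx : b x ∈ B
          · simp only [hx, if_true, Set.mem_inter_iff, Set.mem_preimage, Set.mem_singleton_iff]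
            constructor
            · tauto
            · rintro ⟨h1, h2⟩
              exact ⟨⟨by rwa [h2], h1⟩, h2⟩
          · simp only [hx, if_false, Set.mem_inter_iff, Set.mem_preimage, Set.mem_singleton_iff,
              Set.mem_empty_iff_false, iff_false]
            rintro ⟨⟨h1, -⟩, h2⟩
            exact hx (by rwa [← h2])
        intro p
        simp only [hsplit]
        by_cases hp : b p ∈ B
        · rw [if_pos hp, h p]
          congr 1
          refine Finset.sum_congr rfl fun x hx => ?_
          rw [if_pos (by rwa [(hM.mem_fib _ _).1 hx])]
        · rw [if_neg hp, Finset.sum_eq_zero, zero_mul, measureReal_empty]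
          intro x hx
          rw [if_neg (by rwa [(hM.mem_fib _ _).1 hx]), measureReal_empty]
  -- The property of `A` is that the integral of `h` over `A` vanishes. In this form it passes to
  -- complements and countable disjoint unions, and the π-λ theorem extends it from cylinder events
  -- to the whole past.
  let h : Ω → ℝ := fun ω => (Z t ⁻¹' {p}).indicator (fun _ => (1 : ℝ)) ω
    - ((fun ω => b (Z t ω)) ⁻¹' {b p}).indicator (fun _ => M (b p) p) ω
  have hm1 : MeasurableSet (Z t ⁻¹' {p}) := hZ t (measurableSet_singleton p)
  have hm2 : MeasurableSet ((fun ω => b (Z t ω)) ⁻¹' {b p}) := hY t (measurableSet_singleton _)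
  have hi1 : Integrable ((Z t ⁻¹' {p}).indicator (fun _ => (1 : ℝ))) μ :=
    (integrable_const _).indicator hm1
  have hi2 : Integrable (((fun ω => b (Z t ω)) ⁻¹' {b p}).indicator (fun _ => M (b p) p)) μ :=
    (integrable_const _).indicator hm2
  have hint : Integrable h μ := hi1.sub hi2
  have hiff : ∀ A, MeasurableSet A → (∫ ω in A, h ω ∂μ = 0 ↔ μ.real (A ∩ Z t ⁻¹' {p})
      = (∑ x ∈ fib (b p), μ.real (A ∩ Z t ⁻¹' {x})) * M (b p) p) := by
    intro A hA
    rw [integral_sub hi1.integrableOn hi2.integrableOn, setIntegral_indicator hm1,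
      setIntegral_indicator hm2, setIntegral_const, setIntegral_const,
      hM.sum_fib_measureReal (hZ t) hA, sub_eq_zero, smul_eq_mul, smul_eq_mul, mul_one]
  have hle := pastSigma_le hY t
  rw [← hiff A (hle A hA)]
  have huniv : ∫ ω, h ω ∂μ = 0 := by
    rw [← setIntegral_univ, hiff _ MeasurableSet.univ]
    simpa using hfin ∅ (fun _ => Set.univ) (by simp) t (by simp) p
  refine MeasurableSpace.induction_on_inter (m := pastSigma (fun t ω => b (Z t ω)) t)
    (C := fun A _ => ∫ ω in A, h ω ∂μ = 0)
    (generateFrom_piiUnionInter_measurableSet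
      (fun s => MeasurableSpace.comap (fun ω => b (Z s ω)) inferInstance) (Set.Iic t)).symm
    (isPiSystem_piiUnionInter _ (fun s => @MeasurableSpace.isPiSystem_measurableSet Ω
      (MeasurableSpace.comap (fun ω => b (Z s ω)) inferInstance)) _) ?_ ?_ ?_ ?_ A hA
  · simp
  · rintro _ ⟨I, hI, f, hf, rfl⟩
    have hms : MeasurableSet (⋂ s ∈ I, f s) := Finset.measurableSet_biInter _ fun s hs =>
      (hY s).comap_le _ (hf s hs)
    exact (hiff _ hms).2 (hfin I f hf t (fun s hs => hI hs) p)
  · intro A hA h0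
    have := integral_add_compl (hle A hA) hint
    rw [h0, huniv, zero_add] at this
    exact this
  · intro f hd hf h0
    have := hasSum_integral_iUnion (fun i => hle _ (hf i)) hd hint.integrableOn
    simp only [h0] at this
    exact this.unique hasSum_zero

/-- A function of a Markov chain, for a kernel that intertwines the rates, is a Markov chain. -/
theorem isMarkovChainWithRates [MeasurableSpace T] [DiscreteMeasurableSpace T]
    (hM : KernelIntertwines b fib M Q R H C)
    (hZ : IsMarkovChainWithRates μ Z Q) {z : T} (hinit : ∀ p, μ.real (Z 0 ⁻¹' {p}) = M z p) :
    IsMarkovChainWithRates μ (fun t ω => b (Z t ω)) R ∧ (∀ᵐ ω ∂μ, b (Z 0 ω) = z) ∧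
    ∀ (t : ℝ≥0) (p : S), μ[(Z t ⁻¹' {p}).indicator (fun _ => (1 : ℝ)) |
        pastSigma (fun t ω => b (Z t ω)) t] =ᵐ[μ] fun ω => M (b (Z t ω)) p := by
  obtain ⟨P, hP, hQ, hmar⟩ := hZ.markov
  have hb : Measurable b := measurable_of_countable b
  have hY : ∀ t, Measurable fun ω => b (Z t ω) := fun t => hb.comp (hZ.measurable t)
  have hMle : ∀ z p, M z p ≤ 1 := by
    intro z p
    by_cases h : b p = z
    · rw [← hM.sum_kernel z]
      exact Finset.single_le_sum (fun x _ => hM.kernel_nonneg z x) ((hM.mem_fib _ _).2 h)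
    · rw [hM.kernel_support z p h]; exact zero_le_one
  have hPf := hM.isTransitionFunction hP hQ
  refine ⟨⟨hY, ?_, ?_, fibreTransition fib M P, hPf, hM.hasTransitionRates hP hQ, ?_⟩, ?_, ?_⟩
  · filter_upwards [hZ.right_continuous] with ω h t
    exact (h t).mono fun u hu => congrArg b hu
  · filter_upwards [hZ.left_limits] with ω h t
    obtain ⟨x, hx⟩ := h t
    exact ⟨b x, hx.mono fun u hu => congrArg b hu⟩
  · intro s t y
    have hm : MeasurableSet ((fun ω => b (Z (s + t) ω)) ⁻¹' {y}) :=
      hY _ (measurableSet_singleton y)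
    have hbd : ∀ z, |fibreTransition fib M P t z y| ≤ 1 := fun z => by
      rw [abs_of_nonneg (hPf.nonneg t z y)]; exact hPf.le_one t z y
    have hmeas : Measurable[pastSigma (fun t ω => b (Z t ω)) s]
        fun ω => fibreTransition fib M P t (b (Z s ω)) y :=
      (Measurable.of_discrete (f := fun p => fibreTransition fib M P t p y)).comp
        (measurable_pastSigma (fun t ω => b (Z t ω)) le_rfl)
    refine (ae_eq_condExp_of_forall_setIntegral_eq (pastSigma_le hY s)
      ((integrable_const _).indicator hm) ?_ ?_ hmeas.stronglyMeasurable.aestronglyMeasurable).symm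
    · exact fun A _ _ => (Integrable.of_bound
        (hmeas.mono (pastSigma_le hY s) le_rfl).aestronglyMeasurable 1
        (Eventually.of_forall fun ω => hbd _)).integrableOn
    · intro A hA _
      have hA' := pastSigma_le hY s A hA
      rw [setIntegral_indicator hm, setIntegral_const, smul_eq_mul, mul_one,
        ← hM.sum_fib_measureReal (hZ.measurable _) hA']
      -- Both sides are sums over the fibre that contains the chain at time `s`; given an event of
      -- the past of the image, the law on that fibre is the kernel.
      refine HasSum.unique ?_ (hM.hasSum_mul_fibreTransition
        (hM.kernel_law_of_past hP hQ hZ.measurable hmar hinit hA)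
        (hasSum_measureReal_transition hP hZ.measurable hmar (pastSigma_comp_le hb s A hA)) y)
      refine (hasSum_congr_fun fun z => ?_).1 ((hasSum_setIntegral_comp (μ := μ) (hZ.measurable s) A
        (g := fun p => fibreTransition fib M P t (b p) y) fun p => hbd (b p)).sum_fibres hM.mem_fib)
      rw [Finset.sum_mul]
      refine Finset.sum_congr rfl fun p hp => ?_
      rw [(hM.mem_fib _ _).1 hp]
  · have h := hM.sum_fib_measureReal (μ := μ) (hZ.measurable 0) MeasurableSet.univ z
    simp only [Set.univ_inter, hinit, hM.sum_kernel] at h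
    refine (mem_ae_iff_prob_eq_one (hY 0 (measurableSet_singleton z))).2 ?_
    have h2 := (ENNReal.ofReal_toReal (measure_ne_top μ ((fun ω => b (Z 0 ω)) ⁻¹' {z})))
    rw [← h2, ← measureReal_def, ← h, ENNReal.ofReal_one]
  · intro t p
    have hm : MeasurableSet (Z t ⁻¹' {p}) := hZ.measurable t (measurableSet_singleton p)
    have hbd : ∀ z, |M z p| ≤ 1 := fun z => by
      rw [abs_of_nonneg (hM.kernel_nonneg z p)]; exact hMle z p
    have hmeas : Measurable[pastSigma (fun t ω => b (Z t ω)) t] fun ω => M (b (Z t ω)) p :=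
      (Measurable.of_discrete (f := fun z => M z p)).comp
        (measurable_pastSigma (fun t ω => b (Z t ω)) le_rfl)
    refine (ae_eq_condExp_of_forall_setIntegral_eq (pastSigma_le hY t)
      ((integrable_const _).indicator hm) ?_ ?_ hmeas.stronglyMeasurable.aestronglyMeasurable).symm
    · exact fun A _ _ => (Integrable.of_bound
        (hmeas.mono (pastSigma_le hY t) le_rfl).aestronglyMeasurable 1
        (Eventually.of_forall fun ω => hbd _)).integrableOn
    · intro A hA _
      rw [setIntegral_indicator hm, setIntegral_const, smul_eq_mul, mul_one,
        hM.kernel_law_of_past hP hQ hZ.measurable hmar hinit hA p]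
      refine (hasSum_setIntegral_comp (μ := μ) (hZ.measurable t) A (g := fun x => M (b x) p)
        fun x => hbd (b x)).unique ?_
      have : (∑ x ∈ fib (b p), μ.real (A ∩ Z t ⁻¹' {x})) * M (b p) p
          = ∑ x ∈ fib (b p), μ.real (A ∩ Z t ⁻¹' {x}) * M (b x) p := by
        rw [Finset.sum_mul]
        refine Finset.sum_congr rfl fun x hx => ?_
        rw [(hM.mem_fib _ _).1 hx]
      rw [this]
      refine hasSum_sum_of_ne_finset_zero fun x hx => ?_
      rw [hM.kernel_support (b x) p fun h => hx ((hM.mem_fib _ _).2 h.symm), mul_zero]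

end KernelIntertwines

/-! ### `q`-factorials at integers -/

noncomputable section

/-- The `q`-factorial, as a function on the integers. -/
def qFactInt (q : ℝ) (m : ℤ) : ℝ := qFact q m.toNat

/-- The inverse of the `q`-factorial, extended by `0` to the negative integers. -/
def qFactInv (q : ℝ) (m : ℤ) : ℝ := if 0 ≤ m then (qFact q m.toNat)⁻¹ else 0

/-- The factor of the slice weight that belongs to the `i`-th particles. It vanishes unless
`y (i + 1) ≤ x i ≤ y i`. -/
def sliceFactor (q : ℝ) (x y : ℕ → ℤ) (i : ℕ) : ℝ :=
  qFactInt q (y i - y (i + 1)) * qFactInv q (y i - x i) * qFactInv q (x i - y (i + 1))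

/-- The slice weight, extended by `0` to the levels that do not interlace. -/
def extSliceWeight (a : ℕ → ℝ) (q : ℝ) (k : ℕ) (x y : ℕ → ℤ) : ℝ :=
  extParam a k ^ ((∑ i ∈ Finset.Icc 1 ((k + 1) / 2), y i) - ∑ i ∈ Finset.Icc 1 (k / 2), x i)
    * ∏ i ∈ Finset.Icc 1 (k / 2), sliceFactor q x y i

end

section QFact

variable {q : ℝ}

theorem one_sub_zpow_pos (hq0 : 0 < q) (hq1 : q < 1) {m : ℤ} (hm : 0 < m) : 0 < 1 - q ^ m :=
  sub_pos.2 (zpow_lt_one₀ hq0 hq1 hm)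

theorem one_sub_zpow_ne_zero (hq0 : 0 < q) (hq1 : q < 1) {m : ℤ} (hm : 0 < m) : 1 - q ^ m ≠ 0 :=
  (one_sub_zpow_pos hq0 hq1 hm).ne'

theorem qFact_pos (hq0 : 0 < q) (hq1 : q < 1) (m : ℕ) : 0 < qFact q m := by
  refine Finset.prod_pos fun k hk => div_pos ?_ (by linarith)
  have : q ^ k < 1 := pow_lt_one₀ hq0.le hq1 (by have := Finset.mem_Icc.1 hk; omega)
  linarith

theorem qFact_succ (hq1 : q < 1) (m : ℕ) :
    qFact q (m + 1) * (1 - q) = qFact q m * (1 - q ^ (m + 1)) := by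
  have : 1 - q ≠ 0 := by linarith
  rw [qFact, qFact, Finset.prod_Icc_succ_top (by omega)]
  field_simp

theorem qFactInt_sub_one (hq1 : q < 1) {m : ℤ} (hm : 0 < m) :
    qFactInt q (m - 1) * (1 - q ^ m) = qFactInt q m * (1 - q) := by
  obtain ⟨k, rfl⟩ : ∃ k : ℕ, m = k + 1 := ⟨(m - 1).toNat, by omega⟩
  have h1 : ((k : ℤ) + 1 - 1).toNat = k := by omega
  have h2 : ((k : ℤ) + 1).toNat = k + 1 := by omega
  rw [qFactInt, qFactInt, h1, h2, qFact_succ hq1]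
  norm_cast

/-- The recursion holds at every integer: at 0 the factor `1 - q ^ m` vanishes together with
`qFactInv q (-1)`. This lets the ratios of slice weights hold also when a move destroys the
interlacing. -/
theorem qFactInv_sub_one (hq0 : 0 < q) (hq1 : q < 1) (m : ℤ) :
    qFactInv q (m - 1) * (1 - q) = qFactInv q m * (1 - q ^ m) := by
  rcases lt_trichotomy m 0 with h | rfl | h
  · rw [qFactInv, qFactInv, if_neg (by omega), if_neg (by omega), zero_mul, zero_mul]
  · simp [qFactInv]
  · have h1 := qFactInt_sub_one hq1 h
    rw [qFactInt, qFactInt] at h1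
    rw [qFactInv, qFactInv, if_pos (by omega), if_pos (by omega)]
    have h2 := (qFact_pos hq0 hq1 m.toNat).ne'
    have h3 := (qFact_pos hq0 hq1 (m - 1).toNat).ne'
    field_simp
    linarith

theorem qFactInt_mul_qFactInv (hq0 : 0 < q) (hq1 : q < 1) {m : ℤ} (hm : 0 ≤ m) :
    qFactInt q m * qFactInv q m = 1 := by
  rw [qFactInt, qFactInv, if_pos hm]
  exact mul_inv_cancel₀ (qFact_pos hq0 hq1 _).ne'

theorem qFactInv_of_neg {m : ℤ} (hm : m < 0) : qFactInv q m = 0 := by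
  rw [qFactInv, if_neg (by omega)]

theorem qBinom_eq {m k : ℤ} (hk : 0 ≤ k) (hkm : k ≤ m) :
    qBinom q m k = qFactInt q m * qFactInv q k * qFactInv q (m - k) := by
  rw [qBinom, qFactInt, qFactInv, qFactInv, if_pos hk, if_pos (by omega), div_eq_mul_inv, mul_inv,
    mul_assoc]

theorem qBinom_pos (hq0 : 0 < q) (hq1 : q < 1) (m k : ℤ) : 0 < qBinom q m k :=
  div_pos (qFact_pos hq0 hq1 _) (mul_pos (qFact_pos hq0 hq1 _) (qFact_pos hq0 hq1 _))

end QFact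

/-! ### Ratios of slice weights -/

section SliceWeights

variable {a : ℕ → ℝ} {q : ℝ} {k : ℕ}

theorem sum_add_single {s : Finset ℕ} (x : ℕ → ℤ) {i : ℕ} (hi : i ∈ s) :
    ∑ j ∈ s, (x + Pi.single i 1 : ℕ → ℤ) j = ∑ j ∈ s, x j + 1 := by
  simp only [Pi.add_apply, Finset.sum_add_distrib, Finset.sum_pi_single', if_pos hi]

/-- The cross-multiplied form of a ratio, valid when some factors vanish. -/
theorem prod_change {s : Finset ℕ} {f g : ℕ → ℝ} {i : ℕ} {c d : ℝ}
    (hi : i ∈ s) (h : f i * c = g i * d) (hfg : ∀ j ∈ s, j ≠ i → f j = g j) :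
    (∏ j ∈ s, f j) * c = (∏ j ∈ s, g j) * d := by
  rw [← Finset.mul_prod_erase s f hi, ← Finset.mul_prod_erase s g hi,
    Finset.prod_congr rfl fun j hj => hfg j (Finset.mem_of_mem_erase hj) (Finset.ne_of_mem_erase hj)]
  linear_combination (∏ j ∈ s.erase i, g j) * h

theorem sliceFactor_add_single_of_ne {x y : ℕ → ℤ} {i j : ℕ} (h1 : j ≠ i) (h2 : j + 1 ≠ i) :
    sliceFactor q x (y + Pi.single i 1) j = sliceFactor q x y j := by
  simp [sliceFactor, Pi.single_eq_of_ne h1, Pi.single_eq_of_ne h2]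

theorem sliceFactor_add_single_left_of_ne {x y : ℕ → ℤ} {i j : ℕ} (h1 : j ≠ i) :
    sliceFactor q (x + Pi.single i 1) y j = sliceFactor q x y j := by
  simp [sliceFactor, Pi.single_eq_of_ne h1]

/-- The change of the weight when the particle `i` of the upper level moves. -/
theorem extSliceWeight_move_upper (hq0 : 0 < q) (hq1 : q < 1) (ha : extParam a k ≠ 0)
    (x y : ℕ → ℤ) {i : ℕ} (hi : i ∈ Finset.Icc 1 (k / 2)) :
    extSliceWeight a q k x y * (1 - q ^ (y i - x i)) =
      extParam a k * (extSliceWeight a q k (x + Pi.single i 1) y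
        * (1 - q ^ (x i - y (i + 1) + 1))) := by
  have h : (∏ j ∈ Finset.Icc 1 (k / 2), sliceFactor q x y j) * (1 - q ^ (y i - x i))
      = (∏ j ∈ Finset.Icc 1 (k / 2), sliceFactor q (x + Pi.single i 1) y j)
        * (1 - q ^ (x i - y (i + 1) + 1)) := by
    refine prod_change hi ?_ fun j _ hj => (sliceFactor_add_single_left_of_ne hj).symm
    have h1 := qFactInv_sub_one hq0 hq1 (y i - x i)
    have h2 := qFactInv_sub_one hq0 hq1 (x i - y (i + 1) + 1)
    have h3 : y i - (x i + 1) = y i - x i - 1 := by ring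
    have h4 : x i + 1 - y (i + 1) = x i - y (i + 1) + 1 := by ring
    rw [add_sub_cancel_right] at h2
    simp only [sliceFactor, Pi.add_apply, Pi.single_eq_same, h3, h4]
    have : 1 - q ≠ 0 := by linarith
    apply mul_right_cancel₀ this
    linear_combination (qFactInt q (y i - y (i + 1))) * (1 - q ^ (y i - x i)) * qFactInv q (y i - x i) * h2
      - qFactInt q (y i - y (i + 1)) * (1 - q ^ (x i - y (i + 1) + 1)) * qFactInv q (x i - y (i + 1) + 1) * h1
  rw [extSliceWeight, extSliceWeight, sum_add_single x hi, mul_assoc, h]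
  have : extParam a k ^ ((∑ i ∈ Finset.Icc 1 ((k + 1) / 2), y i) - ∑ i ∈ Finset.Icc 1 (k / 2), x i)
      = extParam a k * extParam a k ^ ((∑ i ∈ Finset.Icc 1 ((k + 1) / 2), y i)
        - (∑ i ∈ Finset.Icc 1 (k / 2), x i + 1)) := by
    rw [← zpow_one_add₀ ha]
    congr 1
    ring
  rw [this]
  ring

/-- The factor of the particle `i` when the particle `i` of the lower level moves. -/
theorem sliceFactor_move_lower (hq0 : 0 < q) (hq1 : q < 1) {x y : ℕ → ℤ} {i : ℕ}
    (hy : y (i + 1) ≤ y i) :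
    sliceFactor q x (y + Pi.single i 1) i * (1 - q ^ (y i - x i + 1))
      = sliceFactor q x y i * (1 - q ^ (y i - y (i + 1) + 1)) := by
  have h1 := qFactInv_sub_one hq0 hq1 (y i - x i + 1)
  have h2 := qFactInt_sub_one hq1 (m := y i - y (i + 1) + 1) (by omega)
  have h3 : y i + 1 - x i = y i - x i + 1 := by ring
  have h4 : y i + 1 - y (i + 1) = y i - y (i + 1) + 1 := by ring
  rw [add_sub_cancel_right] at h1 h2
  have h5 : (Pi.single i 1 : ℕ → ℤ) (i + 1) = 0 := Pi.single_eq_of_ne (by omega) _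
  simp only [sliceFactor, Pi.add_apply, Pi.single_eq_same, h3, h4, h5, add_zero]
  linear_combination -qFactInv q (x i - y (i + 1)) * qFactInt q (y i - y (i + 1) + 1) * h1
    - qFactInv q (x i - y (i + 1)) * qFactInv q (y i - x i) * h2

/-- The factor of the particle `i` when the particle `i + 1` of the lower level moves. -/
theorem sliceFactor_move_lower_next (hq0 : 0 < q) (hq1 : q < 1) {x y : ℕ → ℤ} {i : ℕ}
    (hy : y (i + 1) < y i) :
    sliceFactor q x (y + Pi.single (i + 1) 1) i * (1 - q ^ (y i - y (i + 1)))
      = sliceFactor q x y i * (1 - q ^ (x i - y (i + 1))) := by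
  have h1 := qFactInv_sub_one hq0 hq1 (x i - y (i + 1))
  have h2 := qFactInt_sub_one hq1 (m := y i - y (i + 1)) (by omega)
  have h3 : x i - (y (i + 1) + 1) = x i - y (i + 1) - 1 := by ring
  have h4 : y i - (y (i + 1) + 1) = y i - y (i + 1) - 1 := by ring
  have h5 : (Pi.single (i + 1) 1 : ℕ → ℤ) i = 0 := Pi.single_eq_of_ne (by omega) _
  simp only [sliceFactor, Pi.add_apply, Pi.single_eq_same, h3, h4, h5, add_zero]
  linear_combination qFactInv q (x i - y (i + 1) - 1) * qFactInv q (y i - x i) * h2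
    + qFactInv q (y i - x i) * qFactInt q (y i - y (i + 1)) * h1

/-- The factor of the particle `i` does not change when the particle `i` of the lower level is pushed to
the right. -/
theorem sliceFactor_push_right (hq0 : 0 < q) (hq1 : q < 1) {x y : ℕ → ℤ} {i : ℕ}
    (hy : y (i + 1) ≤ y i) (hxy : x i = y i) :
    sliceFactor q (x + Pi.single i 1) (y + Pi.single i 1) i = sliceFactor q x y i := by
  have h5 : (Pi.single i 1 : ℕ → ℤ) (i + 1) = 0 := Pi.single_eq_of_ne (by omega) _
  simp only [sliceFactor, Pi.add_apply, Pi.single_eq_same, h5, add_zero, hxy, sub_self]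
  have h1 := qFactInt_mul_qFactInv hq0 hq1 (m := y i - y (i + 1)) (by omega)
  have h2 := qFactInt_mul_qFactInv hq0 hq1 (m := y i + 1 - y (i + 1)) (by omega)
  linear_combination qFactInv q 0 * h2 - qFactInv q 0 * h1

/-- The factor of the particle `i` does not change when the particle `i + 1` of the lower level is pushed
to the left. -/
theorem sliceFactor_push_left (hq0 : 0 < q) (hq1 : q < 1) {x y : ℕ → ℤ} {i : ℕ}
    (hy : y (i + 1) < y i) (hxy : x i = y (i + 1)) :
    sliceFactor q (x + Pi.single i 1) (y + Pi.single (i + 1) 1) i = sliceFactor q x y i := by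
  have h5 : (Pi.single (i + 1) 1 : ℕ → ℤ) i = 0 := Pi.single_eq_of_ne (by omega) _
  simp only [sliceFactor, Pi.add_apply, Pi.single_eq_same, h5, add_zero, hxy, sub_self]
  have h1 := qFactInt_mul_qFactInv hq0 hq1 (m := y i - y (i + 1)) (by omega)
  have h2 := qFactInt_mul_qFactInv hq0 hq1 (m := y i - (y (i + 1) + 1)) (by omega)
  linear_combination qFactInv q 0 * h2 - qFactInv q 0 * h1

/-- The factor `1 - q ^ (x₍ᵢ₋₁₎ - c)`, with the convention `x₀ = ∞`. -/
noncomputable def gapFactor (q : ℝ) (x : ℕ → ℤ) (i : ℕ) (c : ℤ) : ℝ :=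
  if i = 1 then 1 else 1 - q ^ (x (i - 1) - c)

/-- The product of the slice factors when the particle `i` of the lower level moves. -/
theorem prod_sliceFactor_move_lower (hq0 : 0 < q) (hq1 : q < 1) {m : ℕ} {x y : ℕ → ℤ} {i : ℕ}
    (hi : 1 ≤ i) (him : i ≤ m + 1) (hy : y (i + 1) ≤ y i) (hy' : i ≠ 1 → y i < y (i - 1))
    (hlast : i = m + 1 → x i = y (i + 1)) :
    (∏ j ∈ Finset.Icc 1 m, sliceFactor q x (y + Pi.single i 1) j)
        * ((1 - q ^ (y i - x i + 1)) * gapFactor q y i (y i))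
      = (∏ j ∈ Finset.Icc 1 m, sliceFactor q x y j)
        * ((1 - q ^ (y i - y (i + 1) + 1)) * gapFactor q x i (y i)) := by
  classical
  -- Only the factors `i - 1` and `i` involve `y i`. The numbers `c` and `d` stand for the change of
  -- factor `i`; for `i = m + 1` that factor is absent and `c = d`.
  have key : ∀ c d : ℝ, ((i ∈ Finset.Icc 1 m → sliceFactor q x (y + Pi.single i 1) i * c
      = sliceFactor q x y i * d) ∧ (i ∉ Finset.Icc 1 m → c = d)) →
      (∏ j ∈ Finset.Icc 1 m, sliceFactor q x (y + Pi.single i 1) j)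
        * (c * gapFactor q y i (y i))
      = (∏ j ∈ Finset.Icc 1 m, sliceFactor q x y j) * (d * gapFactor q x i (y i)) := by
    rintro c d ⟨h1, h2⟩
    -- The intermediate product, in which factor `i` has changed and factor `i - 1` has not.
    let f : ℕ → ℝ := fun j => if j = i then sliceFactor q x (y + Pi.single i 1) j
      else sliceFactor q x y j
    have hstep1 : (∏ j ∈ Finset.Icc 1 m, f j) * c
        = (∏ j ∈ Finset.Icc 1 m, sliceFactor q x y j) * d := by
      by_cases hmem : i ∈ Finset.Icc 1 m
      · refine prod_change hmem ?_ fun j _ hj => by simp only [f, if_neg hj]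
        simp only [f, if_true]
        exact h1 hmem
      · rw [h2 hmem]
        congr 1
        refine Finset.prod_congr rfl fun j hj => ?_
        simp only [f, if_neg (show j ≠ i by rintro rfl; exact hmem hj)]
    have hstep2 : (∏ j ∈ Finset.Icc 1 m, sliceFactor q x (y + Pi.single i 1) j)
          * gapFactor q y i (y i)
        = (∏ j ∈ Finset.Icc 1 m, f j) * gapFactor q x i (y i) := by
      by_cases hi1 : i = 1
      · rw [gapFactor, gapFactor, if_pos hi1, if_pos hi1]
        congr 1
        refine Finset.prod_congr rfl fun j hj => ?_
        by_cases hj1 : j = i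
        · simp only [f, if_pos hj1]
        · simp only [f, if_neg hj1]
          have := Finset.mem_Icc.1 hj
          exact sliceFactor_add_single_of_ne hj1 (by omega)
      · rw [gapFactor, gapFactor, if_neg hi1, if_neg hi1]
        obtain ⟨l, rfl⟩ : ∃ l, i = l + 1 := ⟨i - 1, by omega⟩
        rw [add_tsub_cancel_right]
        have hl : l ∈ Finset.Icc 1 m := Finset.mem_Icc.2 ⟨by omega, by omega⟩
        refine prod_change hl ?_ ?_
        · simp only [f, if_neg (show l ≠ l + 1 by omega)]
          exact sliceFactor_move_lower_next hq0 hq1 (by simpa using hy' hi1)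
        · intro j _ hj
          by_cases hj1 : j = l + 1
          · simp only [f, if_pos hj1]
          · simp only [f, if_neg hj1]
            exact sliceFactor_add_single_of_ne hj1 (by omega)
    linear_combination c * hstep2 + gapFactor q x i (y i) * hstep1
  refine key _ _ ⟨fun _ => sliceFactor_move_lower hq0 hq1 hy, fun h => ?_⟩
  rw [hlast (by rw [Finset.mem_Icc] at h; omega)]

/-- `hlast` concerns odd `k` only, where the last lower particle has no upper particle of the same
index. For shapes both entries in it are the default value 0. -/
theorem extSliceWeight_move_lower (hq0 : 0 < q) (hq1 : q < 1) (ha : extParam a k ≠ 0)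
    {x y : ℕ → ℤ} {i : ℕ} (hi : 1 ≤ i) (hik : i ≤ (k + 1) / 2) (hy : y (i + 1) ≤ y i)
    (hy' : i ≠ 1 → y i < y (i - 1)) (hlast : i = k / 2 + 1 → x i = y (i + 1)) :
    extSliceWeight a q k x (y + Pi.single i 1)
        * ((1 - q ^ (y i - x i + 1)) * gapFactor q y i (y i))
      = extParam a k * extSliceWeight a q k x y
        * ((1 - q ^ (y i - y (i + 1) + 1)) * gapFactor q x i (y i)) := by
  have h := prod_sliceFactor_move_lower hq0 hq1 (x := x) hi (by omega) hy hy' hlast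
  rw [extSliceWeight, extSliceWeight, sum_add_single y (Finset.mem_Icc.2 ⟨hi, hik⟩), mul_assoc, h,
    add_sub_right_comm, zpow_add_one₀ ha]
  ring

/-- The rate `R_j` cancels the ratio of slice weights up to `gapFactor q y i (y i)`, which is the
rate f_N of the same move of the lower level. Thus an unpushed jump balances on its own. -/
theorem extSliceWeight_jump_right (hq0 : 0 < q) (hq1 : q < 1) (ha : extParam a k ≠ 0)
    {x y : ℕ → ℤ} {i : ℕ} (hi : 1 ≤ i) (hik : i ≤ (k + 1) / 2) (hy : y (i + 1) ≤ y i)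
    (hy' : i ≠ 1 → y i < y (i - 1)) (hlast : i = k / 2 + 1 → x i = y (i + 1)) (hxy : x i ≤ y i) :
    extSliceWeight a q k x y * (extParam a k * rightFactor q y x i)
      = extSliceWeight a q k x (y + Pi.single i 1) * gapFactor q y i (y i) := by
  have h := extSliceWeight_move_lower hq0 hq1 ha hi hik hy hy' hlast
  have h1 := one_sub_zpow_ne_zero hq0 hq1 (m := y i - x i + 1) (by omega)
  have h2 : rightFactor q y x i
      = gapFactor q x i (y i) * ((1 - q ^ (y i - y (i + 1) + 1)) / (1 - q ^ (y i - x i + 1))) := rfl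
  rw [h2]
  field_simp
  linear_combination -h

/-- Here `y` is the target of the jump and `y + Pi.single i 1` its source, so both directions use
the same `extSliceWeight_move_lower`. -/
theorem extSliceWeight_jump_left (hq0 : 0 < q) (hq1 : q < 1) (ha : extParam a k ≠ 0)
    {x y : ℕ → ℤ} {i : ℕ} (hi : 1 ≤ i) (hik : i ≤ (k + 1) / 2) (hy : y (i + 1) ≤ y i)
    (hy' : i ≠ 1 → y i < y (i - 1)) (hlast : i = k / 2 + 1 → x i = y (i + 1))
    (hxy : i ≠ 1 → y i < x (i - 1)) :
    extSliceWeight a q k x (y + Pi.single i 1)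
        * ((extParam a k)⁻¹ * leftFactor q (y + Pi.single i 1) x i)
      = extSliceWeight a q k x y * (1 - q ^ (y i - y (i + 1) + 1)) := by
  have h := extSliceWeight_move_lower hq0 hq1 ha hi hik hy hy' hlast
  have h1 : gapFactor q x i (y i) ≠ 0 := by
    rw [gapFactor]
    split_ifs with hi1
    · exact one_ne_zero
    · exact one_sub_zpow_ne_zero hq0 hq1 (by have := hxy hi1; omega)
  have h2 : leftFactor q (y + Pi.single i 1) x i
      = (1 - q ^ (y i - x i + 1)) * (gapFactor q y i (y i) / gapFactor q x i (y i)) := by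
    have h3 : y i + 1 - x i = y i - x i + 1 := by ring
    rw [leftFactor, gapFactor, gapFactor, Pi.add_apply, Pi.single_eq_same, h3]
    split_ifs with hi1
    · simp
    · have h4 : y (i - 1) - (y i + 1) + 1 = y (i - 1) - y i := by ring
      have h5 : x (i - 1) - (y i + 1) + 1 = x (i - 1) - y i := by ring
      rw [Pi.add_apply, Pi.single_eq_of_ne (by omega), add_zero, h4, h5]
  rw [h2]
  field_simp
  linear_combination h

/-- The factor of the pushed pair is unchanged. Only factor `i - 1` changes, and it exchanges the
rate of the upper particle for that of the lower one. -/
theorem extSliceWeight_push_right (hq0 : 0 < q) (hq1 : q < 1)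
    {x y : ℕ → ℤ} {i : ℕ} (hi : 1 ≤ i) (hik : i ≤ k / 2) (hy : y (i + 1) ≤ y i)
    (hy' : i ≠ 1 → y i < y (i - 1)) (hxy : x i = y i) :
    extSliceWeight a q k (x + Pi.single i 1) (y + Pi.single i 1) * gapFactor q y i (y i)
      = extSliceWeight a q k x y * gapFactor q x i (x i) := by
  have h : (∏ j ∈ Finset.Icc 1 (k / 2), sliceFactor q (x + Pi.single i 1) (y + Pi.single i 1) j)
        * gapFactor q y i (y i)
      = (∏ j ∈ Finset.Icc 1 (k / 2), sliceFactor q x y j) * gapFactor q x i (x i) := by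
    have hmid : ∀ j, j + 1 ≠ i → sliceFactor q (x + Pi.single i 1) (y + Pi.single i 1) j
        = sliceFactor q x y j := by
      intro j hj
      by_cases hji : j = i
      · rw [hji]; exact sliceFactor_push_right hq0 hq1 hy hxy
      · rw [sliceFactor_add_single_left_of_ne hji, sliceFactor_add_single_of_ne hji hj]
    by_cases hi1 : i = 1
    · rw [gapFactor, gapFactor, if_pos hi1, if_pos hi1]
      congr 1
      refine Finset.prod_congr rfl fun j hj => hmid j ?_
      have := Finset.mem_Icc.1 hj
      omega
    · rw [gapFactor, gapFactor, if_neg hi1, if_neg hi1]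
      obtain ⟨l, rfl⟩ : ∃ l, i = l + 1 := ⟨i - 1, by omega⟩
      rw [add_tsub_cancel_right, hxy]
      refine prod_change (i := l) (Finset.mem_Icc.2 ⟨by omega, by omega⟩) ?_
        fun j _ hj => hmid j (by omega)
      rw [sliceFactor_add_single_left_of_ne (by omega)]
      exact sliceFactor_move_lower_next hq0 hq1 (by simpa using hy' hi1)
  rw [extSliceWeight, extSliceWeight, sum_add_single y (Finset.mem_Icc.2 ⟨hi, by omega⟩),
    sum_add_single x (Finset.mem_Icc.2 ⟨hi, hik⟩), mul_assoc, h, add_sub_add_right_eq_sub, mul_assoc]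

/-- The target is `(x, y)`. Factor `i` is unchanged, and factor `i + 1` exchanges the two rates; for
`i = k / 2` it is absent and the rates agree already. -/
theorem extSliceWeight_push_left (hq0 : 0 < q) (hq1 : q < 1)
    {x y : ℕ → ℤ} {i : ℕ} (hi : 1 ≤ i) (hik : i + 1 ≤ (k + 1) / 2)
    (hy : y (i + 2) ≤ y (i + 1)) (hy' : y (i + 1) < y i) (hxy : x i = y (i + 1))
    (hlast : i = k / 2 → x (i + 1) = y (i + 2)) :
    extSliceWeight a q k (x + Pi.single i 1) (y + Pi.single (i + 1) 1)
        * (1 - q ^ (x i - x (i + 1) + 1))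
      = extSliceWeight a q k x y * (1 - q ^ (y (i + 1) - y (i + 2) + 1)) := by
  have h : (∏ j ∈ Finset.Icc 1 (k / 2),
        sliceFactor q (x + Pi.single i 1) (y + Pi.single (i + 1) 1) j)
        * (1 - q ^ (x i - x (i + 1) + 1))
      = (∏ j ∈ Finset.Icc 1 (k / 2), sliceFactor q x y j)
        * (1 - q ^ (y (i + 1) - y (i + 2) + 1)) := by
    have hmid : ∀ j, j ≠ i + 1 →
        sliceFactor q (x + Pi.single i 1) (y + Pi.single (i + 1) 1) j = sliceFactor q x y j := by
      intro j hj
      by_cases hji : j = i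
      · rw [hji]; exact sliceFactor_push_left hq0 hq1 hy' hxy
      · rw [sliceFactor_add_single_left_of_ne hji, sliceFactor_add_single_of_ne hj (by omega)]
    by_cases hi1 : i = k / 2
    · rw [hlast hi1, hxy]
      congr 1
      refine Finset.prod_congr rfl fun j hj => hmid j ?_
      have := Finset.mem_Icc.1 hj
      omega
    · refine prod_change (i := i + 1) (Finset.mem_Icc.2 ⟨by omega, by omega⟩) ?_
        fun j _ hj => hmid j hj
      rw [sliceFactor_add_single_left_of_ne (by omega), hxy]
      exact sliceFactor_move_lower hq0 hq1 hy
  rw [extSliceWeight, extSliceWeight, sum_add_single y (Finset.mem_Icc.2 ⟨by omega, hik⟩),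
    sum_add_single x (Finset.mem_Icc.2 ⟨hi, by omega⟩), mul_assoc, h, add_sub_add_right_eq_sub,
    mul_assoc]

end SliceWeights

/-! ### The balance of the exit rates of two consecutive levels -/

section ExitRates

variable {q : ℝ}

/-- The exit rate of the lower particle `i` is compared with the flow of the upper particle `i`
arriving from `x i - 1`, reweighted by the ratio of slice weights. The difference telescopes in `i`.
-/
theorem rightFactor_sub (hq0 : 0 < q) (hq1 : q < 1) {x y : ℕ → ℤ} {i : ℕ} (h : x i ≤ y i) :
    rightFactor q y x i - gapFactor q x i (x i - 1) * (1 - q ^ (x i - y (i + 1)))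
        / (1 - q ^ (y i - x i + 1))
      = q ^ (x i - y (i + 1)) - (if i = 1 then 0 else q ^ (x (i - 1) - y i)) := by
  have hD := one_sub_zpow_ne_zero hq0 hq1 (m := y i - x i + 1) (by omega)
  rw [rightFactor, gapFactor, ← mul_div_assoc, ← sub_div, div_eq_iff hD]
  simp only [zpow_sub₀ hq0.ne', zpow_add₀ hq0.ne', zpow_one]
  have h1 : q ^ x i ≠ 0 := (zpow_pos hq0 _).ne'
  have h2 : q ^ y i ≠ 0 := (zpow_pos hq0 _).ne'
  have h3 : q ^ y (i + 1) ≠ 0 := (zpow_pos hq0 _).ne'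
  have h4 := hq0.ne'
  split_ifs
  · field_simp
    ring
  · field_simp
    ring

/-- For left moves the lower particle `i + 1` is paired with the upper particle `i`. The first lower
particle remains unpaired and starts the sum in `sum_leftFactor_sub`. -/
theorem leftFactor_sub (hq0 : 0 < q) (hq1 : q < 1) {x y : ℕ → ℤ} {i : ℕ} (hi : 1 ≤ i)
    (h : y (i + 1) ≤ x i) :
    leftFactor q y x (i + 1) - (1 - q ^ (x i - x (i + 1) + 1)) * (1 - q ^ (y i - x i))
        / (1 - q ^ (x i - y (i + 1) + 1))
      = q ^ (y i - x i) - q ^ (y (i + 1) - x (i + 1)) := by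
  have hD := one_sub_zpow_ne_zero hq0 hq1 (m := x i - y (i + 1) + 1) (by omega)
  rw [leftFactor, if_neg (by omega), add_tsub_cancel_right, ← mul_div_assoc, ← sub_div,
    div_eq_iff hD]
  simp only [zpow_sub₀ hq0.ne', zpow_add₀ hq0.ne', zpow_one]
  have h1 : q ^ x i ≠ 0 := (zpow_pos hq0 _).ne'
  have h2 : q ^ y i ≠ 0 := (zpow_pos hq0 _).ne'
  have h3 : q ^ y (i + 1) ≠ 0 := (zpow_pos hq0 _).ne'
  have h5 : q ^ x (i + 1) ≠ 0 := (zpow_pos hq0 _).ne'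
  have h4 := hq0.ne'
  field_simp
  ring

theorem sum_rightFactor_sub (hq0 : 0 < q) (hq1 : q < 1) {x y : ℕ → ℤ} (m : ℕ)
    (h : ∀ i, 1 ≤ i → x i ≤ y i) :
    ∑ i ∈ Finset.Icc 1 m, rightFactor q y x i
      - ∑ i ∈ Finset.Icc 1 m, gapFactor q x i (x i - 1) * (1 - q ^ (x i - y (i + 1)))
        / (1 - q ^ (y i - x i + 1))
      = if m = 0 then 0 else q ^ (x m - y (m + 1)) := by
  rw [← Finset.sum_sub_distrib]
  induction m with
  | zero => simp
  | succ m ih =>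
    rw [Finset.sum_Icc_succ_top (by omega), ih, rightFactor_sub hq0 hq1 (h _ (by omega))]
    by_cases hm : m = 0
    · subst hm; simp
    · simp [hm]

theorem sum_leftFactor_sub (hq0 : 0 < q) (hq1 : q < 1) {x y : ℕ → ℤ} (m : ℕ)
    (h : ∀ i, 1 ≤ i → y (i + 1) ≤ x i) :
    ∑ i ∈ Finset.Icc 1 (m + 1), leftFactor q y x i
      - ∑ i ∈ Finset.Icc 1 m, (1 - q ^ (x i - x (i + 1) + 1)) * (1 - q ^ (y i - x i))
        / (1 - q ^ (x i - y (i + 1) + 1))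
      = 1 - q ^ (y (m + 1) - x (m + 1)) := by
  induction m with
  | zero => simp [leftFactor]
  | succ m ih =>
    rw [Finset.sum_Icc_succ_top (b := m + 1) (by omega), Finset.sum_Icc_succ_top (b := m) (by omega)
      (fun i => (1 - q ^ (x i - x (i + 1) + 1)) * (1 - q ^ (y i - x i))
        / (1 - q ^ (x i - y (i + 1) + 1)))]
    linear_combination ih + leftFactor_sub hq0 hq1 (x := x) (y := y) (i := m + 1) (by omega)
      (h _ (by omega))

end ExitRates

/-! ### Interlacing shapes -/

/-- The shapes `x` and `y` of consecutive levels interlace. -/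
def Shape.Interlaces {m n : ℕ} (x : Shape m) (y : Shape n) : Prop :=
  ∀ j, 1 ≤ j → x.part j ≤ y.part j ∧ y.part (j + 1) ≤ x.part j

/-- The shape `x` with the raw parts `f`, if they interlace with a shape. -/
def Shape.ofInterlacing {m n : ℕ} (y : Shape n) (f : ℕ → ℤ)
    (hf : ∀ j, ¬ (1 ≤ j ∧ j ≤ m) → f j = 0)
    (h : ∀ j, 1 ≤ j → f j ≤ y.part j ∧ y.part (j + 1) ≤ f j) : Shape m where
  part := f
  nonneg j := by
    by_cases hj : 1 ≤ j
    · exact (y.nonneg _).trans (h j hj).2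
    · exact (hf j (by tauto)).ge
  support := hf
  antitone j hj := (h (j + 1) (by omega)).1.trans (h j hj).2

noncomputable section

/-- The diagonal entries of the rate matrix on shapes. -/
def diagRate (n N : ℕ) (a : ℕ → ℝ) (q : ℝ) (z : ℕ → ℤ) : ℝ :=
  if N = 2 * n then -∑ i ∈ Finset.Icc 1 n, (a i + (a i)⁻¹)
  else -(∑ i ∈ Finset.Icc 1 (n - 1), (a i + (a i)⁻¹)) - a n - (a n)⁻¹ * (1 - q ^ z n)

open Classical in
/-- The rate matrix on shapes before the Doob transform. -/
def levelRate {n : ℕ} (N : ℕ) (a : ℕ → ℝ) (q : ℝ) (z z' : Shape n) : ℝ :=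
  if z' = z then diagRate n N a q z.part else jumpFactor q z z'

/-- The parts of the lower level after the upper level has moved from `x'` to `x`. -/
def pushLevel (n : ℕ) (x' x y' : ℕ → ℤ) : ℕ → ℤ := fun i =>
  if x i = x' i + 1 ∧ x' i = y' i then y' i + 1
  else if 2 ≤ i ∧ i ≤ n ∧ x (i - 1) = x' (i - 1) - 1 ∧ x' (i - 1) = y' i then y' i - 1
  else y' i

open Classical in
/-- The rates of the jumps of the level `k` of its own accord, the level above it being `x`. -/
def ownRate (a : ℕ → ℝ) (q : ℝ) (k : ℕ) (x y' y : ℕ → ℤ) : ℝ :=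
  if y = y' then -∑ j ∈ Finset.Icc 1 ((k + 1) / 2),
    (extParam a k * rightFactor q y' x j + (extParam a k)⁻¹ * leftFactor q y' x j)
  else ∑ j ∈ Finset.Icc 1 ((k + 1) / 2),
    ((if y = y' + Pi.single j 1 then extParam a k * rightFactor q y' x j else 0)
      + (if y' = y + Pi.single j 1 then (extParam a k)⁻¹ * leftFactor q y' x j else 0))

end

/-! ### Unit vectors -/

section Single

theorem single_one_injective {i j : ℕ} (h : (Pi.single i 1 : ℕ → ℤ) = Pi.single j 1) : i = j := by
  by_contra hij
  have := congrFun h i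
  rw [Pi.single_eq_same, Pi.single_eq_of_ne hij] at this
  omega

theorem single_add_single_ne_zero (i j : ℕ) :
    (Pi.single i 1 + Pi.single j 1 : ℕ → ℤ) ≠ 0 := by
  intro h
  have h1 := congrFun h i
  have h2 : (0 : ℤ) ≤ (Pi.single j 1 : ℕ → ℤ) i := by
    by_cases hij : i = j
    · subst hij; simp
    · rw [Pi.single_eq_of_ne hij]
  simp only [Pi.add_apply, Pi.single_eq_same, Pi.zero_apply] at h1
  omega

theorem add_single_ne_self (f : ℕ → ℤ) (i : ℕ) : f + Pi.single i 1 ≠ f := by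
  intro h
  have := congrFun h i
  simp at this

end Single

/-! ### Jump rates between neighbouring shapes -/

section JumpFactor

variable {n : ℕ} {q : ℝ} {z z' : Shape n} {i : ℕ}

theorem jumpFactor_right (hi : i ∈ Finset.Icc 1 n) (h : z'.part = z.part + Pi.single i 1) :
    jumpFactor q z z' = gapFactor q z.part i (z.part i) := by
  have hd : z'.part - z.part = Pi.single i 1 := by rw [h, add_sub_cancel_left]
  rw [jumpFactor, Finset.sum_eq_single_of_mem i hi]
  · have hne : z'.part - z.part ≠ -Pi.single i 1 := by
      rw [hd]
      intro h0
      exact single_add_single_ne_zero i i (by linear_combination h0)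
    rw [if_pos hd, if_neg hne, add_zero, gapFactor]
  · intro j _ hj
    rw [hd, if_neg fun h0 => hj (single_one_injective h0).symm, if_neg, add_zero]
    intro h0
    exact single_add_single_ne_zero i j (by linear_combination h0)

theorem jumpFactor_left (hi : i ∈ Finset.Icc 1 n) (h : z.part = z'.part + Pi.single i 1) :
    jumpFactor q z z' = 1 - q ^ (z'.part i - z'.part (i + 1) + 1) := by
  have hd : z'.part - z.part = -Pi.single i 1 := by rw [h, sub_add_cancel_left]
  rw [jumpFactor, Finset.sum_eq_single_of_mem i hi]
  · rw [if_pos hd, if_neg, zero_add, h]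
    · simp only [Pi.add_apply, Pi.single_eq_same]
      rw [Pi.single_eq_of_ne (by omega)]
      ring_nf
    · rw [hd]
      intro h0
      exact single_add_single_ne_zero i i (by linear_combination -h0)
  · intro j _ hj
    rw [hd, if_neg, if_neg fun h0 => hj (single_one_injective (neg_inj.1 h0)).symm, add_zero]
    intro h0
    exact single_add_single_ne_zero i j (by linear_combination -h0)

theorem exists_of_jumpFactor_ne_zero (h : jumpFactor q z z' ≠ 0) :
    ∃ i ∈ Finset.Icc 1 n, z'.part = z.part + Pi.single i 1 ∨ z.part = z'.part + Pi.single i 1 := by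
  obtain ⟨i, hi, h0⟩ := Finset.exists_ne_zero_of_sum_ne_zero h
  refine ⟨i, hi, ?_⟩
  by_cases h1 : z'.part - z.part = Pi.single i 1
  · left; linear_combination h1
  · by_cases h2 : z'.part - z.part = -Pi.single i 1
    · right; linear_combination -h2
    · rw [if_neg h1, if_neg h2, add_zero] at h0
      exact absurd rfl h0

theorem jumpFactor_self : jumpFactor q z z = 0 := by
  by_contra h
  obtain ⟨i, -, h | h⟩ := exists_of_jumpFactor_ne_zero h <;>
  exact add_single_ne_self _ i h.symm

theorem levelRate_right {N : ℕ} {a : ℕ → ℝ} (hi : i ∈ Finset.Icc 1 n)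
    (h : z'.part = z.part + Pi.single i 1) :
    levelRate N a q z z' = gapFactor q z.part i (z.part i) := by
  rw [levelRate, if_neg, jumpFactor_right hi h]
  rintro rfl
  exact add_single_ne_self _ i h.symm

theorem levelRate_left {N : ℕ} {a : ℕ → ℝ} (hi : i ∈ Finset.Icc 1 n)
    (h : z.part = z'.part + Pi.single i 1) :
    levelRate N a q z z' = 1 - q ^ (z'.part i - z'.part (i + 1) + 1) := by
  rw [levelRate, if_neg, jumpFactor_left hi h]
  rintro rfl
  exact add_single_ne_self _ i h.symm

end JumpFactor

/-! ### Response of the lower level to a move of the upper level -/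

section PushLevel

variable {n i : ℕ} {x' x y' : ℕ → ℤ}

theorem pushLevel_self : pushLevel n x x y' = y' := by
  funext i
  rw [pushLevel, if_neg (by omega), if_neg (by omega)]

theorem pushLevel_right (h : x = x' + Pi.single i 1) :
    pushLevel n x' x y' = if x' i = y' i then y' + Pi.single i 1 else y' := by
  subst h
  funext j
  have h2 : (x' + Pi.single i 1 : ℕ → ℤ) (j - 1) ≠ x' (j - 1) - 1 := by
    rw [Pi.add_apply]
    by_cases hj : j - 1 = i
    · rw [hj, Pi.single_eq_same]; omega
    · rw [Pi.single_eq_of_ne hj]; omega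
  rw [pushLevel]
  simp only [h2, false_and, and_false, if_false]
  by_cases hj : j = i
  · subst hj
    split_ifs <;> simp_all
  · rw [Pi.add_apply, Pi.single_eq_of_ne hj, if_neg (by omega)]
    split_ifs <;> simp [Pi.single_eq_of_ne hj]

theorem pushLevel_left (hi : 1 ≤ i) (h : x' = x + Pi.single i 1) :
    pushLevel n x' x y' = if x' i = y' (i + 1) ∧ i + 1 ≤ n then y' - Pi.single (i + 1) 1 else y' := by
  subst h
  funext j
  have h1 : x j ≠ (x + Pi.single i 1 : ℕ → ℤ) j + 1 := by
    rw [Pi.add_apply]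
    by_cases hj : j = i
    · rw [hj, Pi.single_eq_same]; omega
    · rw [Pi.single_eq_of_ne hj]; omega
  rw [pushLevel]
  simp only [h1, false_and, if_false]
  by_cases hj : j = i + 1
  · subst hj
    simp only [Pi.add_apply, Pi.single_eq_same, add_tsub_cancel_right]
    by_cases hc : x i + 1 = y' (i + 1) ∧ i + 1 ≤ n
    · rw [if_pos hc, if_pos ⟨by omega, hc.2, by trivial, hc.1⟩]; simp
    · rw [if_neg hc, if_neg fun h => hc ⟨h.2.2.2, h.2.1⟩]
  · have h3 : ¬ (2 ≤ j ∧ j ≤ n ∧ x (j - 1) = (x + Pi.single i 1 : ℕ → ℤ) (j - 1) - 1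
        ∧ (x + Pi.single i 1 : ℕ → ℤ) (j - 1) = y' j) := by
      rintro ⟨h4, -, h5, -⟩
      rw [Pi.add_apply, Pi.single_eq_of_ne (by omega)] at h5
      omega
    rw [if_neg h3]
    split_ifs <;> simp [Pi.single_eq_of_ne hj]

end PushLevel

/-! ### The slice weights of interlacing shapes -/

section Weights

variable {a : ℕ → ℝ} {q : ℝ} {N : ℕ}

/-- For even `k` the separate last binomial is the slice factor with `y (k / 2 + 1) = 0`; for odd
`k` the two products have the same range. -/
theorem sliceWeight_eq_extSliceWeight {x : Shape ((N + 1) / 2)} {y : Shape ((N + 1 + 1) / 2)}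
    (h : x.Interlaces y) :
    sliceWeight a q (N + 1) x.part y.part = extSliceWeight a q (N + 1) x.part y.part := by
  have hf : ∀ i, 1 ≤ i → qBinom q (y.part i - y.part (i + 1)) (y.part i - x.part i)
      = sliceFactor q x.part y.part i := by
    intro i hi
    have := h i hi
    rw [qBinom_eq (by omega) (by omega), sliceFactor]
    congr 2
    ring
  have hy : ∀ i, (N + 1 + 1) / 2 < i → y.part i = 0 := fun i hi => y.support i (by omega)
  rw [sliceWeight, extSliceWeight, mul_assoc]
  congr 1
  -- The types of the shapes contain the bounds to be rewritten, so bare functions replace the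
  -- shapes.
  clear h
  generalize x.part = f at hf ⊢
  generalize y.part = g at hf hy ⊢
  rcases Nat.even_or_odd (N + 1) with he | ho
  · obtain ⟨l, hl⟩ := he
    have h1 : (N + 1) / 2 = (l - 1) + 1 := by omega
    have h2 : (N + 1 + 1) / 2 - 1 = l - 1 := by omega
    rw [if_pos ⟨l, hl⟩, h1, h2, Finset.prod_Icc_succ_top (by omega), ← hf _ (by omega),
      hy (l - 1 + 1 + 1) (by omega), sub_zero]
    congr 1
    refine Finset.prod_congr rfl fun i hi => hf i (Finset.mem_Icc.1 hi).1
  · obtain ⟨l, hl⟩ := id ho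
    have h1 : (N + 1) / 2 = l := by omega
    have h2 : (N + 1 + 1) / 2 - 1 = l := by omega
    rw [if_neg (Nat.not_even_iff_odd.2 ho), h1, h2, mul_one]
    refine Finset.prod_congr rfl fun i hi => hf i (Finset.mem_Icc.1 hi).1

/-- `qFactInv` vanishes at negative integers, so a nonzero weight forces the inequalities of
interlacing, and these make `f` a shape. -/
theorem exists_shape_of_extSliceWeight_ne_zero {f : ℕ → ℤ} {y : Shape ((N + 1 + 1) / 2)}
    (hf : ∀ j, ¬ (1 ≤ j ∧ j ≤ (N + 1) / 2) → f j = 0)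
    (h : extSliceWeight a q (N + 1) f y.part ≠ 0) :
    ∃ x : Shape ((N + 1) / 2), x.part = f ∧ x.Interlaces y := by
  have hint : ∀ j, 1 ≤ j → f j ≤ y.part j ∧ y.part (j + 1) ≤ f j := by
    intro j hj
    by_cases hjm : j ≤ (N + 1) / 2
    · have h1 := Finset.prod_ne_zero_iff.1 (right_ne_zero_of_mul h) j (Finset.mem_Icc.2 ⟨hj, hjm⟩)
      have h2 := right_ne_zero_of_mul (left_ne_zero_of_mul h1)
      have h3 := right_ne_zero_of_mul h1
      constructor
      · by_contra hlt
        exact h2 (qFactInv_of_neg (by omega))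
      · by_contra hlt
        exact h3 (qFactInv_of_neg (by omega))
    · rw [hf j (by omega), y.support (j + 1) (by omega)]
      exact ⟨y.nonneg j, le_rfl⟩
  exact ⟨Shape.ofInterlacing y f hf hint, rfl, hint⟩

theorem extSliceWeight_eq_zero {x : Shape ((N + 1) / 2)} {y : Shape ((N + 1 + 1) / 2)}
    (h : ¬ x.Interlaces y) : extSliceWeight a q (N + 1) x.part y.part = 0 := by
  by_contra h0
  obtain ⟨x', h1, h2⟩ := exists_shape_of_extSliceWeight_ne_zero x.support h0
  rw [Shape.ext h1] at h2
  exact h h2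

end Weights

/-! ### The balance equation of two consecutive levels -/

section TwoLevels

variable {a : ℕ → ℝ} {q : ℝ} {N : ℕ}

theorem Shape.part_le_pred_of_succ {n : ℕ} {y y' : Shape n} {i : ℕ} (hi : 1 ≤ i)
    (h : y.part = y'.part + Pi.single i 1) (hi1 : i ≠ 1) : y'.part i < y'.part (i - 1) := by
  have h1 := congrFun h i
  have h2 := congrFun h (i - 1)
  rw [Pi.add_apply, Pi.single_eq_same] at h1
  rw [Pi.add_apply, Pi.single_eq_of_ne (by omega)] at h2
  have h3 := y.antitone (i - 1) (by omega)
  rw [show i - 1 + 1 = i by omega] at h3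
  omega

theorem ownRate_self (k : ℕ) (x y : ℕ → ℤ) :
    ownRate a q k x y y = -∑ j ∈ Finset.Icc 1 ((k + 1) / 2),
      (extParam a k * rightFactor q y x j + (extParam a k)⁻¹ * leftFactor q y x j) := by
  rw [ownRate, if_pos rfl]

theorem ownRate_right {k i : ℕ} {x y' y : ℕ → ℤ} (hi : i ∈ Finset.Icc 1 ((k + 1) / 2))
    (h : y = y' + Pi.single i 1) :
    ownRate a q k x y' y = extParam a k * rightFactor q y' x i := by
  have h2 : ∀ j, y' ≠ y + Pi.single j 1 := by
    intro j h'
    rw [h] at h'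
    exact single_add_single_ne_zero i j (by linear_combination -h')
  rw [ownRate, if_neg (by rw [h]; exact add_single_ne_self _ _), Finset.sum_eq_single_of_mem i hi,
    if_pos h, if_neg (h2 i), add_zero]
  intro j _ hj
  rw [if_neg, if_neg (h2 j), add_zero]
  rw [h]
  exact fun h' => hj (single_one_injective (add_left_cancel h')).symm

theorem ownRate_left {k i : ℕ} {x y' y : ℕ → ℤ} (hi : i ∈ Finset.Icc 1 ((k + 1) / 2))
    (h : y' = y + Pi.single i 1) :
    ownRate a q k x y' y = (extParam a k)⁻¹ * leftFactor q y' x i := by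
  have h2 : ∀ j, y ≠ y' + Pi.single j 1 := by
    intro j h'
    rw [h] at h'
    exact single_add_single_ne_zero i j (by linear_combination -h')
  have h3 : y ≠ y' := by rw [h]; exact (add_single_ne_self _ _).symm
  rw [ownRate, if_neg h3, Finset.sum_eq_single_of_mem i hi, if_pos h, if_neg (h2 i), zero_add]
  intro j _ hj
  rw [if_neg (h2 j), if_neg, zero_add]
  intro h'
  rw [h] at h'
  exact hj (single_one_injective (add_left_cancel h')).symm

theorem exists_of_levelRate_ne_zero {n : ℕ} {z z' : Shape n} (h : levelRate N a q z z' ≠ 0) :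
    z' = z ∨ ∃ i ∈ Finset.Icc 1 n,
      z'.part = z.part + Pi.single i 1 ∨ z.part = z'.part + Pi.single i 1 := by
  by_cases hz : z' = z
  · exact Or.inl hz
  · rw [levelRate, if_neg hz] at h
    exact Or.inr (exists_of_jumpFactor_ne_zero h)

open Classical in
/-- The balance equation when the lower level moves to the right. -/
theorem twoLevel_right (hq0 : 0 < q) (hq1 : q < 1) (ha : extParam a (N + 1) ≠ 0)
    {x : Shape ((N + 1) / 2)} {y' y : Shape ((N + 1 + 1) / 2)} (hxy : x.Interlaces y)
    {X : Finset (Shape ((N + 1) / 2))} (hX : ∀ x', x' ∈ X ↔ x'.Interlaces y') {i : ℕ}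
    (hi : i ∈ Finset.Icc 1 ((N + 1 + 1) / 2)) (h : y.part = y'.part + Pi.single i 1) :
    ∑ x' ∈ X, extSliceWeight a q (N + 1) x'.part y'.part
        * ((if y.part = pushLevel ((N + 1 + 1) / 2) x'.part x.part y'.part then 1 else 0)
          * levelRate N a q x' x)
      + extSliceWeight a q (N + 1) x.part y'.part * ownRate a q (N + 1) x.part y'.part y.part
      = extSliceWeight a q (N + 1) x.part y.part * levelRate (N + 1) a q y' y := by
  obtain ⟨hi1, hi2⟩ := Finset.mem_Icc.1 hi
  have hlast : i = (N + 1) / 2 + 1 → x.part i = y'.part (i + 1) := fun h0 => by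
    rw [x.support i (by omega), y'.support (i + 1) (by omega)]
  have hyi : y.part i = y'.part i + 1 := by rw [h, Pi.add_apply, Pi.single_eq_same]
  have hyj : ∀ j, j ≠ i → y.part j = y'.part j := fun j hj => by
    rw [h, Pi.add_apply, Pi.single_eq_of_ne hj, add_zero]
  -- The only way to push the lower particle `i` to the right is a right move of the upper particle
  -- `i` from the same position.
  have hpush : ∀ x' : Shape ((N + 1) / 2), levelRate N a q x' x ≠ 0 →
      y.part = pushLevel ((N + 1 + 1) / 2) x'.part x.part y'.part →
      i ∈ Finset.Icc 1 ((N + 1) / 2) ∧ x.part = x'.part + Pi.single i 1 ∧ x'.part i = y'.part i := by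
    intro x' hx' hp
    rcases exists_of_levelRate_ne_zero hx' with rfl | ⟨j, hj, hxj | hxj⟩
    · rw [pushLevel_self, h] at hp
      exact absurd hp (add_single_ne_self _ _)
    · rw [pushLevel_right hxj, h] at hp
      split_ifs at hp with hc
      · obtain rfl := single_one_injective (add_left_cancel hp)
        exact ⟨hj, hxj, hc⟩
      · exact absurd hp (add_single_ne_self _ _)
    · rw [pushLevel_left (Finset.mem_Icc.1 hj).1 hxj, h] at hp
      split_ifs at hp with hc
      · exact absurd (by linear_combination hp) (single_add_single_ne_zero i (j + 1))
      · exact absurd hp (add_single_ne_self _ _)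
  rw [ownRate_right hi h, levelRate_right hi h]
  -- If `x i` equals the new position of the lower particle, then `x` does not interlace with `y'`,
  -- the own jump has weight 0, and the push from `x - e_i` is the only source. Otherwise no push is
  -- possible and the own jump is the only source.
  by_cases hc : x.part i = y.part i
  · have him : i ≤ (N + 1) / 2 := by
      by_contra hlt
      have h1 := x.support i (by omega)
      have h2 := y'.nonneg i
      omega
    have hint : ∀ j, 1 ≤ j → (x.part - Pi.single i 1 : ℕ → ℤ) j ≤ y'.part j
        ∧ y'.part (j + 1) ≤ (x.part - Pi.single i 1 : ℕ → ℤ) j := by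
      intro j hj
      have h3 := hxy j hj
      have h4 := y'.antitone j hj
      by_cases hji : j = i
      · subst hji
        rw [Pi.sub_apply, Pi.single_eq_same]
        omega
      · rw [Pi.sub_apply, Pi.single_eq_of_ne hji]
        have h5 := hyj j hji
        by_cases hji' : j + 1 = i
        · subst hji'; omega
        · have := hyj (j + 1) hji'
          omega
    let x₀ : Shape ((N + 1) / 2) := Shape.ofInterlacing y' (x.part - Pi.single i 1) (by
      intro j hj
      rw [Pi.sub_apply, x.support j hj, Pi.single_eq_of_ne (by rintro rfl; omega), sub_zero]) hint
    have hx₀ : x.part = x₀.part + Pi.single i 1 := by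
      change x.part = x.part - Pi.single i 1 + Pi.single i 1
      rw [sub_add_cancel]
    have hx₀i : x₀.part i = y'.part i := by
      have := congrFun hx₀ i
      rw [Pi.add_apply, Pi.single_eq_same] at this
      omega
    have hx₀X : x₀ ∈ X := (hX _).2 hint
    have hzero : extSliceWeight a q (N + 1) x.part y'.part = 0 :=
      extSliceWeight_eq_zero fun h' => by have := (h' i hi1).1; omega
    rw [Finset.sum_eq_single_of_mem x₀ hx₀X, hzero, zero_mul, add_zero,
      levelRate_right (Finset.mem_Icc.2 ⟨hi1, him⟩) hx₀, if_pos, one_mul]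
    · conv_rhs => rw [h, hx₀]
      exact (extSliceWeight_push_right hq0 hq1 hi1 him (y'.antitone i hi1)
        (Shape.part_le_pred_of_succ hi1 h) hx₀i).symm
    · rw [pushLevel_right hx₀, if_pos hx₀i, h]
    · intro x' _ hne
      by_contra h0
      have h1 := right_ne_zero_of_mul h0
      have h2 := right_ne_zero_of_mul h1
      by_cases hp : y.part = pushLevel ((N + 1 + 1) / 2) x'.part x.part y'.part
      · exact hne (Shape.ext (add_right_cancel ((hpush x' h2 hp).2.1.symm.trans hx₀)))
      · rw [if_neg hp] at h1
        exact left_ne_zero_of_mul h1 rfl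
  · have hxi : x.part i ≤ y'.part i := by
      have := (hxy i hi1).1
      omega
    rw [Finset.sum_eq_zero, zero_add, extSliceWeight_jump_right hq0 hq1 ha hi1 hi2
      (y'.antitone i hi1) (Shape.part_le_pred_of_succ hi1 h) hlast hxi, ← h]
    intro x' _
    by_contra h0
    have h1 := right_ne_zero_of_mul h0
    have h2 := right_ne_zero_of_mul h1
    by_cases hp : y.part = pushLevel ((N + 1 + 1) / 2) x'.part x.part y'.part
    · obtain ⟨-, h3, h4⟩ := hpush x' h2 hp
      have h5 := congrFun h3 i
      rw [Pi.add_apply, Pi.single_eq_same] at h5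
      omega
    · rw [if_neg hp] at h1
      exact left_ne_zero_of_mul h1 rfl

open Classical in
/-- The balance equation when the lower level moves to the left. -/
theorem twoLevel_left (hq0 : 0 < q) (hq1 : q < 1) (ha : extParam a (N + 1) ≠ 0)
    {x : Shape ((N + 1) / 2)} {y' y : Shape ((N + 1 + 1) / 2)} (hxy : x.Interlaces y)
    {X : Finset (Shape ((N + 1) / 2))} (hX : ∀ x', x' ∈ X ↔ x'.Interlaces y') {i : ℕ}
    (hi : i ∈ Finset.Icc 1 ((N + 1 + 1) / 2)) (h : y'.part = y.part + Pi.single i 1) :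
    ∑ x' ∈ X, extSliceWeight a q (N + 1) x'.part y'.part
        * ((if y.part = pushLevel ((N + 1 + 1) / 2) x'.part x.part y'.part then 1 else 0)
          * levelRate N a q x' x)
      + extSliceWeight a q (N + 1) x.part y'.part * ownRate a q (N + 1) x.part y'.part y.part
      = extSliceWeight a q (N + 1) x.part y.part * levelRate (N + 1) a q y' y := by
  obtain ⟨hi1, hi2⟩ := Finset.mem_Icc.1 hi
  have hlast : i = (N + 1) / 2 + 1 → x.part i = y.part (i + 1) := fun h0 => by
    rw [x.support i (by omega), y.support (i + 1) (by omega)]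
  have hyi : y'.part i = y.part i + 1 := by rw [h, Pi.add_apply, Pi.single_eq_same]
  have hyj : ∀ j, j ≠ i → y'.part j = y.part j := fun j hj => by
    rw [h, Pi.add_apply, Pi.single_eq_of_ne hj, add_zero]
  have hpush : ∀ x' : Shape ((N + 1) / 2), levelRate N a q x' x ≠ 0 →
      y.part = pushLevel ((N + 1 + 1) / 2) x'.part x.part y'.part →
      i ≠ 1 ∧ i - 1 ∈ Finset.Icc 1 ((N + 1) / 2) ∧ x'.part = x.part + Pi.single (i - 1) 1
        ∧ x'.part (i - 1) = y'.part i := by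
    intro x' hx' hp
    rcases exists_of_levelRate_ne_zero hx' with rfl | ⟨j, hj, hxj | hxj⟩
    · rw [pushLevel_self, h] at hp
      exact absurd hp.symm (add_single_ne_self _ _)
    · rw [pushLevel_right hxj, h] at hp
      split_ifs at hp with hc
      · exact absurd (by linear_combination -hp) (single_add_single_ne_zero i j)
      · exact absurd hp.symm (add_single_ne_self _ _)
    · rw [pushLevel_left (Finset.mem_Icc.1 hj).1 hxj, h] at hp
      split_ifs at hp with hc
      · have hij : i = j + 1 := single_one_injective (by linear_combination -hp)
        have hj1 := (Finset.mem_Icc.1 hj).1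
        subst hij
        rw [add_tsub_cancel_right]
        exact ⟨by omega, hj, hxj, by rw [hc.1, h]⟩
      · exact absurd hp.symm (add_single_ne_self _ _)
  rw [ownRate_left hi h, levelRate_left hi h]
  -- The dichotomy for left moves: the upper particle `i - 1` has ended at the new position of the
  -- lower particle `i` exactly when it pushed it there.
  by_cases hc : i ≠ 1 ∧ x.part (i - 1) = y.part i
  · obtain ⟨hne1, hc⟩ := hc
    obtain ⟨l, rfl⟩ : ∃ l, i = l + 1 := ⟨i - 1, by omega⟩
    rw [add_tsub_cancel_right] at hc hpush
    have hl1 : 1 ≤ l := by omega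
    have hlt : y.part (l + 1) < y.part l := by
      simpa using Shape.part_le_pred_of_succ hi1 h hne1
    have hint : ∀ j, 1 ≤ j → (x.part + Pi.single l 1 : ℕ → ℤ) j ≤ y'.part j
        ∧ y'.part (j + 1) ≤ (x.part + Pi.single l 1 : ℕ → ℤ) j := by
      intro j hj
      have h3 := hxy j hj
      by_cases hji : j = l
      · subst hji
        have := hyj j (by omega)
        rw [Pi.add_apply, Pi.single_eq_same]
        omega
      · rw [Pi.add_apply, Pi.single_eq_of_ne hji]
        have h5 := hyj (j + 1) (by omega)
        by_cases hji' : j = l + 1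
        · subst hji'; omega
        · have := hyj j hji'
          omega
    let x₀ : Shape ((N + 1) / 2) := Shape.ofInterlacing y' (x.part + Pi.single l 1) (by
      intro j hj
      rw [Pi.add_apply, x.support j hj, Pi.single_eq_of_ne (by rintro rfl; omega), add_zero]) hint
    have hx₀ : x₀.part = x.part + Pi.single l 1 := rfl
    have hx₀i : x₀.part l = y'.part (l + 1) := by
      rw [hx₀, Pi.add_apply, Pi.single_eq_same, hyi, hc]
    have hx₀X : x₀ ∈ X := (hX _).2 hint
    have hzero : extSliceWeight a q (N + 1) x.part y'.part = 0 :=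
      extSliceWeight_eq_zero fun h' => by have := (h' l hl1).2; omega
    rw [Finset.sum_eq_single_of_mem x₀ hx₀X, hzero, zero_mul, add_zero,
      levelRate_left (Finset.mem_Icc.2 ⟨hl1, by omega⟩) hx₀, if_pos, one_mul]
    · rw [h, hx₀]
      refine extSliceWeight_push_left hq0 hq1 hl1 hi2 (y.antitone _ hi1) hlt hc fun h0 => ?_
      exact hlast (by omega)
    · rw [pushLevel_left hl1 hx₀, if_pos ⟨hx₀i, hi2⟩, h, add_sub_cancel_right]
    · intro x' _ hne
      by_contra h0
      have h1 := right_ne_zero_of_mul h0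
      have h2 := right_ne_zero_of_mul h1
      by_cases hp : y.part = pushLevel ((N + 1 + 1) / 2) x'.part x.part y'.part
      · exact hne (Shape.ext ((hpush x' h2 hp).2.2.1.trans hx₀.symm))
      · rw [if_neg hp] at h1
        exact left_ne_zero_of_mul h1 rfl
  · have hxi : i ≠ 1 → y.part i < x.part (i - 1) := by
      intro h0
      have h1 := (hxy (i - 1) (by omega)).2
      rw [show i - 1 + 1 = i by omega] at h1
      rcases h1.lt_or_eq with h2 | h2
      · exact h2
      · exact absurd ⟨h0, h2.symm⟩ hc
    have hjump := extSliceWeight_jump_left hq0 hq1 ha hi1 hi2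
      (y.antitone i hi1) (Shape.part_le_pred_of_succ hi1 h) hlast hxi
    rw [← h] at hjump
    rw [Finset.sum_eq_zero, zero_add, hjump]
    intro x' _
    by_contra h0
    have h1 := right_ne_zero_of_mul h0
    have h2 := right_ne_zero_of_mul h1
    by_cases hp : y.part = pushLevel ((N + 1 + 1) / 2) x'.part x.part y'.part
    · obtain ⟨h6, -, h3, h4⟩ := hpush x' h2 hp
      have h5 := congrFun h3 (i - 1)
      rw [Pi.add_apply, Pi.single_eq_same] at h5
      have := hxi h6
      omega
    · rw [if_neg hp] at h1
      exact left_ne_zero_of_mul h1 rfl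

theorem sum_levelRate (x : Shape ((N + 1) / 2)) (X : Finset (Shape ((N + 1) / 2)))
    (hxX : x ∈ X) (F : Shape ((N + 1) / 2) → ℝ) :
    ∑ x' ∈ X, F x' * levelRate N a q x' x
      = F x * diagRate ((N + 1) / 2) N a q x.part + ∑ x' ∈ X, F x' * jumpFactor q x' x := by
  classical
  rw [← Finset.add_sum_erase X _ hxX, ← Finset.add_sum_erase X (fun x' => F x' * jumpFactor q x' x) hxX,
    jumpFactor_self, mul_zero, zero_add, levelRate, if_pos rfl]
  congr 1
  refine Finset.sum_congr rfl fun x' hx' => ?_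
  rw [levelRate, if_neg (Finset.ne_of_mem_erase hx').symm]

/-- The flow into `x` with `y` at rest. `extSliceWeight_move_upper` expresses the weight of each
source through the weight at `x`; a source that does not interlace with `y` has extended weight 0,
so no boundary case arises. -/
theorem sum_extSliceWeight_mul_jumpFactor (hq0 : 0 < q) (hq1 : q < 1)
    (ha : extParam a (N + 1) ≠ 0)
    {x : Shape ((N + 1) / 2)} {y : Shape ((N + 1 + 1) / 2)} (hxy : x.Interlaces y)
    {X : Finset (Shape ((N + 1) / 2))} (hX : ∀ x', x' ∈ X ↔ x'.Interlaces y) :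
    ∑ x' ∈ X, extSliceWeight a q (N + 1) x'.part y.part * jumpFactor q x' x
      = extSliceWeight a q (N + 1) x.part y.part * (extParam a (N + 1)
          * ∑ i ∈ Finset.Icc 1 ((N + 1) / 2), gapFactor q x.part i (x.part i - 1)
            * (1 - q ^ (x.part i - y.part (i + 1))) / (1 - q ^ (y.part i - x.part i + 1))
        + (extParam a (N + 1))⁻¹ * ∑ i ∈ Finset.Icc 1 ((N + 1) / 2),
            (1 - q ^ (x.part i - x.part (i + 1) + 1)) * (1 - q ^ (y.part i - x.part i))
            / (1 - q ^ (x.part i - y.part (i + 1) + 1))) := by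
  classical
  have hR : ∀ i ∈ Finset.Icc 1 ((N + 1) / 2),
      ∑ x' ∈ X, extSliceWeight a q (N + 1) x'.part y.part
        * (if x.part - x'.part = Pi.single i 1 then
            (if i = 1 then 1 else 1 - q ^ (x'.part (i - 1) - x'.part i)) else 0)
      = extSliceWeight a q (N + 1) x.part y.part * (extParam a (N + 1)
          * (gapFactor q x.part i (x.part i - 1)
            * (1 - q ^ (x.part i - y.part (i + 1))) / (1 - q ^ (y.part i - x.part i + 1)))) := by
    intro i hi
    obtain ⟨hi1, hi2⟩ := Finset.mem_Icc.1 hi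
    have hD := one_sub_zpow_ne_zero hq0 hq1 (m := y.part i - x.part i + 1)
      (by have := (hxy i hi1).1; omega)
    have hmove := extSliceWeight_move_upper hq0 hq1 ha (x.part - Pi.single i 1) y.part hi
    rw [sub_add_cancel, Pi.sub_apply, Pi.single_eq_same] at hmove
    have e1 : y.part i - (x.part i - 1) = y.part i - x.part i + 1 := by ring
    have e2 : x.part i - 1 - y.part (i + 1) + 1 = x.part i - y.part (i + 1) := by ring
    rw [e1, e2] at hmove
    have hrhs : extSliceWeight a q (N + 1) x.part y.part * (extParam a (N + 1)
          * (gapFactor q x.part i (x.part i - 1)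
            * (1 - q ^ (x.part i - y.part (i + 1))) / (1 - q ^ (y.part i - x.part i + 1))))
        = extSliceWeight a q (N + 1) (x.part - Pi.single i 1) y.part
          * gapFactor q x.part i (x.part i - 1) := by
      field_simp
      linear_combination -gapFactor q x.part i (x.part i - 1) * hmove
    rw [hrhs]
    by_cases h0 : extSliceWeight a q (N + 1) (x.part - Pi.single i 1) y.part = 0
    · rw [h0, zero_mul]
      refine Finset.sum_eq_zero fun x' _ => ?_
      split_ifs with h1 h2
      all_goals first
        | rw [show x'.part = x.part - Pi.single i 1 by linear_combination -h1, h0, zero_mul]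
        | rw [mul_zero]
    · obtain ⟨x₀, h1, h2⟩ := exists_shape_of_extSliceWeight_ne_zero (fun j hj => by
        rw [Pi.sub_apply, x.support j hj, Pi.single_eq_of_ne (by rintro rfl; omega), sub_zero]) h0
      rw [Finset.sum_eq_single_of_mem x₀ ((hX _).2 h2), if_pos (by rw [h1, sub_sub_cancel]), h1,
        gapFactor]
      · split_ifs with hi0
        · rfl
        · rw [Pi.sub_apply, Pi.sub_apply, Pi.single_eq_same, Pi.single_eq_of_ne (by omega), sub_zero]
      · intro x' _ hne
        rw [if_neg, mul_zero]
        intro h3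
        exact hne (Shape.ext (by rw [h1]; linear_combination -h3))
  have hL : ∀ i ∈ Finset.Icc 1 ((N + 1) / 2),
      ∑ x' ∈ X, extSliceWeight a q (N + 1) x'.part y.part
        * (if x.part - x'.part = -Pi.single i 1 then
            1 - q ^ (x'.part i - x'.part (i + 1)) else 0)
      = extSliceWeight a q (N + 1) x.part y.part * ((extParam a (N + 1))⁻¹
          * ((1 - q ^ (x.part i - x.part (i + 1) + 1)) * (1 - q ^ (y.part i - x.part i))
            / (1 - q ^ (x.part i - y.part (i + 1) + 1)))) := by
    intro i hi
    obtain ⟨hi1, hi2⟩ := Finset.mem_Icc.1 hi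
    have hD := one_sub_zpow_ne_zero hq0 hq1 (m := x.part i - y.part (i + 1) + 1)
      (by have := (hxy i hi1).2; omega)
    have hmove := extSliceWeight_move_upper hq0 hq1 ha x.part y.part hi
    have hrhs : extSliceWeight a q (N + 1) x.part y.part * ((extParam a (N + 1))⁻¹
          * ((1 - q ^ (x.part i - x.part (i + 1) + 1)) * (1 - q ^ (y.part i - x.part i))
            / (1 - q ^ (x.part i - y.part (i + 1) + 1))))
        = extSliceWeight a q (N + 1) (x.part + Pi.single i 1) y.part
          * (1 - q ^ (x.part i - x.part (i + 1) + 1)) := by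
      field_simp
      linear_combination (1 - q ^ (x.part i - x.part (i + 1) + 1)) * hmove
    rw [hrhs]
    by_cases h0 : extSliceWeight a q (N + 1) (x.part + Pi.single i 1) y.part = 0
    · rw [h0, zero_mul]
      refine Finset.sum_eq_zero fun x' _ => ?_
      split_ifs with h1
      · rw [show x'.part = x.part + Pi.single i 1 by linear_combination -h1, h0, zero_mul]
      · rw [mul_zero]
    · obtain ⟨x₀, h1, h2⟩ := exists_shape_of_extSliceWeight_ne_zero (fun j hj => by
        rw [Pi.add_apply, x.support j hj, Pi.single_eq_of_ne (by rintro rfl; omega), add_zero]) h0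
      rw [Finset.sum_eq_single_of_mem x₀ ((hX _).2 h2), if_pos (by rw [h1, sub_add_cancel_left]), h1,
        Pi.add_apply, Pi.single_eq_same, Pi.add_apply, Pi.single_eq_of_ne (by omega), add_zero]
      · ring_nf
      · intro x' _ hne
        rw [if_neg, mul_zero]
        intro h3
        exact hne (Shape.ext (by rw [h1]; linear_combination -h3))
  simp only [jumpFactor, Finset.mul_sum, mul_add]
  rw [Finset.sum_comm, ← Finset.sum_add_distrib]
  refine Finset.sum_congr rfl fun i hi => ?_
  rw [Finset.sum_add_distrib, hR i hi, hL i hi]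

/-- The balance of the diagonal rates. -/
theorem diagRate_balance (hq0 : 0 < q) (hq1 : q < 1)
    {x y : ℕ → ℤ} (hxy : ∀ j, 1 ≤ j → x j ≤ y j ∧ y (j + 1) ≤ x j)
    (hxs : x ((N + 1) / 2 + 1) = 0) (hys : y ((N + 1 + 1) / 2 + 1) = 0) (hy : ∀ j, 0 ≤ y j) :
    diagRate ((N + 1) / 2) N a q x + extParam a (N + 1)
          * ∑ i ∈ Finset.Icc 1 ((N + 1) / 2), gapFactor q x i (x i - 1)
            * (1 - q ^ (x i - y (i + 1))) / (1 - q ^ (y i - x i + 1))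
        + (extParam a (N + 1))⁻¹ * ∑ i ∈ Finset.Icc 1 ((N + 1) / 2),
            (1 - q ^ (x i - x (i + 1) + 1)) * (1 - q ^ (y i - x i))
            / (1 - q ^ (x i - y (i + 1) + 1))
        - (extParam a (N + 1) * ∑ j ∈ Finset.Icc 1 ((N + 1 + 1) / 2), rightFactor q y x j
          + (extParam a (N + 1))⁻¹ * ∑ j ∈ Finset.Icc 1 ((N + 1 + 1) / 2),
              leftFactor q y x j)
      = diagRate ((N + 1 + 1) / 2) (N + 1) a q y := by
  have hR := sum_rightFactor_sub hq0 hq1 ((N + 1) / 2) fun i hi => (hxy i hi).1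
  have hL := sum_leftFactor_sub hq0 hq1 ((N + 1) / 2) fun i hi => (hxy i hi).2
  rcases Nat.even_or_odd N with he | ho
  -- The new level has an additional particle `l + 1`. Its right rate cancels the remainder of the
  -- right sum and leaves `a (l + 1)`; the remainder of the left sum is the wall term `1 - q ^ y (l
  -- + 1)`.
  · obtain ⟨l, rfl⟩ := he
    have h1 : (l + l + 1) / 2 = l := by omega
    have h2 : (l + l + 1 + 1) / 2 = l + 1 := by omega
    have hp : extParam a (l + l + 1) = a (l + 1) := by
      rw [extParam, if_neg (by rw [Nat.not_even_iff_odd]; exact ⟨l, by ring⟩), h2]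
    have hd1 : diagRate ((l + l + 1) / 2) (l + l) a q x = -∑ i ∈ Finset.Icc 1 l, (a i + (a i)⁻¹) := by
      rw [diagRate, if_pos (by omega), h1]
    have hd2 : diagRate ((l + l + 1 + 1) / 2) (l + l + 1) a q y = -(∑ i ∈ Finset.Icc 1 l, (a i + (a i)⁻¹)) - a (l + 1)
        - (a (l + 1))⁻¹ * (1 - q ^ y (l + 1)) := by
      rw [diagRate, if_neg (by omega), h2, add_tsub_cancel_right]
    rw [h1] at hxs hR hL
    rw [h2] at hys
    have hg : rightFactor q y x (l + 1)
        = 1 - (if l = 0 then 0 else q ^ (x l - y (l + 1))) := by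
      have hne := one_sub_zpow_ne_zero hq0 hq1 (m := y (l + 1) + 1)
        (by have := hy (l + 1); omega)
      rw [rightFactor, hxs, hys, sub_zero, div_self hne, mul_one, add_tsub_cancel_right]
      by_cases hl : l = 0 <;> simp [hl]
    rw [hd1, hd2, hp, h1, h2, Finset.sum_Icc_succ_top (f := fun j => rightFactor q y x j)
      (by omega), hg]
    rw [hxs, sub_zero] at hL
    linear_combination -a (l + 1) * hR - (a (l + 1))⁻¹ * hL
  -- The new level has as many particles as the one above. The remainder `q ^ x (l + 1)` of the
  -- right sum removes the wall term of the upper level, and the left sum has remainder 0 once the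
  -- absent particle `l + 2` is included with rate 0.
  · obtain ⟨l, rfl⟩ := ho
    have h1 : (2 * l + 1 + 1) / 2 = l + 1 := by omega
    have h2 : (2 * l + 1 + 1 + 1) / 2 = l + 1 := by omega
    have hp : extParam a (2 * l + 1 + 1) = (a (l + 1))⁻¹ := by
      rw [extParam, if_pos ⟨l + 1, by ring⟩, h1]
    have hd1 : diagRate ((2 * l + 1 + 1) / 2) (2 * l + 1) a q x = -(∑ i ∈ Finset.Icc 1 l, (a i + (a i)⁻¹)) - a (l + 1)
        - (a (l + 1))⁻¹ * (1 - q ^ x (l + 1)) := by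
      rw [diagRate, if_neg (by omega), h1, add_tsub_cancel_right]
    have hd2 : diagRate ((2 * l + 1 + 1 + 1) / 2) (2 * l + 1 + 1) a q y
        = -((∑ i ∈ Finset.Icc 1 l, (a i + (a i)⁻¹)) + (a (l + 1) + (a (l + 1))⁻¹)) := by
      rw [diagRate, if_pos (by omega), h2, Finset.sum_Icc_succ_top (by omega)]
    rw [h1] at hxs hR hL
    rw [h2] at hys
    rw [if_neg (by omega), hys, sub_zero] at hR
    rw [Finset.sum_Icc_succ_top (by omega)] at hL
    have hg : leftFactor q y x (l + 1 + 1) = 0 := by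
      rw [leftFactor, hxs, hys, sub_zero, zpow_zero, sub_self, zero_mul]
    rw [hg, hys, hxs, sub_zero, zpow_zero, sub_self, add_zero] at hL
    rw [hd1, hd2, hp, h1, h2, inv_inv]
    linear_combination -(a (l + 1))⁻¹ * hR - a (l + 1) * hL

open Classical in
/-- The balance equation when the lower level does not move. -/
theorem twoLevel_diag (hq0 : 0 < q) (hq1 : q < 1) (ha : extParam a (N + 1) ≠ 0)
    {x : Shape ((N + 1) / 2)} {y : Shape ((N + 1 + 1) / 2)} (hxy : x.Interlaces y)
    {X : Finset (Shape ((N + 1) / 2))} (hX : ∀ x', x' ∈ X ↔ x'.Interlaces y) :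
    ∑ x' ∈ X, extSliceWeight a q (N + 1) x'.part y.part
        * ((if y.part = pushLevel ((N + 1 + 1) / 2) x'.part x.part y.part then 1 else 0)
          * levelRate N a q x' x)
      + extSliceWeight a q (N + 1) x.part y.part * ownRate a q (N + 1) x.part y.part y.part
      = extSliceWeight a q (N + 1) x.part y.part * levelRate (N + 1) a q y y := by
  -- Since `x` interlaces with `y`, an upper level arriving at `x` cannot have pushed: the
  -- interlacing would be violated.
  have hpush : ∀ x', levelRate N a q x' x ≠ 0 →
      y.part = pushLevel ((N + 1 + 1) / 2) x'.part x.part y.part := by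
    intro x' hx'
    rcases exists_of_levelRate_ne_zero hx' with rfl | ⟨j, hj, hxj | hxj⟩
    · rw [pushLevel_self]
    · rw [pushLevel_right hxj, if_neg]
      intro h0
      have h1 := (hxy j (Finset.mem_Icc.1 hj).1).1
      rw [hxj, Pi.add_apply, Pi.single_eq_same] at h1
      omega
    · rw [pushLevel_left (Finset.mem_Icc.1 hj).1 hxj, if_neg]
      rintro ⟨h0, -⟩
      have h1 := (hxy j (Finset.mem_Icc.1 hj).1).2
      rw [hxj, Pi.add_apply, Pi.single_eq_same] at h0
      omega
  have h1 : ∀ x' ∈ X, extSliceWeight a q (N + 1) x'.part y.part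
        * ((if y.part = pushLevel ((N + 1 + 1) / 2) x'.part x.part y.part then 1 else 0)
          * levelRate N a q x' x)
      = extSliceWeight a q (N + 1) x'.part y.part * levelRate N a q x' x := by
    intro x' _
    by_cases h0 : levelRate N a q x' x = 0
    · rw [h0, mul_zero]
    · rw [if_pos (hpush x' h0), one_mul]
  rw [Finset.sum_congr rfl h1, sum_levelRate x X ((hX x).2 hxy),
    sum_extSliceWeight_mul_jumpFactor hq0 hq1 ha hxy hX, ownRate_self, levelRate, if_pos rfl,
    ← diagRate_balance hq0 hq1 hxy (x.support _ (by omega)) (y.support _ (by omega)) y.nonneg,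
     Finset.sum_add_distrib, ← Finset.mul_sum, ← Finset.mul_sum]
  ring

open Classical in
/-- The balance equation of two consecutive levels. -/
theorem twoLevel_balance (hq0 : 0 < q) (hq1 : q < 1) (ha : extParam a (N + 1) ≠ 0)
    {x : Shape ((N + 1) / 2)} {y' y : Shape ((N + 1 + 1) / 2)} (hxy : x.Interlaces y)
    {X : Finset (Shape ((N + 1) / 2))} (hX : ∀ x', x' ∈ X ↔ x'.Interlaces y') :
    ∑ x' ∈ X, extSliceWeight a q (N + 1) x'.part y'.part
        * ((if y.part = pushLevel ((N + 1 + 1) / 2) x'.part x.part y'.part then 1 else 0)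
          * levelRate N a q x' x)
      + extSliceWeight a q (N + 1) x.part y'.part * ownRate a q (N + 1) x.part y'.part y.part
      = extSliceWeight a q (N + 1) x.part y.part * levelRate (N + 1) a q y' y := by
  by_cases h1 : y = y'
  · subst h1
    exact twoLevel_diag hq0 hq1 ha hxy hX
  have h1' : y.part ≠ y'.part := fun h => h1 (Shape.ext h)
  by_cases h2 : ∃ i ∈ Finset.Icc 1 ((N + 1 + 1) / 2), y.part = y'.part + Pi.single i 1
  · obtain ⟨i, hi, h⟩ := h2
    exact twoLevel_right hq0 hq1 ha hxy hX hi h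
  by_cases h3 : ∃ i ∈ Finset.Icc 1 ((N + 1 + 1) / 2), y'.part = y.part + Pi.single i 1
  · obtain ⟨i, hi, h⟩ := h3
    exact twoLevel_left hq0 hq1 ha hxy hX hi h
  have hrate : levelRate (N + 1) a q y' y = 0 := by
    by_contra h0
    rcases exists_of_levelRate_ne_zero h0 with h | ⟨i, hi, h | h⟩
    · exact h1 h
    · exact h2 ⟨i, hi, h⟩
    · exact h3 ⟨i, hi, h⟩
  have hown : ownRate a q (N + 1) x.part y'.part y.part = 0 := by
    rw [ownRate, if_neg h1']
    refine Finset.sum_eq_zero fun j hj => ?_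
    rw [if_neg fun h => h2 ⟨j, hj, h⟩, if_neg fun h => h3 ⟨j, hj, h⟩, add_zero]
  rw [hrate, hown, mul_zero, mul_zero, add_zero]
  refine Finset.sum_eq_zero fun x' _ => ?_
  by_cases h0 : levelRate N a q x' x = 0
  · rw [h0, mul_zero, mul_zero]
  rw [if_neg, zero_mul, mul_zero]
  intro hp
  rcases exists_of_levelRate_ne_zero h0 with rfl | ⟨j, hj, hxj | hxj⟩
  · rw [pushLevel_self] at hp
    exact h1' hp
  · rw [pushLevel_right hxj] at hp
    have := Finset.mem_Icc.1 hj
    split_ifs at hp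
    · exact h2 ⟨j, Finset.mem_Icc.2 ⟨this.1, by omega⟩, hp⟩
    · exact h1' hp
  · rw [pushLevel_left (Finset.mem_Icc.1 hj).1 hxj] at hp
    split_ifs at hp with hc
    · exact h3 ⟨j + 1, Finset.mem_Icc.2 ⟨by omega, hc.2⟩, by rw [hp, sub_add_cancel]⟩
    · exact h1' hp

end TwoLevels

/-! ### Removing and adding the bottom level -/

section Levels

variable {N : ℕ}

/-- The levels of a pattern above the bottom level. -/
def SympPattern.trunc (p : SympPattern (N + 1)) : SympPattern N where
  entry k j := if k ≤ N then p.entry k j else 0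
  nonneg k j := by
    split_ifs
    · exact p.nonneg k j
    · exact le_rfl
  support k j h := by
    split_ifs
    · exact p.support k j (by omega)
    · rfl
  lower k j h1 h2 h3 := by
    rw [if_pos (by omega), if_pos (by omega)]
    exact p.lower k j h1 (by omega) h3
  upper k j h1 h2 h3 := by
    rw [if_pos (by omega), if_pos (by omega)]
    exact p.upper k j h1 (by omega) h3

theorem SympPattern.trunc_entry (p : SympPattern (N + 1)) {k : ℕ} (hk : k ≤ N) :
    p.trunc.entry k = p.entry k := by
  funext j
  exact if_pos hk

theorem SympPattern.entry_zero (p : SympPattern N) : p.entry 0 = 0 := by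
  funext j
  exact p.support 0 j (by omega)

theorem SympPattern.entry_of_lt (p : SympPattern N) {k : ℕ} (hk : N < k) : p.entry k = 0 := by
  funext j
  exact p.support k j (by omega)

theorem SympPattern.ext_trunc {p w : SympPattern (N + 1)} (h : p.trunc = w.trunc)
    (h' : p.entry (N + 1) = w.entry (N + 1)) : p = w := by
  apply SympPattern.ext
  funext k
  rcases lt_trichotomy k (N + 1) with hk | rfl | hk
  · rw [← p.trunc_entry (by omega), h, w.trunc_entry (by omega)]
  · exact h'
  · rw [p.entry_of_lt hk, w.entry_of_lt hk]

theorem SympPattern.interlaces (p : SympPattern (N + 1)) :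
    (p.trunc.bottom rfl : Shape ((N + 1) / 2)).Interlaces (p.bottom rfl : Shape ((N + 1 + 1) / 2)) := by
  intro j hj
  change p.trunc.entry N j ≤ p.entry (N + 1) j ∧ p.entry (N + 1) (j + 1) ≤ p.trunc.entry N j
  rw [p.trunc_entry le_rfl]
  by_cases hN : 1 ≤ N
  · exact ⟨p.lower N j hN (by omega) hj, p.upper N j hN (by omega) hj⟩
  · obtain rfl : N = 0 := by omega
    rw [p.entry_zero, p.support (0 + 1) (j + 1) (by omega)]
    exact ⟨p.nonneg _ _, le_rfl⟩

/-- The pattern with one more level. -/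
def SympPattern.snoc (p : SympPattern N) (y : Shape ((N + 1 + 1) / 2))
    (h : (p.bottom rfl : Shape ((N + 1) / 2)).Interlaces y) : SympPattern (N + 1) where
  entry k j := if k = N + 1 then y.part j else p.entry k j
  nonneg k j := by
    split_ifs
    · exact y.nonneg j
    · exact p.nonneg k j
  support k j hkj := by
    split_ifs with hk
    · exact y.support j (by subst hk; omega)
    · exact p.support k j (by omega)
  lower k j h1 h2 h3 := by
    rw [if_neg (by omega)]
    split_ifs with hk
    · obtain rfl : k = N := by omega
      exact (h j h3).1
    · exact p.lower k j h1 (by omega) h3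
  upper k j h1 h2 h3 := by
    rw [if_neg (show k ≠ N + 1 by omega)]
    split_ifs with hk
    · obtain rfl : k = N := by omega
      exact (h j h3).2
    · exact p.upper k j h1 (by omega) h3

theorem SympPattern.snoc_entry_last (p : SympPattern N) (y : Shape ((N + 1 + 1) / 2))
    (h : (p.bottom rfl : Shape ((N + 1) / 2)).Interlaces y) :
    (p.snoc y h).entry (N + 1) = y.part := by
  funext j
  exact if_pos rfl

theorem SympPattern.trunc_snoc (p : SympPattern N) (y : Shape ((N + 1 + 1) / 2))
    (h : (p.bottom rfl : Shape ((N + 1) / 2)).Interlaces y) : (p.snoc y h).trunc = p := by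
  apply SympPattern.ext
  funext k j
  by_cases hk : k ≤ N
  · rw [SympPattern.trunc_entry _ hk]
    exact if_neg (by omega)
  · rw [SympPattern.entry_of_lt _ (by omega), SympPattern.entry_of_lt _ (by omega)]

/-- The pattern whose levels are the initial segments of the shape `z`. -/
def Shape.toPattern {n : ℕ} (z : Shape n) (N : ℕ) : SympPattern N where
  entry k j := if 1 ≤ k ∧ k ≤ N ∧ 1 ≤ j ∧ j ≤ (k + 1) / 2 then z.part j else 0
  nonneg k j := by
    split_ifs
    · exact z.nonneg j
    · exact le_rfl
  support k j h := if_neg h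
  lower k j h1 h2 h3 := by
    split_ifs
    · exact le_rfl
    · omega
    · exact z.nonneg j
    · exact le_rfl
  upper k j h1 h2 h3 := by
    split_ifs
    · exact z.antitone j h3
    · omega
    · exact z.nonneg j
    · exact le_rfl

theorem Shape.toPattern_entry_last {n : ℕ} (z : Shape n) (h : (N + 1) / 2 = n) :
    (z.toPattern N).entry N = z.part := by
  funext j
  change (if 1 ≤ N ∧ N ≤ N ∧ 1 ≤ j ∧ j ≤ (N + 1) / 2 then z.part j else 0) = z.part j
  split_ifs with hj
  · rfl
  · exact (z.support j (by omega)).symm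

/-- The patterns with bottom level `z`. -/
noncomputable def patternFibre {n : ℕ} (N : ℕ) (z : Shape n) : Finset (SympPattern N) :=
  (Set.finite_coe_iff.1 (SympPattern.finite_fibre (N := N) z)).toFinset

theorem mem_patternFibre {n : ℕ} {z : Shape n} {p : SympPattern N} :
    p ∈ patternFibre N z ↔ p.entry N = z.part :=
  Set.Finite.mem_toFinset _

theorem mem_patternFibre_iff_bottom {n : ℕ} (h : (N + 1) / 2 = n) {z : Shape n}
    {p : SympPattern N} : p ∈ patternFibre N z ↔ p.bottom h = z := by
  rw [mem_patternFibre, Shape.ext_iff]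
  rfl

open Classical in
/-- The shapes that interlace with the shape `y` of the next level. -/
noncomputable def interlacingShapes (y : Shape ((N + 1 + 1) / 2)) : Finset (Shape ((N + 1) / 2)) :=
  (patternFibre (N + 1) y).image fun p => p.trunc.bottom rfl

theorem mem_interlacingShapes {y : Shape ((N + 1 + 1) / 2)} {x : Shape ((N + 1) / 2)} :
    x ∈ interlacingShapes y ↔ x.Interlaces y := by
  classical
  rw [interlacingShapes, Finset.mem_image]
  constructor
  · rintro ⟨p, hp, rfl⟩
    have := p.interlaces
    rwa [(mem_patternFibre_iff_bottom rfl).1 hp] at this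
  · intro h
    have hx : (x.toPattern N).bottom rfl = x := Shape.ext (x.toPattern_entry_last rfl)
    have h' : ((x.toPattern N).bottom rfl : Shape ((N + 1) / 2)).Interlaces y := by rwa [hx]
    refine ⟨(x.toPattern N).snoc y h', mem_patternFibre.2 (SympPattern.snoc_entry_last _ y h'), ?_⟩
    rw [SympPattern.trunc_snoc, hx]

/-- With the last two levels fixed, `trunc` is a bijection onto the patterns with bottom level `x`;
its inverse is `snoc`. -/
theorem sum_patternFibre_succ (y : Shape ((N + 1 + 1) / 2)) (g : SympPattern N → ℝ) :
    ∑ p ∈ patternFibre (N + 1) y, g p.trunc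
      = ∑ x ∈ interlacingShapes y, ∑ p ∈ patternFibre N x, g p := by
  classical
  rw [← Finset.sum_fiberwise_of_maps_to (t := interlacingShapes y)
    (g := fun p : SympPattern (N + 1) => (p.trunc.bottom rfl : Shape ((N + 1) / 2)))]
  · refine Finset.sum_congr rfl fun x hx => ?_
    refine Finset.sum_nbij SympPattern.trunc ?_ ?_ ?_ fun _ _ => rfl
    · intro p hp
      exact (mem_patternFibre_iff_bottom rfl).2 (Finset.mem_filter.1 hp).2
    · intro p hp w hw h
      have hp' := mem_patternFibre.1 (Finset.mem_filter.1 hp).1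
      have hw' := mem_patternFibre.1 (Finset.mem_filter.1 hw).1
      exact SympPattern.ext_trunc h (hp'.trans hw'.symm)
    · intro p hp
      have hp' := (mem_patternFibre_iff_bottom rfl).1 hp
      have h : (p.bottom rfl : Shape ((N + 1) / 2)).Interlaces y := by
        rw [hp']; exact mem_interlacingShapes.1 hx
      refine ⟨p.snoc y h, ?_, p.trunc_snoc y h⟩
      refine Finset.mem_coe.2 (Finset.mem_filter.2
        ⟨mem_patternFibre.2 (p.snoc_entry_last y h), ?_⟩)
      rw [p.trunc_snoc y h, hp']
  · intro p hp
    rw [mem_interlacingShapes, ← (mem_patternFibre_iff_bottom rfl).1 hp]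
    exact p.interlaces

end Levels

/-! ### The rates in terms of the levels above -/

section Jumps

variable {N k j : ℕ}

theorem jumpRight_apply_self (z : ℕ → ℕ → ℤ) (hk : k ≤ N) : jumpRight N z k j k j = z k j + 1 :=
  if_pos ⟨le_rfl, hk, rfl, fun m h1 h2 => absurd h2 (by omega)⟩

theorem jumpLeft_apply_self (z : ℕ → ℕ → ℤ) (hk : k ≤ N) (hj : j ≤ (k + 1) / 2) :
    jumpLeft N z k j k j = z k j - 1 :=
  if_pos ⟨le_rfl, hk, by omega, hj, fun m h => absurd h (by omega)⟩

theorem jumpRight_ne_self (z : ℕ → ℕ → ℤ) (hk : k ≤ N) : z ≠ jumpRight N z k j := by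
  intro h
  have := congrFun (congrFun h k) j
  rw [jumpRight_apply_self z hk] at this
  omega

theorem jumpLeft_ne_self (z : ℕ → ℕ → ℤ) (hk : k ≤ N) (hj : j ≤ (k + 1) / 2) :
    z ≠ jumpLeft N z k j := by
  intro h
  have := congrFun (congrFun h k) j
  rw [jumpLeft_apply_self z hk hj] at this
  omega

/-- Turns the description of the cascade along a column into a recursion: the last level reacts to
the level just above it. Here `n` is arbitrary, since only left pushes ask whether the particle
exists. -/
theorem jumpRight_last (z : ℕ → ℕ → ℤ) (hk : k ≤ N) (n : ℕ) :
    jumpRight (N + 1) z k j (N + 1) = pushLevel n (z N) (jumpRight (N + 1) z k j N) (z (N + 1)) := by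
  by_cases hc : ∀ m, k ≤ m → m < N → z (m + 1) j = z m j
  · have hN : jumpRight (N + 1) z k j N = z N + Pi.single j 1 := by
      funext i
      rw [jumpRight, Pi.add_apply]
      by_cases hi : i = j
      · subst hi
        rw [if_pos ⟨hk, by omega, rfl, hc⟩, Pi.single_eq_same]
      · rw [if_neg (by tauto), Pi.single_eq_of_ne hi, add_zero]
    rw [pushLevel_right hN]
    funext i
    rw [jumpRight]
    by_cases hi : i = j
    · subst hi
      by_cases hz : z N i = z (N + 1) i
      · rw [if_pos hz, if_pos, Pi.add_apply, Pi.single_eq_same]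
        refine ⟨by omega, le_rfl, rfl, fun m h1 h2 => ?_⟩
        rcases Nat.lt_succ_iff_lt_or_eq.1 h2 with h | rfl
        · exact hc m h1 h
        · exact hz.symm
      · rw [if_neg hz, if_neg]
        rintro ⟨-, -, -, h⟩
        exact hz (h N hk (by omega)).symm
    · rw [if_neg (by tauto)]
      split_ifs
      · rw [Pi.add_apply, Pi.single_eq_of_ne hi, add_zero]
      · rfl
  · have hN : jumpRight (N + 1) z k j N = z N := by
      funext i
      exact if_neg fun h => hc h.2.2.2
    rw [hN, pushLevel_self]
    funext i
    exact if_neg fun h => hc fun m h1 h2 => h.2.2.2 m h1 (by omega)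

/-- The same recursion along a diagonal. Testing existence at the last level suffices, because
existence there implies existence at the earlier places of the diagonal. -/
theorem jumpLeft_last (z : ℕ → ℕ → ℤ) (hk : k ≤ N) (hj : 1 ≤ j) :
    jumpLeft (N + 1) z k j (N + 1)
      = pushLevel ((N + 1 + 1) / 2) (z N) (jumpLeft (N + 1) z k j N) (z (N + 1)) := by
  have hsub : N + 1 - k = N - k + 1 := by omega
  by_cases hc : j + (N - k) ≤ (N + 1) / 2 ∧
      ∀ m, m < N - k → z (k + m + 1) (j + m + 1) = z (k + m) (j + m)
  · have hN : z N = jumpLeft (N + 1) z k j N + Pi.single (j + (N - k)) 1 := by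
      funext i
      rw [Pi.add_apply, jumpLeft]
      by_cases hi : i = j + (N - k)
      · subst hi
        rw [if_pos ⟨hk, by omega, rfl, hc⟩, Pi.single_eq_same]
        ring
      · rw [if_neg (by tauto), Pi.single_eq_of_ne hi, add_zero]
    rw [pushLevel_left (by omega) hN]
    funext i
    rw [jumpLeft]
    by_cases hi : i = j + (N - k) + 1
    · subst hi
      by_cases hz : z N (j + (N - k)) = z (N + 1) (j + (N - k) + 1) ∧
          j + (N - k) + 1 ≤ (N + 1 + 1) / 2
      · rw [if_pos hz, if_pos, Pi.sub_apply, Pi.single_eq_same]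
        refine ⟨by omega, le_rfl, by omega, hz.2, fun m hm => ?_⟩
        rw [hsub] at hm
        rcases Nat.lt_succ_iff_lt_or_eq.1 hm with h | rfl
        · exact hc.2 m h
        · rw [show k + (N - k) = N by omega]
          exact hz.1.symm
      · rw [if_neg hz, if_neg]
        rintro ⟨-, -, -, h1, h2⟩
        refine hz ⟨?_, h1⟩
        have := h2 (N - k) (by omega)
        rw [show k + (N - k) = N by omega] at this
        exact this.symm
    · rw [if_neg (by omega)]
      split_ifs
      · rw [Pi.sub_apply, Pi.single_eq_of_ne hi, sub_zero]
      · rfl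
  · have hN : jumpLeft (N + 1) z k j N = z N := by
      funext i
      refine if_neg ?_
      rintro ⟨-, -, rfl, h⟩
      exact hc h
    rw [hN, pushLevel_self]
    funext i
    refine if_neg ?_
    rintro ⟨-, -, rfl, h1, h2⟩
    exact hc ⟨by omega, fun m hm => h2 m (by omega)⟩

theorem jumpRight_trunc (p : SympPattern (N + 1)) {l : ℕ} (hl : l ≤ N) :
    jumpRight N p.trunc.entry k j l = jumpRight (N + 1) p.entry k j l := by
  funext i
  have h : (k ≤ l ∧ l ≤ N ∧ i = j ∧ ∀ m, k ≤ m → m < l → p.trunc.entry (m + 1) j = p.trunc.entry m j)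
      ↔ (k ≤ l ∧ l ≤ N + 1 ∧ i = j ∧ ∀ m, k ≤ m → m < l → p.entry (m + 1) j = p.entry m j) := by
    have h0 : (∀ m, k ≤ m → m < l → p.trunc.entry (m + 1) j = p.trunc.entry m j)
        ↔ ∀ m, k ≤ m → m < l → p.entry (m + 1) j = p.entry m j := by
      refine forall_congr' fun m => forall_congr' fun _ => forall_congr' fun hm => ?_
      rw [p.trunc_entry (by omega), p.trunc_entry (by omega)]
    rw [h0]
    have : l ≤ N + 1 := by omega
    tauto
  simp only [jumpRight, h, p.trunc_entry hl]

theorem jumpLeft_trunc (p : SympPattern (N + 1)) {l : ℕ} (hl : l ≤ N) :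
    jumpLeft N p.trunc.entry k j l = jumpLeft (N + 1) p.entry k j l := by
  funext i
  have h : (k ≤ l ∧ l ≤ N ∧ i = j + (l - k) ∧ i ≤ (l + 1) / 2 ∧ ∀ m, m < l - k →
        p.trunc.entry (k + m + 1) (j + m + 1) = p.trunc.entry (k + m) (j + m))
      ↔ (k ≤ l ∧ l ≤ N + 1 ∧ i = j + (l - k) ∧ i ≤ (l + 1) / 2 ∧ ∀ m, m < l - k →
        p.entry (k + m + 1) (j + m + 1) = p.entry (k + m) (j + m)) := by
    have h0 : (∀ m, m < l - k →
        p.trunc.entry (k + m + 1) (j + m + 1) = p.trunc.entry (k + m) (j + m))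
        ↔ ∀ m, m < l - k → p.entry (k + m + 1) (j + m + 1) = p.entry (k + m) (j + m) := by
      refine forall_congr' fun m => forall_congr' fun hm => ?_
      rw [p.trunc_entry (by omega), p.trunc_entry (by omega)]
    rw [h0]
    have : l ≤ N + 1 := by omega
    tauto
  simp only [jumpLeft, h, p.trunc_entry hl]

theorem entry_eq_iff_trunc {w : SympPattern (N + 1)} {f g : ℕ → ℕ → ℤ}
    (hfg : ∀ l, l ≤ N → g l = f l) (hf : ∀ l, N + 1 < l → f l = 0) (hg : ∀ l, N < l → g l = 0) :
    w.entry = f ↔ w.trunc.entry = g ∧ w.entry (N + 1) = f (N + 1) := by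
  constructor
  · rintro h
    refine ⟨?_, by rw [h]⟩
    funext l
    by_cases hl : l ≤ N
    · rw [w.trunc_entry hl, hfg l hl, h]
    · rw [SympPattern.entry_of_lt _ (by omega), hg l (by omega)]
  · rintro ⟨h1, h2⟩
    funext l
    rcases lt_trichotomy l (N + 1) with hl | rfl | hl
    · rw [← w.trunc_entry (by omega), h1, hfg l (by omega)]
    · exact h2
    · rw [SympPattern.entry_of_lt _ hl, hf l hl]

theorem jumpRight_of_lt (p : SympPattern N) {l : ℕ} (hl : N < l) :
    jumpRight N p.entry k j l = 0 := by
  funext i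
  rw [jumpRight, if_neg (by omega), p.entry_of_lt hl]

theorem jumpLeft_of_lt (p : SympPattern N) {l : ℕ} (hl : N < l) :
    jumpLeft N p.entry k j l = 0 := by
  funext i
  rw [jumpLeft, if_neg (by omega), p.entry_of_lt hl]

theorem entry_eq_jumpRight_iff (p w : SympPattern (N + 1)) (hk : k ≤ N) :
    w.entry = jumpRight (N + 1) p.entry k j ↔ w.trunc.entry = jumpRight N p.trunc.entry k j ∧
      w.entry (N + 1) = pushLevel ((N + 1 + 1) / 2) (p.entry N) (w.entry N) (p.entry (N + 1)) := by
  rw [entry_eq_iff_trunc (g := jumpRight N p.trunc.entry k j) (fun l hl => jumpRight_trunc p hl)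
    (fun l hl => jumpRight_of_lt p hl) (fun l hl => jumpRight_of_lt p.trunc hl)]
  refine and_congr_right fun h => ?_
  rw [jumpRight_last p.entry hk ((N + 1 + 1) / 2), ← jumpRight_trunc p le_rfl, ← h,
    w.trunc_entry le_rfl]

theorem entry_eq_jumpLeft_iff (p w : SympPattern (N + 1)) (hk : k ≤ N) (hj : 1 ≤ j) :
    w.entry = jumpLeft (N + 1) p.entry k j ↔ w.trunc.entry = jumpLeft N p.trunc.entry k j ∧
      w.entry (N + 1) = pushLevel ((N + 1 + 1) / 2) (p.entry N) (w.entry N) (p.entry (N + 1)) := by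
  rw [entry_eq_iff_trunc (g := jumpLeft N p.trunc.entry k j) (fun l hl => jumpLeft_trunc p hl)
    (fun l hl => jumpLeft_of_lt p hl) (fun l hl => jumpLeft_of_lt p.trunc hl)]
  refine and_congr_right fun h => ?_
  rw [jumpLeft_last p.entry hk hj, ← jumpLeft_trunc p le_rfl, ← h, w.trunc_entry le_rfl]

theorem entry_eq_jumpRight_last_iff (p w : SympPattern (N + 1)) :
    w.entry = jumpRight (N + 1) p.entry (N + 1) j ↔ w.trunc = p.trunc ∧
      w.entry (N + 1) = p.entry (N + 1) + Pi.single j 1 := by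
  rw [entry_eq_iff_trunc (g := p.trunc.entry) ?_ (fun l hl => jumpRight_of_lt p hl)
    (fun l hl => p.trunc.entry_of_lt hl), SympPattern.ext_iff]
  · refine and_congr_right fun h => ?_
    have : jumpRight (N + 1) p.entry (N + 1) j (N + 1) = p.entry (N + 1) + Pi.single j 1 := by
      funext i
      rw [Pi.add_apply]
      by_cases hi : i = j
      · subst hi
        rw [jumpRight_apply_self _ le_rfl, Pi.single_eq_same]
      · rw [jumpRight, if_neg (by tauto), Pi.single_eq_of_ne hi, add_zero]
    rw [this]
  · intro l hl
    rw [p.trunc_entry hl]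
    funext i
    rw [jumpRight, if_neg (by omega)]

theorem entry_eq_jumpLeft_last_iff (p w : SympPattern (N + 1)) (hj : j ≤ (N + 1 + 1) / 2) :
    w.entry = jumpLeft (N + 1) p.entry (N + 1) j ↔ w.trunc = p.trunc ∧
      p.entry (N + 1) = w.entry (N + 1) + Pi.single j 1 := by
  rw [entry_eq_iff_trunc (g := p.trunc.entry) ?_ (fun l hl => jumpLeft_of_lt p hl)
    (fun l hl => p.trunc.entry_of_lt hl), SympPattern.ext_iff]
  · refine and_congr_right fun h => ?_
    have : jumpLeft (N + 1) p.entry (N + 1) j (N + 1) = p.entry (N + 1) - Pi.single j 1 := by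
      funext i
      rw [Pi.sub_apply]
      by_cases hi : i = j
      · subst hi
        rw [jumpLeft_apply_self _ le_rfl hj, Pi.single_eq_same]
      · rw [jumpLeft, if_neg (by omega), Pi.single_eq_of_ne hi, sub_zero]
    rw [this, eq_sub_iff_add_eq, eq_comm]
  · intro l hl
    rw [p.trunc_entry hl]
    funext i
    rw [jumpLeft, if_neg (by omega)]

variable {a : ℕ → ℝ} {q : ℝ}

open Classical in
/-- The rates on patterns in terms of the levels above the bottom level. -/
theorem patternRate_succ (p w : SympPattern (N + 1)) :
    patternRate (N + 1) a q p w
      = (if w.entry (N + 1) = pushLevel ((N + 1 + 1) / 2) (p.entry N) (w.entry N) (p.entry (N + 1))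
          then 1 else 0) * patternRate N a q p.trunc w.trunc
        + (if w.trunc = p.trunc then ownRate a q (N + 1) (p.entry N) (p.entry (N + 1)) (w.entry (N + 1))
          else 0) := by
  have hrf : ∀ k ∈ Finset.Icc 1 N, ∀ j,
      rightFactor q (p.trunc.entry k) (p.trunc.entry (k - 1)) j
        = rightFactor q (p.entry k) (p.entry (k - 1)) j := by
    intro k hk j
    have := Finset.mem_Icc.1 hk
    rw [p.trunc_entry (by omega), p.trunc_entry (by omega)]
  have hlf : ∀ k ∈ Finset.Icc 1 N, ∀ j,
      leftFactor q (p.trunc.entry k) (p.trunc.entry (k - 1)) j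
        = leftFactor q (p.entry k) (p.entry (k - 1)) j := by
    intro k hk j
    have := Finset.mem_Icc.1 hk
    rw [p.trunc_entry (by omega), p.trunc_entry (by omega)]
  by_cases hw : w = p
  · subst hw
    rw [pushLevel_self, if_pos rfl, if_pos rfl, one_mul, patternRate, patternRate, if_pos rfl,
      if_pos rfl, ownRate_self, Finset.sum_Icc_succ_top (by omega), neg_add, add_tsub_cancel_right]
    congr 2
    refine Finset.sum_congr rfl fun k hk => Finset.sum_congr rfl fun j _ => ?_
    rw [hrf k hk, hlf k hk]
  rw [patternRate, if_neg hw, Finset.sum_Icc_succ_top (by omega), add_tsub_cancel_right]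
  congr 1
  -- A jump that starts at a level up to `N` always changes the truncation. If the truncations
  -- agree, such jumps contribute nothing, and the indicator on the right is 0.
  · by_cases hw' : w.trunc = p.trunc
    · have hne : w.entry (N + 1) ≠ p.entry (N + 1) := fun h => hw (SympPattern.ext_trunc hw' h)
      have hN : w.entry N = p.entry N := by
        rw [← w.trunc_entry le_rfl, hw', p.trunc_entry le_rfl]
      rw [hN, pushLevel_self, if_neg hne, zero_mul]
      refine Finset.sum_eq_zero fun k hk => Finset.sum_eq_zero fun j hj => ?_
      obtain ⟨hk1, hk2⟩ := Finset.mem_Icc.1 hk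
      obtain ⟨hj1, hj2⟩ := Finset.mem_Icc.1 hj
      rw [if_neg, if_neg, add_zero]
      · rw [entry_eq_jumpLeft_iff p w hk2 hj1, hw']
        exact fun h => jumpLeft_ne_self _ hk2 hj2 h.1
      · rw [entry_eq_jumpRight_iff p w hk2, hw']
        exact fun h => jumpRight_ne_self _ hk2 h.1
    · rw [patternRate, if_neg hw', Finset.mul_sum]
      refine Finset.sum_congr rfl fun k hk => ?_
      rw [Finset.mul_sum]
      refine Finset.sum_congr rfl fun j hj => ?_
      obtain ⟨hk1, hk2⟩ := Finset.mem_Icc.1 hk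
      obtain ⟨hj1, hj2⟩ := Finset.mem_Icc.1 hj
      rw [hrf k hk, hlf k hk, entry_eq_jumpRight_iff p w hk2, entry_eq_jumpLeft_iff p w hk2 hj1]
      by_cases hp : w.entry (N + 1)
          = pushLevel ((N + 1 + 1) / 2) (p.entry N) (w.entry N) (p.entry (N + 1))
      · simp only [hp, and_true, if_true, one_mul]
      · simp only [hp, and_false, if_false, zero_mul, add_zero]
  · by_cases hw' : w.trunc = p.trunc
    · have hne : w.entry (N + 1) ≠ p.entry (N + 1) := fun h => hw (SympPattern.ext_trunc hw' h)
      rw [if_pos hw', ownRate, if_neg hne]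
      refine Finset.sum_congr rfl fun j hj => ?_
      rw [entry_eq_jumpRight_last_iff, entry_eq_jumpLeft_last_iff p w (Finset.mem_Icc.1 hj).2]
      simp only [hw', true_and]
    · rw [if_neg hw']
      refine Finset.sum_eq_zero fun j hj => ?_
      rw [entry_eq_jumpRight_last_iff, entry_eq_jumpLeft_last_iff p w (Finset.mem_Icc.1 hj).2,
        if_neg (fun h => hw' h.1), if_neg (fun h => hw' h.1), add_zero]

theorem patternWeight_succ (p : SympPattern (N + 1)) :
    patternWeight (N + 1) a q p
      = patternWeight N a q p.trunc * extSliceWeight a q (N + 1) (p.entry N) (p.entry (N + 1)) := by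
  have h := sliceWeight_eq_extSliceWeight (a := a) (q := q) p.interlaces
  change sliceWeight a q (N + 1) (p.trunc.entry N) (p.entry (N + 1))
    = extSliceWeight a q (N + 1) (p.trunc.entry N) (p.entry (N + 1)) at h
  rw [p.trunc_entry le_rfl] at h
  rw [patternWeight, patternWeight, Finset.prod_Icc_succ_top (by omega), add_tsub_cancel_right, h]
  congr 1
  refine Finset.prod_congr rfl fun k hk => ?_
  have := Finset.mem_Icc.1 hk
  rw [p.trunc_entry (by omega), p.trunc_entry (by omega)]

/-- The weights intertwine the rates on patterns and the rates on shapes. -/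
theorem sum_patternWeight_mul_patternRate (hq0 : 0 < q) (hq1 : q < 1) (N : ℕ)
    (ha : ∀ k, 1 ≤ k → k ≤ N → extParam a k ≠ 0) (y' : Shape ((N + 1) / 2)) (w : SympPattern N) :
    ∑ p ∈ patternFibre N y', patternWeight N a q p * patternRate N a q p w
      = patternWeight N a q w * levelRate N a q y' (w.bottom rfl) := by
  classical
  induction N with
  -- Without levels there is one shape, and all rates are 0.
  | zero =>
    have h1 : ∀ p, patternRate 0 a q p w = 0 := by
      intro p
      rw [patternRate]
      split_ifs <;> simp
    have h2 : w.bottom rfl = y' := by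
      apply Shape.ext
      funext j
      rw [y'.support j (by omega)]
      exact w.support 0 j (by omega)
    simp [h1, levelRate, h2, diagRate]
  | succ N ih =>
    have ih' := ih (fun k h1 h2 => ha k h1 (by omega))
    -- With the bottom level fixed to `y'`, the summand depends on the truncation only.
    let g : SympPattern N → ℝ := fun p => patternWeight N a q p
      * extSliceWeight a q (N + 1) (p.entry N) y'.part
      * ((if w.entry (N + 1) = pushLevel ((N + 1 + 1) / 2) (p.entry N) (w.entry N) y'.part
          then 1 else 0) * patternRate N a q p w.trunc
        + (if w.trunc = p then ownRate a q (N + 1) (p.entry N) y'.part (w.entry (N + 1))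
          else 0))
    have hg : ∀ p ∈ patternFibre (N + 1) y',
        patternWeight (N + 1) a q p * patternRate (N + 1) a q p w = g p.trunc := by
      intro p hp
      rw [patternWeight_succ, patternRate_succ, mem_patternFibre.1 hp]
      simp only [g, p.trunc_entry le_rfl]
    have hwN : (w.trunc.bottom rfl : Shape ((N + 1) / 2)).part = w.entry N :=
      w.trunc_entry le_rfl
    have hwN' : (w.bottom rfl : Shape ((N + 1 + 1) / 2)).part = w.entry (N + 1) := rfl
    have hinner : ∀ x ∈ interlacingShapes y', ∑ p ∈ patternFibre N x, g p
        = patternWeight N a q w.trunc * (extSliceWeight a q (N + 1) x.part y'.part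
          * ((if w.entry (N + 1) = pushLevel ((N + 1 + 1) / 2) x.part (w.entry N) y'.part
          then 1 else 0) * levelRate N a q x (w.trunc.bottom rfl)))
        + if w.trunc.bottom rfl = x then patternWeight N a q w.trunc
          * (extSliceWeight a q (N + 1) x.part y'.part
            * ownRate a q (N + 1) x.part y'.part (w.entry (N + 1))) else 0 := by
      intro x _
      have h1 : ∀ p ∈ patternFibre N x, g p = extSliceWeight a q (N + 1) x.part y'.part
          * (if w.entry (N + 1) = pushLevel ((N + 1 + 1) / 2) x.part (w.entry N) y'.part
            then 1 else 0) * (patternWeight N a q p * patternRate N a q p w.trunc)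
          + if w.trunc = p then patternWeight N a q p * (extSliceWeight a q (N + 1) x.part y'.part
            * ownRate a q (N + 1) x.part y'.part (w.entry (N + 1))) else 0 := by
        intro p hp
        simp only [g, mem_patternFibre.1 hp]
        split_ifs <;> ring
      rw [Finset.sum_congr rfl h1, Finset.sum_add_distrib, ← Finset.mul_sum, ih' x w.trunc,
        Finset.sum_ite_eq]
      simp only [mem_patternFibre_iff_bottom rfl]
      ring
    have hbal := twoLevel_balance hq0 hq1 (ha (N + 1) (by omega) le_rfl) w.interlaces
      (X := interlacingShapes y') (fun x => mem_interlacingShapes)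
    rw [hwN, hwN'] at hbal
    rw [Finset.sum_congr rfl hg, sum_patternFibre_succ, Finset.sum_congr rfl hinner,
      Finset.sum_add_distrib, ← Finset.mul_sum, Finset.sum_ite_eq, patternWeight_succ, mul_assoc,
      ← hbal, hwN, mul_add]
    congr 1
    -- If the level above `w`'s bottom does not interlace with `y'`, the own term is missing from
    -- the sum, and it has weight 0 in the balance equation.
    split_ifs with hmem
    · rfl
    · rw [mem_interlacingShapes] at hmem
      rw [← hwN, extSliceWeight_eq_zero hmem, zero_mul, mul_zero]

end Jumps

/-! ### The jumps with positive rate lead to patterns -/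

section Validity

variable {N k j : ℕ} {q : ℝ}

theorem SympPattern.lower' (p : SympPattern N) {k j : ℕ} (hk : k < N) (hj : 1 ≤ j) :
    p.entry k j ≤ p.entry (k + 1) j := by
  by_cases h : 1 ≤ k
  · exact p.lower k j h hk hj
  · rw [p.support k j (by omega)]
    exact p.nonneg _ _

theorem SympPattern.upper' (p : SympPattern N) {k j : ℕ} (hk : k < N) (hj : 1 ≤ j) :
    p.entry (k + 1) (j + 1) ≤ p.entry k j := by
  by_cases h : 1 ≤ k
  · exact p.upper k j h hk hj
  · rw [p.support (k + 1) (j + 1) (by omega)]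
    exact p.nonneg _ _

/-- A nonzero rate means that the level above does not block the jump, and pushing preserves the
interlacing below. Hence no rate is lost in `patternRate`, which counts only jumps that end in a
pattern. -/
theorem exists_eq_jumpRight (p : SympPattern N) (hk1 : 1 ≤ k) (hk : k ≤ N) (hj1 : 1 ≤ j)
    (hj : j ≤ (k + 1) / 2) (h : rightFactor q (p.entry k) (p.entry (k - 1)) j ≠ 0) :
    ∃ w : SympPattern N, w.entry = jumpRight N p.entry k j := by
  have hgap : j ≠ 1 → p.entry k j < p.entry (k - 1) (j - 1) := by
    intro hj0
    have h1 := left_ne_zero_of_mul h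
    rw [if_neg hj0] at h1
    have h2 := p.upper' (k := k - 1) (j := j - 1) (by omega) (by omega)
    rw [show k - 1 + 1 = k by omega, show j - 1 + 1 = j by omega] at h2
    refine lt_of_le_of_ne h2 fun h3 => h1 ?_
    rw [h3, sub_self, zpow_zero, sub_self]
  have hge : ∀ l i, p.entry l i ≤ jumpRight N p.entry k j l i := by
    intro l i
    rw [jumpRight]
    split_ifs
    · omega
    · exact le_rfl
  have hmono : ∀ d, k - 1 + d ≤ N → j ≠ 1 → p.entry (k - 1) (j - 1) ≤ p.entry (k - 1 + d) (j - 1) := by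
    intro d hd hj0
    induction d with
    | zero => exact le_rfl
    | succ d ih => exact (ih (by omega)).trans (p.lower' (by omega) (by omega))
  refine ⟨⟨jumpRight N p.entry k j, fun l i => (p.nonneg l i).trans (hge l i), ?_, ?_, ?_⟩, rfl⟩
  · intro l i hli
    rw [jumpRight, if_neg, p.support l i hli]
    rintro ⟨h1, h2, rfl, -⟩
    omega
  · intro l i hl1 hl hi
    by_cases hm : k ≤ l ∧ l ≤ N ∧ i = j ∧ ∀ m, k ≤ m → m < l → p.entry (m + 1) j = p.entry m j
    · obtain ⟨h1, h2, rfl, h3⟩ := id hm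
      rw [jumpRight, if_pos hm]
      rcases (p.lower l i hl1 hl hi).lt_or_eq with h4 | h4
      · exact (show p.entry l i + 1 ≤ p.entry (l + 1) i by omega).trans (hge _ _)
      · rw [jumpRight, if_pos, h4]
        refine ⟨by omega, by omega, rfl, fun m h5 h6 => ?_⟩
        rcases Nat.lt_succ_iff_lt_or_eq.1 h6 with h7 | rfl
        · exact h3 m h5 h7
        · exact h4.symm
    · rw [jumpRight, if_neg hm]
      exact (p.lower l i hl1 hl hi).trans (hge _ _)
  · intro l i hl1 hl hi
    refine le_trans ?_ (hge l i)
    rw [jumpRight]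
    split_ifs with hm
    · obtain ⟨h1, h2, rfl, h3⟩ := hm
      -- The pushed particles all stand at the height of the first one, while the column to the left
      -- only increases with the level, so the initial gap persists.
      have hconst : ∀ d, k + d ≤ l + 1 → p.entry (k + d) (i + 1) = p.entry k (i + 1) := by
        intro d hd
        induction d with
        | zero => rfl
        | succ d ih => exact (h3 (k + d) (by omega) (by omega)).trans (ih (by omega))
      have h4 := hconst (l + 1 - k) (by omega)
      rw [show k + (l + 1 - k) = l + 1 by omega] at h4
      have h5 := hgap (by omega)
      have h6 := hmono (l - (k - 1)) (by omega) (by omega)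
      rw [show k - 1 + (l - (k - 1)) = l by omega, add_tsub_cancel_right] at h6
      rw [add_tsub_cancel_right] at h5
      omega
    · exact p.upper l i hl1 hl hi

theorem exists_eq_jumpLeft (p : SympPattern N) (hk1 : 1 ≤ k) (hk : k ≤ N) (hj1 : 1 ≤ j)
    (h : leftFactor q (p.entry k) (p.entry (k - 1)) j ≠ 0) :
    ∃ w : SympPattern N, w.entry = jumpLeft N p.entry k j := by
  have hgap : p.entry (k - 1) j < p.entry k j := by
    have h1 := left_ne_zero_of_mul h
    have h2 := p.lower' (k := k - 1) (by omega) hj1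
    rw [show k - 1 + 1 = k by omega] at h2
    refine lt_of_le_of_ne h2 fun h3 => h1 ?_
    rw [h3, sub_self, zpow_zero, sub_self]
  have hle : ∀ l i, jumpLeft N p.entry k j l i ≤ p.entry l i := by
    intro l i
    rw [jumpLeft]
    split_ifs
    · omega
    · exact le_rfl
  -- The neighbouring diagonal stays at or below `p.entry (k - 1) j`, which lies strictly below the
  -- common height of the pushed particles.
  have hdiag : ∀ d, k + d ≤ N → p.entry (k + d) (j + d + 1) ≤ p.entry (k - 1) j := by
    intro d hd
    induction d with
    | zero =>
      have := p.upper' (k := k - 1) (by omega) hj1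
      rwa [show k - 1 + 1 = k by omega] at this
    | succ d ih =>
      exact (p.upper' (k := k + d) (j := j + d + 1) (by omega) (by omega)).trans (ih (by omega))
  have hconst : ∀ l, k ≤ l → (∀ m, m < l - k →
      p.entry (k + m + 1) (j + m + 1) = p.entry (k + m) (j + m)) →
      p.entry l (j + (l - k)) = p.entry k j := by
    intro l hl hc
    have : ∀ d, d ≤ l - k → p.entry (k + d) (j + d) = p.entry k j := by
      intro d hd
      induction d with
      | zero => rfl
      | succ d ih => exact (hc d (by omega)).trans (ih (by omega))
    have h1 := this (l - k) le_rfl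
    rwa [show k + (l - k) = l by omega] at h1
  have hpos := p.nonneg (k - 1) j
  refine ⟨⟨jumpLeft N p.entry k j, ?_, ?_, ?_, ?_⟩, rfl⟩
  · intro l i
    rw [jumpLeft]
    split_ifs with hm
    · obtain ⟨h1, h2, rfl, h3, h4⟩ := hm
      rw [hconst l h1 h4]
      omega
    · exact p.nonneg l i
  · intro l i hli
    rw [jumpLeft, if_neg (by omega), p.support l i hli]
  · intro l i hl1 hl hi
    refine (hle l i).trans ?_
    rw [jumpLeft]
    split_ifs with hm
    · obtain ⟨h1, h2, rfl, h3, h4⟩ := hm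
      rw [hconst (l + 1) h1 h4]
      by_cases hlk : l + 1 = k
      · subst hlk
        rw [add_tsub_cancel_right] at hgap
        rw [tsub_self, add_zero]
        omega
      · have h5 := hdiag (l - k) (by omega)
        rw [show k + (l - k) = l by omega, show j + (l - k) + 1 = j + (l + 1 - k) by omega] at h5
        omega
    · exact p.lower l i hl1 hl hi
  · intro l i hl1 hl hi
    have hup := p.upper l i hl1 hl hi
    by_cases hm : k ≤ l ∧ l ≤ N ∧ i = j + (l - k) ∧ i ≤ (l + 1) / 2 ∧
        ∀ m, m < l - k → p.entry (k + m + 1) (j + m + 1) = p.entry (k + m) (j + m)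
    · rw [jumpLeft.eq_1 N p.entry k j l i, if_pos hm]
      obtain ⟨h1, h2, rfl, h3, h4⟩ := hm
      have h5 := hconst l h1 h4
      rcases hup.lt_or_eq with h6 | h6
      · have := hle (l + 1) (j + (l - k) + 1)
        omega
      · have h7 : j + (l - k) + 1 ≤ (l + 1 + 1) / 2 := by
          by_contra h8
          rw [p.support (l + 1) _ (by omega)] at h6
          omega
        rw [jumpLeft, if_pos, h6]
        refine ⟨by omega, by omega, by omega, h7, fun m hm => ?_⟩
        by_cases hml : m < l - k
        · exact h4 m hml
        · obtain rfl : m = l - k := by omega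
          rw [show k + (l - k) = l by omega]
          exact h6
    · rw [jumpLeft.eq_1 N p.entry k j l i, if_neg hm]
      exact (hle _ _).trans hup

end Validity

/-! ### The total rates of the process on patterns -/

section TotalRates

variable {N : ℕ}

instance : Countable (SympPattern N) := by
  let F : SympPattern N → Fin (N + 1) × Fin (N + 1) → ℤ := fun p x => p.entry x.1 x.2
  refine Function.Injective.countable (f := F) fun p p' h => ?_
  apply SympPattern.ext
  funext k j
  by_cases hkj : k ≤ N ∧ j ≤ N
  · exact congrFun h (⟨k, by omega⟩, ⟨j, by omega⟩)
  · rw [p.support k j (by omega), p'.support k j (by omega)]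

theorem SympPattern.entry_le_bottom_one (p : SympPattern N) (k j : ℕ) :
    p.entry k j ≤ p.entry N 1 := by
  refine (p.entry_le_bottom k j).trans ?_
  by_cases hj : 1 ≤ j
  · induction j, hj using Nat.le_induction with
    | base => exact le_rfl
    | succ j hj ih => exact ((p.bottom (n := (N + 1) / 2) rfl).antitone j hj).trans ih
  · rw [p.support N j (by omega)]
    exact p.nonneg N 1

theorem SympPattern.finite_setOf_le (N : ℕ) (B : ℤ) : {p : SympPattern N | p.entry N 1 ≤ B}.Finite := by
  let F : {p : SympPattern N | p.entry N 1 ≤ B} →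
      ((x : Fin (N + 1) × Fin (N + 1)) → Set.Icc (0 : ℤ) B) :=
    fun p x => ⟨p.1.entry x.1 x.2, p.1.nonneg _ _, (p.1.entry_le_bottom_one _ _).trans p.2⟩
  refine Set.finite_coe_iff.1 (Finite.of_injective F ?_)
  intro p p' h
  apply Subtype.ext
  apply SympPattern.ext
  funext k j
  by_cases hkj : k ≤ N ∧ j ≤ N
  · exact congrArg Subtype.val (congrFun h (⟨k, by omega⟩, ⟨j, by omega⟩))
  · rw [p.1.support k j (by omega), p'.1.support k j (by omega)]

/-- The patterns whose entries are at most `B`. -/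
noncomputable def boundedPatterns (N : ℕ) (B : ℤ) : Finset (SympPattern N) :=
  (SympPattern.finite_setOf_le N B).toFinset

theorem mem_boundedPatterns {B : ℤ} {p : SympPattern N} :
    p ∈ boundedPatterns N B ↔ p.entry N 1 ≤ B :=
  Set.Finite.mem_toFinset _

open Classical in
/-- The shapes that are reached from the shape `z` by at most one jump, and possibly some more. -/
noncomputable def nearbyShapes (N : ℕ) (z : Shape ((N + 1) / 2)) : Finset (Shape ((N + 1) / 2)) :=
  (boundedPatterns N (z.part 1 + 1)).image fun p => p.bottom rfl

theorem mem_nearbyShapes {z z' : Shape ((N + 1) / 2)} :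
    z' ∈ nearbyShapes N z ↔ z'.part 1 ≤ z.part 1 + 1 := by
  classical
  rw [nearbyShapes, Finset.mem_image]
  constructor
  · rintro ⟨p, hp, rfl⟩
    exact mem_boundedPatterns.1 hp
  · intro h
    have hz : (z'.toPattern N).entry N = z'.part := z'.toPattern_entry_last rfl
    exact ⟨z'.toPattern N, mem_boundedPatterns.2 (by rwa [hz]), Shape.ext hz⟩

theorem sum_nearbyShapes (z : Shape ((N + 1) / 2)) (f : SympPattern N → ℝ) :
    ∑ z' ∈ nearbyShapes N z, ∑ p ∈ patternFibre N z', f p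
      = ∑ p ∈ boundedPatterns N (z.part 1 + 1), f p := by
  classical
  rw [← Finset.sum_fiberwise_of_maps_to (t := nearbyShapes N z)
    (g := fun p : SympPattern N => (p.bottom rfl : Shape ((N + 1) / 2)))]
  · refine Finset.sum_congr rfl fun z' hz' => Finset.sum_congr ?_ fun _ _ => rfl
    ext p
    rw [Finset.mem_filter, mem_patternFibre_iff_bottom rfl, mem_boundedPatterns]
    refine ⟨fun h => ⟨?_, h⟩, fun h => h.2⟩
    have h1 := mem_nearbyShapes.1 hz'
    rw [← h] at h1
    exact h1
  · intro p hp
    exact Finset.mem_image_of_mem _ hp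

-- For `r = 0` the target `f` need not be a pattern, so the validity of a jump is needed only when
-- its rate does not vanish.
open Classical in
theorem sum_boundedPatterns_ite {B : ℤ} {p : SympPattern N} {f : ℕ → ℕ → ℤ} {r : ℝ}
    (hB : f N 1 ≤ B) (hp : p.entry ≠ f) (h : r ≠ 0 → ∃ w : SympPattern N, w.entry = f) :
    ∑ w ∈ (boundedPatterns N B).erase p, (if w.entry = f then r else 0) = r := by
  by_cases hr : r = 0
  · simp [hr]
  · obtain ⟨w, hw⟩ := h hr
    rw [Finset.sum_eq_single_of_mem w, if_pos hw]
    · rw [Finset.mem_erase, mem_boundedPatterns]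
      exact ⟨fun h => hp (h ▸ hw), by rw [hw]; exact hB⟩
    · intro w' _ hne
      exact if_neg fun h' => hne (SympPattern.ext (h'.trans hw.symm))

/-- One jump raises the largest entry by at most 1, so all targets lie in the chosen finite set, and
jumps with nonzero rate do lead to patterns. -/
theorem sum_patternRate (a : ℕ → ℝ) (q : ℝ) (p : SympPattern N) :
    ∑ w ∈ boundedPatterns N (p.entry N 1 + 1), patternRate N a q p w = 0 := by
  classical
  have hmem : p ∈ boundedPatterns N (p.entry N 1 + 1) := mem_boundedPatterns.2 (by omega)
  have hoff : ∑ w ∈ (boundedPatterns N (p.entry N 1 + 1)).erase p, patternRate N a q p w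
      = ∑ k ∈ Finset.Icc 1 N, ∑ j ∈ Finset.Icc 1 ((k + 1) / 2),
        (extParam a k * rightFactor q (p.entry k) (p.entry (k - 1)) j
          + (extParam a k)⁻¹ * leftFactor q (p.entry k) (p.entry (k - 1)) j) := by
    have h1 : ∀ w ∈ (boundedPatterns N (p.entry N 1 + 1)).erase p, patternRate N a q p w
        = ∑ k ∈ Finset.Icc 1 N, ∑ j ∈ Finset.Icc 1 ((k + 1) / 2),
      ((if w.entry = jumpRight N p.entry k j then
          extParam a k * rightFactor q (p.entry k) (p.entry (k - 1)) j else 0)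
        + (if w.entry = jumpLeft N p.entry k j then
          (extParam a k)⁻¹ * leftFactor q (p.entry k) (p.entry (k - 1)) j else 0)) := by
      intro w hw
      rw [patternRate, if_neg (Finset.ne_of_mem_erase hw)]
    rw [Finset.sum_congr rfl h1, Finset.sum_comm]
    refine Finset.sum_congr rfl fun k hk => ?_
    rw [Finset.sum_comm]
    refine Finset.sum_congr rfl fun j hj => ?_
    obtain ⟨hk1, hk2⟩ := Finset.mem_Icc.1 hk
    obtain ⟨hj1, hj2⟩ := Finset.mem_Icc.1 hj
    rw [Finset.sum_add_distrib, sum_boundedPatterns_ite, sum_boundedPatterns_ite]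
    · rw [jumpLeft]
      split_ifs <;> omega
    · exact jumpLeft_ne_self _ hk2 hj2
    · exact fun h => exists_eq_jumpLeft p hk1 hk2 hj1 (right_ne_zero_of_mul h)
    · rw [jumpRight]
      split_ifs <;> omega
    · exact jumpRight_ne_self _ hk2
    · exact fun h => exists_eq_jumpRight p hk1 hk2 hj1 hj2 (right_ne_zero_of_mul h)
  rw [← Finset.add_sum_erase _ _ hmem, hoff, patternRate, if_pos rfl, neg_add_cancel]

end TotalRates

/-! ### The Gibbs kernel -/

section Gibbs

variable {N : ℕ} {a : ℕ → ℝ} {q : ℝ}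

theorem Phat_eq_sum {n : ℕ} (z : Shape n) :
    Phat N a q z = ∑ p ∈ patternFibre N z, patternWeight N a q p := by
  have h : {p : SympPattern N | p.entry N = z.part} = (patternFibre N z : Set (SympPattern N)) := by
    ext p
    exact mem_patternFibre.symm
  change ∑' p : ({p : SympPattern N | p.entry N = z.part} : Set (SympPattern N)),
    patternWeight N a q p.1 = _
  rw [h]
  exact Finset.tsum_subtype' (patternFibre N z) (patternWeight N a q)

theorem patternWeight_pos (hq0 : 0 < q) (hq1 : q < 1)
    (ha : ∀ k, 1 ≤ k → k ≤ N → 0 < extParam a k) (p : SympPattern N) :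
    0 < patternWeight N a q p := by
  refine Finset.prod_pos fun k hk => ?_
  obtain ⟨hk1, hk2⟩ := Finset.mem_Icc.1 hk
  refine mul_pos (mul_pos (zpow_pos (ha k hk1 hk2) _)
    (Finset.prod_pos fun i _ => qBinom_pos hq0 hq1 _ _)) ?_
  split_ifs
  · exact qBinom_pos hq0 hq1 _ _
  · exact one_pos

theorem Phat_pos (hq0 : 0 < q) (hq1 : q < 1) (ha : ∀ k, 1 ≤ k → k ≤ N → 0 < extParam a k)
    (z : Shape ((N + 1) / 2)) : 0 < Phat N a q z := by
  rw [Phat_eq_sum]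
  exact Finset.sum_pos (fun p _ => patternWeight_pos hq0 hq1 ha p)
    ⟨z.toPattern N, mem_patternFibre.2 (z.toPattern_entry_last rfl)⟩

theorem extParam_pos {n : ℕ} (h : (N + 1) / 2 = n) (ha : ∀ i, 1 ≤ i → i ≤ n → 0 < a i) (k : ℕ)
    (hk1 : 1 ≤ k) (hk : k ≤ N) : 0 < extParam a k := by
  rw [extParam]
  split_ifs with he
  · obtain ⟨l, rfl⟩ := he
    exact inv_pos.2 (ha _ (by omega) (by omega))
  · exact ha _ (by omega) (by omega)

theorem neg_diagRate_le {n : ℕ} (hn : 1 ≤ n) (ha : ∀ i, 1 ≤ i → i ≤ n → 0 < a i) (hq0 : 0 < q)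
    (z : Shape n) :
    -diagRate n N a q z.part ≤ ∑ i ∈ Finset.Icc 1 n, (a i + (a i)⁻¹) := by
  rw [diagRate]
  split_ifs
  · rw [neg_neg]
  · obtain ⟨m, rfl⟩ : ∃ m, n = m + 1 := ⟨n - 1, by omega⟩
    rw [Finset.sum_Icc_succ_top (by omega), add_tsub_cancel_right]
    have h1 := inv_pos.2 (ha (m + 1) (by omega) le_rfl)
    have h2 := mul_pos h1 (zpow_pos hq0 (z.part (m + 1)))
    linarith

/-- The Gibbs kernel intertwines the rates on patterns and the rates on shapes. -/
theorem gibbs_intertwines (hq0 : 0 < q) (hq1 : q < 1) (hN : 1 ≤ (N + 1) / 2)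
    (ha : ∀ i, 1 ≤ i → i ≤ (N + 1) / 2 → 0 < a i) :
    KernelIntertwines (fun p : SympPattern N => (p.bottom rfl : Shape ((N + 1) / 2)))
      (patternFibre N) (gibbsMass N a q) (patternRate N a q) (shapeRate N a q) (nearbyShapes N)
      (∑ i ∈ Finset.Icc 1 ((N + 1) / 2), (a i + (a i)⁻¹)) := by
  have hpos := extParam_pos rfl ha
  have hW := fun p => (patternWeight_pos hq0 hq1 hpos p).le
  have hP := Phat_pos hq0 hq1 hpos
  have hmass : ∀ z : Shape ((N + 1) / 2), ∀ p ∈ patternFibre N z,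
      gibbsMass N a q z p = patternWeight N a q p / Phat N a q z := fun z p hp =>
    if_pos (mem_patternFibre.1 hp)
  refine ⟨fun z p => mem_patternFibre_iff_bottom rfl, ?_, ?_, ?_, ?_, ?_, ?_, ?_⟩
  · intro z p
    rw [gibbsMass]
    split_ifs
    · exact div_nonneg (hW p) (hP z).le
    · exact le_rfl
  · intro z p h
    exact if_neg fun h' => h (Shape.ext h')
  · intro z
    rw [Finset.sum_congr rfl (hmass z), ← Finset.sum_div, ← Phat_eq_sum, div_self (hP z).ne']
  · intro z
    exact mem_nearbyShapes.2 (by omega)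
  · intro p
    rw [sum_nearbyShapes]
    exact sum_patternRate a q p
  · intro z x
    have h1 : ∑ p ∈ patternFibre N z, gibbsMass N a q z p * patternRate N a q p x
        = (∑ p ∈ patternFibre N z, patternWeight N a q p * patternRate N a q p x)
          / Phat N a q z := by
      rw [Finset.sum_div]
      refine Finset.sum_congr rfl fun p hp => ?_
      rw [hmass z p hp, div_mul_eq_mul_div]
    -- The Doob factor in `shapeRate` changes the normalisation at `z` into that at the bottom level
    -- of `x`; on the diagonal the two coincide.
    rw [h1, sum_patternWeight_mul_patternRate hq0 hq1 N (fun k h2 h3 => (hpos k h2 h3).ne'),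
      hmass _ x ((mem_patternFibre_iff_bottom rfl).2 rfl), levelRate, shapeRate, diagRate]
    have h2 := (hP z).ne'
    have h3 := (hP (x.bottom rfl)).ne'
    by_cases hz : x.bottom rfl = z
    · rw [if_pos hz, if_pos hz, hz]
      ring
    · rw [if_neg hz, if_neg hz]
      field_simp
  · intro z
    have := neg_diagRate_le (N := N) hN ha hq0 z
    rw [shapeRate, if_pos rfl]
    rwa [diagRate] at this

instance {n : ℕ} : DiscreteMeasurableSpace (Shape n) := ⟨fun _ => trivial⟩

instance : DiscreteMeasurableSpace (SympPattern N) := ⟨fun _ => trivial⟩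

end Gibbs

theorem mainTheorem3 {Ω : Type*} [MeasurableSpace Ω] (μ : Measure Ω) [IsProbabilityMeasure μ]
    (n N : ℕ) (hn : 1 ≤ n) (hN : N = 2 * n ∨ N = 2 * n - 1)
    (q : ℝ) (hq0 : 0 < q) (hq1 : q < 1)
    (a : ℕ → ℝ) (ha : ∀ i, 1 ≤ i → i ≤ n → 0 < a i)
    (z : Shape n) (Z : ℝ≥0 → Ω → SympPattern N)
    (hZ : IsMarkovChainWithRates μ Z (patternRate N a q))
    (hinit : ∀ p : SympPattern N, μ.real (Z 0 ⁻¹' {p}) = gibbsMass N a q z p) :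
    IsMarkovChainWithRates μ (bottomProcess (half_levels hn hN) Z) (shapeRate N a q) ∧
    (∀ᵐ ω ∂μ, bottomProcess (half_levels hn hN) Z 0 ω = z) ∧
    ∀ t : ℝ≥0, 0 < t → ∀ p : SympPattern N,
      μ[(Z t ⁻¹' {p}).indicator (fun _ => (1 : ℝ)) | pastSigma (bottomProcess (half_levels hn hN) Z) t]
        =ᵐ[μ] fun ω => gibbsMass N a q (bottomProcess (half_levels hn hN) Z t ω) p := by
  obtain rfl : n = (N + 1) / 2 := (half_levels hn hN).symm
  obtain ⟨h1, h2, h3⟩ := (gibbs_intertwines hq0 hq1 hn ha).isMarkovChainWithRates hZ hinit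
  exact ⟨h1, h2, fun t _ p => h3 t p⟩
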